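/- **Setting.** Fix a smooth partition function $\chi:\mathbb R\to\mathbb R$ ($\chi=0$ on $(-\infty,0]$, $\chi=1$ on $[1,\infty)$, $\chi'\ge 0$). Let $V=\{f\in C_b(\mathbb R): f_\xi\in L^2(\mathbb R)\}$ and $H_{0,\infty}(\mathbb R)=\{\bar u+c\chi:\bar u\in H^1(\mathbb R),\,c\in\mathbb R\}$, with their usual norms. For a finite positive Borel measure $\mu$ on $\mathbb R$ put $$y_\mu(\xi)=\sup\{y:\mu((-\infty,y))+y<\xi\}.$$ **Construction A (arbitrary limit at $+\infty$).** Let $\mathcal D$ be the set of pairs $(u,\mu)$ with $u\in H_{0,\infty}(\mathbb R)$ and $\mu$ a finite positive Borel measure with absolutely continuous part $\mu_{ac}=u_x^2\,dx$. Let $E=V\times H_{0,\infty}(\mathbb R)\times L^2(\mathbb R)$. For $X=(\zeta,U,h)\in E$ put $y=\mathrm{id}+\zeta$, let $c$ be the limit of $U$ at $+\infty$, $\bar U=U-c\,\chi\circ y$, $g(x)=\chi^2(x)+\tfrac12\int e^{-|x-z|}(2\chi'^2+2\chi\chi'')(z)\,dz$, $k(\xi,\eta)=e^{-\operatorname{sgn}(\xi-\eta)(y(\xi)-y(\eta))}$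 (which is $e^{-|y(\xi)-y(\eta)|}$ when $y$ is nondecreasing), and $$P(\xi)=\tfrac14\int k(\xi,\eta)\big((2\bar U^2+4c\bar U\chi\circ y)y_\xi+h\big)(\eta)\,d\eta+c^2g(y(\xi)),$$ $$Q(\xi)=-\tfrac14\int \operatorname{sgn}(\xi-\eta)k(\xi,\eta)\big((2\bar U^2+4c\bar U\chi\circ y)y_\xi+h\big)(\eta)\,d\eta+c^2g'(y(\xi)).$$ A *conservative solution* with initial data $(u_0,\mu_0)\in\mathcal D$ is a curve $t\mapsto(u(t),\mu_t)$, $t\ge0$, for which there is $X\in C^1([0,\infty),E)$ solving $$y_t=U,\qquad U_t=-Q,\qquad h_t=2(U^2-P)U_\xi,$$ with $y(0)=y_{\mu_0}$, $U(0)=u_0\circ y(0)$, $h(0)=1-y_\xi(0)$, such that for all $t\ge0$: $u(t,x)=U(t,\xi)$ whenever $x=y(t,\xi)$, and $\mu_t=y(t)_\#(h(t)\,d\xi)$. **Construction B (Holden–Raynaud, vanishing asymptotics).** Let $\tilde{\mathcal D}$ be the set of pairs $(\tilde u,\tilde\mu)$ with $\tilde u\in H^1(\mathbb R)$ and $\tilde\mu$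 a finite positive Borel measure with $\tilde\mu_{ac}=(\tilde u^2+\tilde u_x^2)\,dx$. For $(\zeta,U,H)\in V\times H^1(\mathbb R)\times V$ put $y=\mathrm{id}+\zeta$, take $k$ as above, and let $$P(\xi)=\tfrac14\int k(\xi,\eta)(U^2y_\xi+H_\xi)(\eta)\,d\eta,\qquad Q(\xi)=-\tfrac14\int\operatorname{sgn}(\xi-\eta)k(\xi,\eta)(U^2y_\xi+H_\xi)(\eta)\,d\eta.$$ A *Holden–Raynaud conservative solution* with initial data $(\tilde u_0,\tilde\mu_0)\in\tilde{\mathcal D}$ is a curve $t\mapsto(\tilde u(t),\tilde\mu_t)$, $t\ge0$, for which there is a $C^1$ curve $(\zeta,U,H)$ from $[0,\infty)$ to $V\times H^1(\mathbb R)\times V$ solving $$y_t=U,\qquad U_t=-Q,\qquad H_t=U^3-2PU,$$ with $y(0)=y_{\tilde\mu_0}$, $U(0)=\tilde u_0\circ y(0)$, $H(0)=\mathrm{id}-y(0)$, such that for all $t\ge0$: $\tilde u(t,x)=U(t,\xi)$ whenever $x=y(t,\xi)$, and $\tilde\mu_t=y(t)_\#(H_\xi(t)\,d\xi)$. **Theorem.**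 Let $(u_0,\mu_0)\in\mathcal D$ and $(\tilde u_0,\tilde\mu_0)\in\tilde{\mathcal D}$ be such that $u_0=\tilde u_0$ and $$\tilde\mu_0((-\infty,x))-\mu_0((-\infty,x))=\int_{-\infty}^x u_0(z)^2\,dz\qquad\text{for all }x\in\mathbb R.$$ Let $(u(t),\mu_t)$ be the conservative solution with initial data $(u_0,\mu_0)$ and $(\tilde u(t),\tilde\mu_t)$ the Holden–Raynaud conservative solution with initial data $(\tilde u_0,\tilde\mu_0)$. Then for all $t\ge0$ the measures $\mu_t,\tilde\mu_t$ are finite, $u(t,\cdot)\in L^2(\mathbb R)$, and for all $x\in\mathbb R$ $$u(t,x)=\tilde u(t,x),\qquad \tilde\mu_t((-\infty,x))-\mu_t((-\infty,x))=\int_{-\infty}^x u(t,z)^2\,dz .$$ -/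

import Mathlib

open MeasureTheory Set Filter Topology
open scoped ENNReal BoundedContinuousFunction

noncomputable section

namespace CamassaHolm

/-! ## Function spaces -/

/-- `L²(ℝ)`. -/
abbrev L2 : Type := Lp ℝ 2 (volume : Measure ℝ)

theorem L2.intervalIntegrable (g : L2) (a b : ℝ) :
    IntervalIntegrable (g : ℝ → ℝ) volume a b :=
  ((Lp.memLp g).locallyIntegrable one_le_two).integrableOn_isCompact isCompact_uIcc |>.intervalIntegrable

/-- The space `V` of bounded continuous functions `f` whose derivative `f_ξ` is in `L²(ℝ)`, as the
space of the pairs `(f, f_ξ)`, with the (maximum) norm of the pair. -/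
def VSub : Submodule ℝ ((ℝ →ᵇ ℝ) × L2) where
  carrier := {p | ∀ a b : ℝ, ∫ x in a..b, p.2 x = p.1 b - p.1 a}
  zero_mem' := by
    intro a b
    have h : ∀ᵐ x ∂(volume : Measure ℝ), (((0 : (ℝ →ᵇ ℝ) × L2).2 : L2) : ℝ → ℝ) x = 0 :=
      Lp.coeFn_zero ℝ 2 volume
    rw [intervalIntegral.integral_congr_ae (g := fun _ => (0 : ℝ)) (h.mono fun x hx _ => hx)]
    simp
  add_mem' := by
    intro p q hp hq a b
    have h : ∀ᵐ x ∂(volume : Measure ℝ), (((p + q).2 : L2) : ℝ → ℝ) x = p.2 x + q.2 x :=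
      Lp.coeFn_add p.2 q.2
    rw [intervalIntegral.integral_congr_ae (g := fun x => p.2 x + q.2 x)
      (h.mono fun x hx _ => hx), intervalIntegral.integral_add
      (L2.intervalIntegrable _ _ _) (L2.intervalIntegrable _ _ _), hp a b, hq a b]
    simp only [Prod.fst_add, BoundedContinuousFunction.coe_add, Pi.add_apply]
    ring
  smul_mem' := by
    intro k p hp a b
    have h : ∀ᵐ x ∂(volume : Measure ℝ), (((k • p).2 : L2) : ℝ → ℝ) x = k * p.2 x :=
      Lp.coeFn_smul k p.2
    rw [intervalIntegral.integral_congr_ae (g := fun x => k * p.2 x)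
      (h.mono fun x hx _ => hx), intervalIntegral.integral_const_mul, hp a b]
    simp only [Prod.smul_fst, BoundedContinuousFunction.coe_smul, smul_eq_mul]
    ring

/-- The normed space `V`. -/
def V : Type := VSub

instance V.instNormedAddCommGroup : NormedAddCommGroup V :=
  inferInstanceAs (NormedAddCommGroup VSub)

instance V.instNormedSpace : NormedSpace ℝ V := inferInstanceAs (NormedSpace ℝ VSub)

/-- The value at `ξ` of an element of `V`. -/
def V.val (f : V) (ξ : ℝ) : ℝ := f.1.1 ξ

/-- The (weak) derivative of an element of `V`. -/
def V.der (f : V) (ξ : ℝ) : ℝ := f.1.2 ξ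

/-- The Sobolev space `H¹(ℝ) = V ∩ L²(ℝ)`. Its elements are `(f, f_ξ, [f])`, where `f` is the
continuous representative and `[f]` its class in `L²`; by the Sobolev inequality
the norm of this triple is equivalent to the usual one. -/
def H1Sub : Submodule ℝ (V × L2) where
  carrier := {p | (p.2 : ℝ → ℝ) =ᵐ[volume] V.val p.1}
  zero_mem' := Lp.coeFn_zero ℝ 2 volume
  add_mem' := by
    intro p q hp hq
    have h : (((p + q).2 : L2) : ℝ → ℝ) =ᵐ[volume] (p.2 : ℝ → ℝ) + (q.2 : ℝ → ℝ) :=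
      Lp.coeFn_add p.2 q.2
    have hp' : (p.2 : ℝ → ℝ) =ᵐ[volume] V.val p.1 := hp
    have hq' : (q.2 : ℝ → ℝ) =ᵐ[volume] V.val q.1 := hq
    exact h.trans (hp'.add hq')
  smul_mem' := by
    intro k p hp
    have h : (((k • p).2 : L2) : ℝ → ℝ) =ᵐ[volume] k • (p.2 : ℝ → ℝ) :=
      Lp.coeFn_smul k p.2
    have hp' : (p.2 : ℝ → ℝ) =ᵐ[volume] V.val p.1 := hp
    exact h.trans (hp'.const_smul k)

/-- The normed space `H¹(ℝ)`. -/
def H1 : Type := H1Sub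

instance H1.instNormedAddCommGroup : NormedAddCommGroup H1 :=
  inferInstanceAs (NormedAddCommGroup H1Sub)

instance H1.instNormedSpace : NormedSpace ℝ H1 := inferInstanceAs (NormedSpace ℝ H1Sub)

/-- The value at `ξ` of (the continuous representative of) an element of `H¹(ℝ)`. -/
def H1.val (f : H1) (ξ : ℝ) : ℝ := V.val f.1.1 ξ

/-- The (weak) derivative of an element of `H¹(ℝ)`. -/
def H1.der (f : H1) (ξ : ℝ) : ℝ := V.der f.1.1 ξ

/-- Smooth partition functions. -/
structure IsPartitionFunction (χ : ℝ → ℝ) : Prop where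
  smooth : ContDiff ℝ (⊤ : ℕ∞) χ
  eq_zero : ∀ x ≤ 0, χ x = 0
  eq_one : ∀ x, 1 ≤ x → χ x = 1
  deriv_nonneg : ∀ x, 0 ≤ deriv χ x

/-- The space `H_{0,∞}(ℝ)`, through its identification `I_χ` with `H¹(ℝ) × ℝ`, which defines its
norm: `(w, c)` stands for the function `w + c χ`. -/
abbrev H0inf : Type := H1 × ℝ

/-- `I_χ (w, c) = w + c χ`. -/
def H0inf.val (χ : ℝ → ℝ) (u : H0inf) (x : ℝ) : ℝ := H1.val u.1 x + u.2 * χ x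

/-- The derivative of `I_χ (w, c)`. -/
def H0inf.der (χ : ℝ → ℝ) (u : H0inf) (x : ℝ) : ℝ := H1.der u.1 x + u.2 * deriv χ x

/-! ## Objects common to both constructions -/

/-- `y = id + ζ`. -/
def char (ζ : V) (ξ : ℝ) : ℝ := ξ + V.val ζ ξ

/-- `y_ξ = 1 + ζ_ξ`. -/
def charDer (ζ : V) (ξ : ℝ) : ℝ := 1 + V.der ζ ξ

/-- The kernel `exp (- sgn (ξ - η) (y ξ - y η))`; for nondecreasing `y` (in particular, along
the solutions below) this is `exp (- |y ξ - y η|)`. -/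
def kernel (y : ℝ → ℝ) (ξ η : ℝ) : ℝ := Real.exp (-(Real.sign (ξ - η) * (y ξ - y η)))

/-- The characteristic `y(ξ) = sup {y | μ((-∞, y)) + y < ξ}` attached to a measure. -/
def charOfMeasure (μ : Measure ℝ) (ξ : ℝ) : ℝ := sSup {y : ℝ | μ.real (Iio y) + y < ξ}

/-- The absolutely continuous part of a measure on the line. -/
def acPart (μ : Measure ℝ) : Measure ℝ := volume.withDensity (μ.rnDeriv volume)

/-- The push-forward `y_# (h dξ)`. -/
def pushDensity (y h : ℝ → ℝ) : Measure ℝ :=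
  (volume.withDensity fun ξ => ENNReal.ofReal (h ξ)).map y

/-! ## The construction with (possibly) nonvanishing asymptotics -/

/-- Eulerian coordinates: `u ∈ H_{0,∞}(ℝ)`, `μ` a finite measure, `μ_ac = u_x² dx`. -/
def IsEulerian (χ u : ℝ → ℝ) (μ : Measure ℝ) : Prop :=
  IsFiniteMeasure μ ∧ ∃ v : H0inf, (∀ x, u x = H0inf.val χ v x) ∧
    acPart μ = volume.withDensity fun x => ENNReal.ofReal (H0inf.der χ v x ^ 2)

/-- `E = V × H_{0,∞}(ℝ) × L²(ℝ)`, with elements `(ζ, U, h)`. -/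
abbrev E : Type := V × H0inf × L2

/-- The unknown `y`. -/
def E.y (X : E) : ℝ → ℝ := char X.1

/-- The derivative `y_ξ`. -/
def E.yDer (X : E) : ℝ → ℝ := charDer X.1

/-- The unknown `U`. -/
def E.U (χ : ℝ → ℝ) (X : E) : ℝ → ℝ := H0inf.val χ X.2.1

/-- The derivative `U_ξ`. -/
def E.UDer (χ : ℝ → ℝ) (X : E) : ℝ → ℝ := H0inf.der χ X.2.1

/-- The asymptotic value `c` of `U` at `+∞`. -/
def E.c (X : E) : ℝ := X.2.1.2

/-- `Ū = U - c χ ∘ y`. -/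
def E.Ubar (χ : ℝ → ℝ) (X : E) (ξ : ℝ) : ℝ := E.U χ X ξ - E.c X * χ (E.y X ξ)

/-- The unknown `h`. -/
def E.h (X : E) : ℝ → ℝ := X.2.2

/-- `g = χ² + ½ ∫ e^{-|x-z|} (2 χ'² + 2 χ χ'')(z) dz`. -/
def gFun (χ : ℝ → ℝ) (x : ℝ) : ℝ :=
  χ x ^ 2 + 1 / 2 * ∫ z, Real.exp (-|x - z|) *
    (2 * deriv χ z ^ 2 + 2 * χ z * deriv (deriv χ) z)

/-- The density `(2 Ū² + 4 c Ū χ ∘ y) y_ξ + h`. -/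
def E.source (χ : ℝ → ℝ) (X : E) (η : ℝ) : ℝ :=
  (2 * E.Ubar χ X η ^ 2 + 4 * E.c X * E.Ubar χ X η * χ (E.y X η)) * E.yDer X η + E.h X η

/-- The function `P`. -/
def E.P (χ : ℝ → ℝ) (X : E) (ξ : ℝ) : ℝ :=
  1 / 4 * (∫ η, kernel (E.y X) ξ η * E.source χ X η) + E.c X ^ 2 * gFun χ (E.y X ξ)

/-- The function `Q`. -/
def E.Q (χ : ℝ → ℝ) (X : E) (ξ : ℝ) : ℝ :=
  -(1 / 4) * (∫ η, Real.sign (ξ - η) * kernel (E.y X) ξ η * E.source χ X η)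
    + E.c X ^ 2 * deriv (gFun χ) (E.y X ξ)

/-- `X ∈ C¹([0, ∞), E)` solves `y_t = U`, `U_t = -Q`, `h_t = 2 (U² - P) U_ξ`. -/
def IsLagrangianSolution (χ : ℝ → ℝ) (X : ℝ → E) : Prop :=
  ∃ X' : ℝ → E, ContinuousOn X' (Ici 0) ∧ ∀ t : ℝ, 0 ≤ t →
    HasDerivWithinAt X (X' t) (Ici 0) t ∧
    (∀ ξ, V.val (X' t).1 ξ = E.U χ (X t) ξ) ∧
    (∀ ξ, E.U χ (X' t) ξ = -E.Q χ (X t) ξ) ∧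
    E.h (X' t) =ᵐ[volume]
      fun ξ => 2 * (E.U χ (X t) ξ ^ 2 - E.P χ (X t) ξ) * E.UDer χ (X t) ξ

/-- `X = L (u, μ)`: `y` is the characteristic attached to `μ`, `U = u ∘ y`, `h = 1 - y_ξ`. -/
def IsLagrangianOf (χ u : ℝ → ℝ) (μ : Measure ℝ) (X : E) : Prop :=
  (∀ ξ, E.y X ξ = charOfMeasure μ ξ) ∧ (∀ ξ, E.U χ X ξ = u (E.y X ξ)) ∧
    E.h X =ᵐ[volume] fun ξ => 1 - E.yDer X ξ

/-- `(u, μ) = M (X)`: `u (x) = U (ξ)` whenever `x = y (ξ)`, and `μ = y_# (h dξ)`. -/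
def IsEulerianOf (χ : ℝ → ℝ) (X : E) (u : ℝ → ℝ) (μ : Measure ℝ) : Prop :=
  (∀ x ξ, x = E.y X ξ → u x = E.U χ X ξ) ∧ μ = pushDensity (E.y X) (E.h X)

/-- `(u(t), μ_t) = M S_t L (u₀, μ₀)` for all `t ≥ 0`. -/
def IsConservativeSolution (χ u₀ : ℝ → ℝ) (μ₀ : Measure ℝ)
    (u : ℝ → ℝ → ℝ) (μ : ℝ → Measure ℝ) : Prop :=
  ∃ X : ℝ → E, IsLagrangianSolution χ X ∧ IsLagrangianOf χ u₀ μ₀ (X 0) ∧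
    ∀ t : ℝ, 0 ≤ t → IsEulerianOf χ (X t) (u t) (μ t)

/-! ## The Holden-Raynaud construction for vanishing asymptotics -/

namespace HR

/-- Eulerian coordinates: `u ∈ H¹(ℝ)`, `μ` a finite measure, `μ_ac = (u² + u_x²) dx`. -/
def IsEulerian (u : ℝ → ℝ) (μ : Measure ℝ) : Prop :=
  IsFiniteMeasure μ ∧ ∃ v : H1, (∀ x, u x = H1.val v x) ∧
    acPart μ = volume.withDensity fun x => ENNReal.ofReal (H1.val v x ^ 2 + H1.der v x ^ 2)

/-- `V × H¹(ℝ) × V`, with elements `(ζ, U, H)`. -/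
abbrev E : Type := V × H1 × V

/-- The unknown `y`. -/
def E.y (X : E) : ℝ → ℝ := char X.1

/-- The derivative `y_ξ`. -/
def E.yDer (X : E) : ℝ → ℝ := charDer X.1

/-- The unknown `U`. -/
def E.U (X : E) : ℝ → ℝ := H1.val X.2.1

/-- The unknown `H`, the cumulative energy. -/
def E.H (X : E) : ℝ → ℝ := V.val X.2.2

/-- The derivative `H_ξ`. -/
def E.HDer (X : E) : ℝ → ℝ := V.der X.2.2

/-- The density `U² y_ξ + H_ξ`. -/
def E.source (X : E) (η : ℝ) : ℝ := E.U X η ^ 2 * E.yDer X η + E.HDer X η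

/-- The function `P`. -/
def E.P (X : E) (ξ : ℝ) : ℝ := 1 / 4 * ∫ η, kernel (E.y X) ξ η * E.source X η

/-- The function `Q`. -/
def E.Q (X : E) (ξ : ℝ) : ℝ :=
  -(1 / 4) * ∫ η, Real.sign (ξ - η) * kernel (E.y X) ξ η * E.source X η

/-- `X ∈ C¹([0, ∞), E)` solves `y_t = U`, `U_t = -Q`, `H_t = U³ - 2 P U`. -/
def IsLagrangianSolution (X : ℝ → E) : Prop :=
  ∃ X' : ℝ → E, ContinuousOn X' (Ici 0) ∧ ∀ t : ℝ, 0 ≤ t →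
    HasDerivWithinAt X (X' t) (Ici 0) t ∧
    (∀ ξ, V.val (X' t).1 ξ = E.U (X t) ξ) ∧
    (∀ ξ, E.U (X' t) ξ = -E.Q (X t) ξ) ∧
    (∀ ξ, E.H (X' t) ξ = E.U (X t) ξ ^ 3 - 2 * E.P (X t) ξ * E.U (X t) ξ)

/-- `X = L (u, μ)`: `y` is the characteristic attached to `μ`, `U = u ∘ y`, `H = id - y`. -/
def IsLagrangianOf (u : ℝ → ℝ) (μ : Measure ℝ) (X : E) : Prop :=
  (∀ ξ, E.y X ξ = charOfMeasure μ ξ) ∧ (∀ ξ, E.U X ξ = u (E.y X ξ)) ∧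
    (∀ ξ, E.H X ξ = ξ - E.y X ξ)

/-- `(u, μ) = M (X)`: `u (x) = U (ξ)` whenever `x = y (ξ)`, and `μ = y_# (H_ξ dξ)`. -/
def IsEulerianOf (X : E) (u : ℝ → ℝ) (μ : Measure ℝ) : Prop :=
  (∀ x ξ, x = E.y X ξ → u x = E.U X ξ) ∧ μ = pushDensity (E.y X) (E.HDer X)

/-- `(u(t), μ_t) = M S_t L (u₀, μ₀)` for all `t ≥ 0`. -/
def IsConservativeSolution (u₀ : ℝ → ℝ) (μ₀ : Measure ℝ)
    (u : ℝ → ℝ → ℝ) (μ : ℝ → Measure ℝ) : Prop :=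
  ∃ X : ℝ → E, IsLagrangianSolution X ∧ IsLagrangianOf u₀ μ₀ (X 0) ∧
    ∀ t : ℝ, 0 ≤ t → IsEulerianOf (X t) (u t) (μ t)

end HR

end CamassaHolm

end

/-! The two constructions are the same flow in different variables. In the Holden–Raynaud system put
`h = H_ξ - U² y_ξ`. The density `U² y_ξ + H_ξ` becomes `2 U² y_ξ + h`, so `P` and `Q` are those of
the first construction with `c = 0`. From `P_ξ = Q y_ξ` and `H_t = U³ - 2 P U` one gets `h_t = 2 (U²
- P) U_ξ`: the terms in `Q` cancel. Both constructions thus lead to one system for `(ζ, U, h)`, here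
called `State`.

Three things remain. The limit `c` must vanish: it does initially because `u₀` is in `H¹`, and later
because `U_t = -Q` tends to `0` at `+∞` (`IsLagrangianSolution.c_eq_zero`). The initial labels
differ, since the two energy measures define different characteristics. However, `y_{ν₀}(ξ +
∫_{-∞}^{y_{μ₀}(ξ)} u₀²) = y_{μ₀}(ξ)`, so the initial states agree after a bi-Lipschitz relabeling
(`exists_toState_eq`). The relabeling does not depend on time and the system is equivariant under it
(`IsRelabeling.isSolution`). As the right-hand side is Lipschitz on bounded sets
(`State.exists_lipschitz`), Grönwall's inequality gives uniqueness (`State.IsSolution.unique`), and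
the states coincide for all times.

Back in Eulerian coordinates, `u = v` is immediate. For the measures, `H_ξ = h + U² y_ξ`, and the
push-forward of `U² y_ξ dξ` by `y` is `u² dx` (`pushDensity_compare`). Densities enter through their
positive parts, so this needs `y_ξ ≥ 0` and `h ≥ 0` (`State.IsSolution.nonneg`). These signs follow
from the conserved identity `y_ξ h = U_ξ²` (`State.IsSolution.mul_eq`). At the initial time it
expresses `μ_ac = u_x² dx` (`charOfMeasure_identity`). -/

noncomputable section

namespace CamassaHolm

/-! ## Primitives -/

/-- `F` is locally absolutely continuous, with derivative `f` almost everywhere. -/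
def IsPrimitive (F f : ℝ → ℝ) : Prop :=
  (∀ a b, AbsolutelyContinuousOnInterval F a b) ∧ ∀ᵐ x, HasDerivAt F (f x) x

namespace IsPrimitive

variable {F G f g : ℝ → ℝ}

/-- Passage from the integral identity that defines `V` to absolute continuity, by Lebesgue
differentiation. -/
theorem of_integral (hf : LocallyIntegrable f) (h : ∀ a b, ∫ x in a..b, f x = F b - F a) :
    IsPrimitive F f := by
  have hF (c : ℝ) : F = fun x => F c + ∫ t in c..x, f t := by
    ext x; rw [h]; ring
  constructor
  · intro a b
    have hi : IntervalIntegrable f volume a b :=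
      (hf.integrableOn_isCompact isCompact_uIcc).intervalIntegrable
    have h1 := hi.absolutelyContinuousOnInterval_intervalIntegral (c := a) (by simp)
    have h2 : AbsolutelyContinuousOnInterval (fun _ : ℝ => F a) a b :=
      ContDiffOn.absolutelyContinuousOnInterval contDiffOn_const
    rw [hF a]
    exact h2.fun_add h1
  · filter_upwards [LocallyIntegrable.ae_hasDerivAt_integral hf] with x hx
    rw [hF 0]
    exact (hx 0).const_add _

theorem continuous (h : IsPrimitive F f) : Continuous F := by
  rw [continuous_iff_continuousAt]
  intro x
  have := (h.1 (x - 1) (x + 1)).continuousOn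
  rw [uIcc_of_le (by linarith)] at this
  exact this.continuousAt (Icc_mem_nhds (by linarith) (by linarith))

theorem deriv_ae (h : IsPrimitive F f) : deriv F =ᵐ[volume] f := h.2.mono fun _ hx => hx.deriv

theorem intervalIntegrable (h : IsPrimitive F f) (a b : ℝ) : IntervalIntegrable f volume a b :=
  (h.1 a b).intervalIntegrable_deriv.congr_ae (h.deriv_ae.restrict)

theorem integral_eq (h : IsPrimitive F f) (a b : ℝ) : ∫ x in a..b, f x = F b - F a := by
  rw [← (h.1 a b).integral_deriv_eq_sub]
  exact intervalIntegral.integral_congr_ae (h.deriv_ae.mono fun _ hx _ => hx.symm)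

theorem unique (hf : IsPrimitive F f) (hg : IsPrimitive F g) : f =ᵐ[volume] g := by
  filter_upwards [hf.2, hg.2] with x h1 h2 using h1.unique h2

theorem congr (hf : IsPrimitive F f) (h : f =ᵐ[volume] g) : IsPrimitive F g :=
  ⟨hf.1, by filter_upwards [hf.2, h] with x h1 h2; rwa [← h2]⟩

theorem aestronglyMeasurable (h : IsPrimitive F f) : AEStronglyMeasurable f volume :=
  (measurable_deriv F).aestronglyMeasurable.congr h.deriv_ae

theorem add (hf : IsPrimitive F f) (hg : IsPrimitive G g) :
    IsPrimitive (fun x => F x + G x) (fun x => f x + g x) :=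
  ⟨fun a b => (hf.1 a b).fun_add (hg.1 a b), by
    filter_upwards [hf.2, hg.2] with x h1 h2 using h1.add h2⟩

theorem sub (hf : IsPrimitive F f) (hg : IsPrimitive G g) :
    IsPrimitive (fun x => F x - G x) (fun x => f x - g x) :=
  ⟨fun a b => (hf.1 a b).fun_sub (hg.1 a b), by
    filter_upwards [hf.2, hg.2] with x h1 h2 using h1.sub h2⟩

theorem mul (hf : IsPrimitive F f) (hg : IsPrimitive G g) :
    IsPrimitive (fun x => F x * G x) (fun x => f x * G x + F x * g x) :=
  ⟨fun a b => (hf.1 a b).fun_mul (hg.1 a b), by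
    filter_upwards [hf.2, hg.2] with x h1 h2 using h1.mul h2⟩

theorem of_contDiff (hF : ContDiff ℝ 1 F) : IsPrimitive F (deriv F) :=
  ⟨fun _ _ => hF.contDiffOn.absolutelyContinuousOnInterval,
    Eventually.of_forall fun x => (hF.differentiable (by simp) x).hasDerivAt⟩

theorem const_mul (c : ℝ) (hf : IsPrimitive F f) :
    IsPrimitive (fun x => c * F x) (fun x => c * f x) :=
  ⟨fun a b => (hf.1 a b).const_mul c, hf.2.mono fun _ hx => hx.const_mul c⟩

theorem comp (hG : ContDiff ℝ 1 G) (hf : IsPrimitive F f) :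
    IsPrimitive (fun x => G (F x)) (fun x => deriv G (F x) * f x) := by
  constructor
  · intro a b
    -- A `C¹` function is Lipschitz on the compact interval `[-C, C]` containing the values of `F`,
    -- and Lipschitz functions preserve absolute continuity.
    obtain ⟨C, hC⟩ := (hf.1 a b).exists_bound
    obtain ⟨K, hK⟩ := hG.contDiffOn.exists_lipschitzOnWith (s := Icc (-C) C) (by simp)
      (convex_Icc _ _) isCompact_Icc
    have h0 := (hf.1 a b)
    unfold AbsolutelyContinuousOnInterval at h0 ⊢
    have h1 := h0.const_mul (K : ℝ)
    rw [mul_zero] at h1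
    refine squeeze_zero' (Eventually.of_forall fun E => Finset.sum_nonneg fun _ _ => dist_nonneg)
      ?_ h1
    rw [eventually_inf_principal]
    refine Eventually.of_forall fun E hE => ?_
    rw [Finset.mul_sum]
    refine Finset.sum_le_sum fun i hi => ?_
    have := hE.1 i hi
    refine hK.dist_le_mul _ ?_ _ ?_
    · exact abs_le.1 (hC _ this.1)
    · exact abs_le.1 (hC _ this.2)
  · filter_upwards [hf.2] with x hx
    exact ((hG.differentiable (by simp) _).hasDerivAt).comp x hx

theorem nonneg_of_monotone (h : IsPrimitive F f) (hF : Monotone F) : 0 ≤ᵐ[volume] f := by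
  filter_upwards [h.2] with x hx
  rw [Pi.zero_apply, ← hx.deriv]
  exact hF.deriv_nonneg

theorem monotone (h : IsPrimitive F f) (hf : 0 ≤ᵐ[volume] f) : Monotone F := by
  intro a b hab
  have := intervalIntegral.integral_nonneg_of_ae (a := a) (b := b) hab hf
  rw [h.integral_eq] at this
  linarith

end IsPrimitive

theorem isPrimitive_id : IsPrimitive (fun x : ℝ => x) (fun _ => 1) := by
  simpa using IsPrimitive.of_contDiff (F := fun x : ℝ => x) contDiff_id

/-! ## The spaces `V` and `H¹` -/

namespace V

theorem isPrimitive (f : V) : IsPrimitive (val f) (der f) :=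
  .of_integral ((Lp.memLp f.1.2).locallyIntegrable one_le_two) f.2

/-- The values determine the weak derivative almost everywhere, so identities in `V`, and then in
`H1`, can be checked pointwise. -/
theorem ext_val {f g : V} (h : ∀ ξ, val f ξ = val g ξ) : f = g := by
  have h1 : val f = val g := funext h
  have h2 : der f =ᵐ[volume] der g := by
    have := f.isPrimitive
    rw [h1] at this
    exact this.unique g.isPrimitive
  exact Subtype.ext (Prod.ext (BoundedContinuousFunction.ext h) (Lp.ext h2))

theorem der_ae {f : V} {F g : ℝ → ℝ} (h : ∀ ξ, val f ξ = F ξ) (hg : IsPrimitive F g) :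
    der f =ᵐ[volume] g := by
  have := f.isPrimitive
  rw [show val f = F from funext h] at this
  exact this.unique hg

theorem memLp_der (f : V) : MemLp (der f) 2 := Lp.memLp f.1.2

theorem abs_val_le (f : V) (ξ : ℝ) : |val f ξ| ≤ ‖f‖ :=
  (f.1.1.norm_coe_le_norm ξ).trans (le_max_left _ _)

/-- The element of `V` given by a bounded function and its square integrable derivative. -/
def mk (F f : ℝ → ℝ) (hF : ∃ C, ∀ x, |F x| ≤ C) (h : IsPrimitive F f) (hf : MemLp f 2) : V :=
  ⟨(BoundedContinuousFunction.ofNormedAddCommGroup F h.continuous hF.choose hF.choose_spec,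
    hf.toLp f), fun a b => by
      rw [intervalIntegral.integral_congr_ae (g := f) (hf.coeFn_toLp.mono fun x hx _ => hx)]
      exact h.integral_eq a b⟩

@[simp] theorem val_mk (F f : ℝ → ℝ) (hF : ∃ C, ∀ x, |F x| ≤ C) (h : IsPrimitive F f)
    (hf : MemLp f 2) (ξ : ℝ) : val (mk F f hF h hf) ξ = F ξ := rfl

theorem der_mk (F f : ℝ → ℝ) (hF : ∃ C, ∀ x, |F x| ≤ C) (h : IsPrimitive F f)
    (hf : MemLp f 2) : der (mk F f hF h hf) =ᵐ[volume] f := hf.coeFn_toLp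

@[simp] theorem val_add (f g : V) (ξ : ℝ) : val (f + g) ξ = val f ξ + val g ξ := rfl
@[simp] theorem val_sub (f g : V) (ξ : ℝ) : val (f - g) ξ = val f ξ - val g ξ := rfl

theorem der_sub (f g : V) : der (f - g) =ᵐ[volume] fun ξ => der f ξ - der g ξ :=
  Lp.coeFn_sub f.1.2 g.1.2

theorem norm_le {f : V} {C D : ℝ} (hC : ∀ ξ, |val f ξ| ≤ C) (hD : ‖f.1.2‖ ≤ D) :
    ‖f‖ ≤ max C D :=
  max_le_max ((BoundedContinuousFunction.norm_le ((abs_nonneg _).trans (hC 0))).2 hC) hD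

end V

namespace H1

theorem isPrimitive (f : H1) : IsPrimitive (val f) (der f) := V.isPrimitive f.1.1

theorem memLp_val (f : H1) : MemLp (val f) 2 := (Lp.memLp f.1.2).ae_eq f.2

theorem memLp_der (f : H1) : MemLp (der f) 2 := V.memLp_der f.1.1

theorem ext_val {f g : H1} (h : ∀ ξ, val f ξ = val g ξ) : f = g := by
  have h1 : f.1.1 = g.1.1 := V.ext_val h
  refine Subtype.ext (Prod.ext h1 (Lp.ext ?_))
  have h2 : V.val f.1.1 = V.val g.1.1 := funext h
  have hf : (f.1.2 : ℝ → ℝ) =ᵐ[volume] V.val f.1.1 := f.2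
  have hg : (g.1.2 : ℝ → ℝ) =ᵐ[volume] V.val g.1.1 := g.2
  rw [h2] at hf
  exact hf.trans hg.symm

theorem der_ae {f : H1} {F g : ℝ → ℝ} (h : ∀ ξ, val f ξ = F ξ) (hg : IsPrimitive F g) :
    der f =ᵐ[volume] g := V.der_ae h hg

theorem abs_val_le (f : H1) (ξ : ℝ) : |val f ξ| ≤ ‖f‖ :=
  (V.abs_val_le f.1.1 ξ).trans (le_max_left _ _)

/-- The element of `H¹` given by a `V`-function that is square integrable. -/
def mk (f : V) (hf : MemLp (V.val f) 2) : H1 := ⟨(f, hf.toLp _), hf.coeFn_toLp⟩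

@[simp] theorem val_mk (f : V) (hf : MemLp (V.val f) 2) (ξ : ℝ) :
    val (mk f hf) ξ = V.val f ξ := rfl

/-- Functions in `H¹` vanish at `+∞`. -/
theorem tendsto_val_atTop (f : H1) : Tendsto (val f) atTop (𝓝 0) := by
  -- The derivative `2 f f_ξ` of `f²` is integrable, so `f²` has a limit; as `f²` is itself
  -- integrable, that limit is `0`.
  have hp := f.isPrimitive.mul f.isPrimitive
  have hi : Integrable (fun x => der f x * val f x + val f x * der f x) :=
    (f.memLp_der.integrable_mul f.memLp_val).add (f.memLp_val.integrable_mul f.memLp_der)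
  have h1 := intervalIntegral_tendsto_integral_Ioi 0 hi.integrableOn tendsto_id
  simp only [hp.integral_eq, id] at h1
  set L := ∫ x in Ioi 0, (der f x * val f x + val f x * der f x)
  have h2 : Tendsto (fun x => val f x * val f x) atTop (𝓝 (L + val f 0 * val f 0)) := by
    simpa using h1.add_const (val f 0 * val f 0)
  have h3 : L + val f 0 * val f 0 = 0 := by
    by_contra hne
    have hint : Integrable (fun x => val f x * val f x) := f.memLp_val.integrable_mul f.memLp_val
    have hz : IntegrableAtFilter (fun x => val f x * val f x) atTop :=
      hint.integrableAtFilter _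
    refine hne (hz.eq_zero_of_tendsto (fun s hs => ?_) h2)
    rcases mem_atTop_sets.1 hs with ⟨b, hb⟩
    exact top_unique (Real.volume_Ici (a := b) ▸ measure_mono hb)
  rw [h3] at h2
  have h4 := (Real.continuous_sqrt.tendsto 0).comp h2
  simp only [Function.comp_def, Real.sqrt_mul_self_eq_abs, Real.sqrt_zero] at h4
  exact (tendsto_zero_iff_abs_tendsto_zero _).2 h4

end H1

/-! ## Monotone changes of variables -/

/-- The measure `ρ dξ`. -/
def density (ρ : ℝ → ℝ) : Measure ℝ := volume.withDensity fun ξ => ENNReal.ofReal (ρ ξ)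

/-- A nondecreasing, locally absolutely continuous change of variables of the line. -/
structure IsChange (y ρ : ℝ → ℝ) : Prop where
  prim : IsPrimitive y ρ
  nonneg : 0 ≤ᵐ[volume] ρ
  atBot : Tendsto y atBot atBot
  atTop : Tendsto y atTop atTop

theorem density_Ioc {y ρ : ℝ → ℝ} (h : IsPrimitive y ρ) (hρ : 0 ≤ᵐ[volume] ρ) {a b : ℝ}
    (hab : a ≤ b) : density ρ (Ioc a b) = ENNReal.ofReal (y b - y a) := by
  rw [density, withDensity_apply _ measurableSet_Ioc, ← h.integral_eq,
    intervalIntegral.integral_of_le hab, ofReal_integral_eq_lintegral_ofReal]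
  · exact (intervalIntegrable_iff_integrableOn_Ioc_of_le hab).1 (h.intervalIntegrable a b)
  · exact ae_restrict_of_ae hρ

namespace IsChange

variable {y ρ : ℝ → ℝ}

theorem monotone (h : IsChange y ρ) : Monotone y := h.prim.monotone h.nonneg

theorem continuous (h : IsChange y ρ) : Continuous y := h.prim.continuous

theorem measurable (h : IsChange y ρ) : Measurable y := h.continuous.measurable

theorem surjective (h : IsChange y ρ) : Function.Surjective y :=
  h.continuous.surjective h.atTop h.atBot

theorem aemeasurable (h : IsChange y ρ) : AEMeasurable ρ volume :=
  h.prim.aestronglyMeasurable.aemeasurable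

/-- A change of variables may have plateaus. Taking the right end of the plateau at level `c` makes
preimages of half-open intervals half-open intervals. -/
theorem exists_preimage_Iic (h : IsChange y ρ) (c : ℝ) : ∃ a, y a = c ∧ y ⁻¹' Iic c = Iic a := by
  set S := y ⁻¹' Iic c with hS
  obtain ⟨x, hx⟩ := h.surjective c
  have hne : S.Nonempty := ⟨x, hx.le⟩
  obtain ⟨b, hb⟩ := h.surjective (c + 1)
  have hbdd : BddAbove S := ⟨b, fun z hz => by
    by_contra hlt
    have := h.monotone (not_le.1 hlt).le
    have hz' : y z ≤ c := hz
    linarith⟩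
  have hcl : IsClosed S := isClosed_Iic.preimage h.continuous
  have hmem : sSup S ∈ S := hcl.csSup_mem hne hbdd
  refine ⟨sSup S, le_antisymm hmem ?_, ?_⟩
  · rw [← hx]; exact h.monotone (le_csSup hbdd hx.le)
  · ext z
    exact ⟨fun hz => le_csSup hbdd hz, fun hz => (h.monotone hz).trans hmem⟩

/-- The image of `ρ dξ` is the Lebesgue measure. -/
theorem map_density (h : IsChange y ρ) : (density ρ).map y = volume := by
  symm
  refine Measure.ext_of_Ioc _ _ fun c d hcd => ?_
  obtain ⟨a, ha, hca⟩ := h.exists_preimage_Iic c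
  obtain ⟨b, hb, hdb⟩ := h.exists_preimage_Iic d
  have hab : a ≤ b := by
    by_contra hlt
    have := h.monotone (not_le.1 hlt).le
    linarith
  have hpre : y ⁻¹' Ioc c d = Ioc a b := by
    ext ξ
    have h1 : y ξ ≤ c ↔ ξ ≤ a := by rw [← mem_Iic, ← mem_preimage, hca, mem_Iic]
    have h2 : y ξ ≤ d ↔ ξ ≤ b := by rw [← mem_Iic, ← mem_preimage, hdb, mem_Iic]
    simp only [mem_preimage, mem_Ioc, ← not_le, h1, h2]
  rw [Measure.map_apply h.measurable measurableSet_Ioc, hpre, density_Ioc h.prim h.nonneg hab,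
    Real.volume_Ioc, ha, hb]

theorem density_preimage (h : IsChange y ρ) {s : Set ℝ} (hs : MeasurableSet s) :
    density ρ (y ⁻¹' s) = volume s := by
  rw [← Measure.map_apply h.measurable hs, h.map_density]

/-- The two sets differ only on the level sets of `y` at `y a` and `y b`, which `ρ dξ` does not
charge because its image is Lebesgue measure. -/
theorem preimage_Ioc_ae (h : IsChange y ρ) (a b : ℝ) :
    y ⁻¹' Ioc (y a) (y b) =ᵐ[density ρ] Ioc a b := by
  have h0 (c : ℝ) : ∀ᵐ ξ ∂(density ρ), y ξ ≠ c := by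
    have := h.density_preimage (measurableSet_singleton c)
    rw [Real.volume_singleton] at this
    exact measure_eq_zero_iff_ae_notMem.1 this
  filter_upwards [h0 (y a), h0 (y b)] with ξ h1 h2
  apply propext
  constructor
  · rintro ⟨h3, h4⟩
    constructor
    · by_contra hlt
      exact absurd (h.monotone (not_lt.1 hlt)) (not_le.2 h3)
    · by_contra hlt
      exact h2 (le_antisymm h4 (h.monotone (not_le.1 hlt).le))
  · rintro ⟨h3, h4⟩
    exact ⟨lt_of_le_of_ne (h.monotone h3.le) h1.symm, h.monotone h4⟩

theorem integral_comp (h : IsChange y ρ) {f : ℝ → ℝ} (hf : AEStronglyMeasurable f volume)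
    {s : Set ℝ} (hs : MeasurableSet s) :
    ∫ ξ in y ⁻¹' s, f (y ξ) * ρ ξ = ∫ x in s, f x := by
  conv_rhs => rw [← h.map_density]
  rw [setIntegral_map hs (by rwa [h.map_density]) h.measurable.aemeasurable, density,
    setIntegral_withDensity_eq_setIntegral_toReal_smul₀
      h.aemeasurable.ennreal_ofReal.restrict (by simp) _ (h.measurable hs)]
  refine integral_congr_ae (ae_restrict_of_ae ?_)
  filter_upwards [h.nonneg] with ξ hξ
  rw [ENNReal.toReal_ofReal hξ, smul_eq_mul, mul_comm]

theorem integrableOn_comp (h : IsChange y ρ) {f : ℝ → ℝ} {s : Set ℝ} (hs : MeasurableSet s)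
    (hf : AEStronglyMeasurable f volume) :
    IntegrableOn (fun ξ => f (y ξ) * ρ ξ) (y ⁻¹' s) ↔ IntegrableOn f s := by
  conv_rhs => rw [← h.map_density]
  rw [IntegrableOn, IntegrableOn, Measure.restrict_map h.measurable hs, integrable_map_measure,
    density, restrict_withDensity (h.measurable hs),
    integrable_withDensity_iff_integrable_smul₀' h.aemeasurable.ennreal_ofReal.restrict (by simp)]
  · refine integrable_congr (ae_restrict_of_ae ?_)
    filter_upwards [h.nonneg] with ξ hξ
    rw [ENNReal.toReal_ofReal hξ, smul_eq_mul, mul_comm, Function.comp]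
  · rw [← Measure.restrict_map h.measurable hs, h.map_density]
    exact hf.restrict
  · exact h.measurable.aemeasurable

/-- Change of variables in a primitive. -/
theorem isPrimitive_comp (h : IsChange y ρ) {F f : ℝ → ℝ} (hF : IsPrimitive F f) :
    IsPrimitive (fun ξ => F (y ξ)) (fun ξ => f (y ξ) * ρ ξ) := by
  have hac : ∀ {a b : ℝ},
      (volume.restrict (y ⁻¹' Ioc (y a) (y b))).withDensity (fun ξ => ENNReal.ofReal (ρ ξ)) =
      (volume.restrict (Ioc a b)).withDensity (fun ξ => ENNReal.ofReal (ρ ξ)) := by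
    intro a b
    rw [← restrict_withDensity (h.measurable measurableSet_Ioc),
      ← restrict_withDensity measurableSet_Ioc]
    exact Measure.restrict_congr_set (h.preimage_Ioc_ae a b)
  -- The chain rule is obtained from the integral formula: a pointwise argument would break down
  -- where `y` sends a set of positive measure into the null set on which `F` is not differentiable.
  have key : ∀ {a b : ℝ}, a ≤ b → IntegrableOn (fun ξ => f (y ξ) * ρ ξ) (Ioc a b) ∧
      ∫ ξ in Ioc a b, f (y ξ) * ρ ξ = F (y b) - F (y a) := by
    intro a b hab
    have hyab := h.monotone hab
    have hi := (h.integrableOn_comp measurableSet_Ioc hF.aestronglyMeasurable).2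
      ((intervalIntegrable_iff_integrableOn_Ioc_of_le hyab).1 (hF.intervalIntegrable (y a) (y b)))
    have he := h.integral_comp hF.aestronglyMeasurable
      (measurableSet_Ioc (a := y a) (b := y b))
    rw [← intervalIntegral.integral_of_le hyab, hF.integral_eq] at he
    have hcongr : (fun ξ => f (y ξ) * ρ ξ) =ᵐ[volume]
        fun ξ => (ENNReal.ofReal (ρ ξ)).toReal • f (y ξ) := by
      filter_upwards [h.nonneg] with ξ hξ
      rw [ENNReal.toReal_ofReal hξ, smul_eq_mul, mul_comm]
    constructor
    · rw [IntegrableOn, integrable_congr (ae_restrict_of_ae hcongr),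
        ← integrable_withDensity_iff_integrable_smul₀' h.aemeasurable.ennreal_ofReal.restrict
          (by simp)] at hi ⊢
      rwa [← hac]
    · rw [← he, integral_congr_ae (ae_restrict_of_ae hcongr),
        integral_congr_ae (μ := volume.restrict (y ⁻¹' _)) (ae_restrict_of_ae hcongr),
        ← integral_withDensity_eq_integral_toReal_smul₀ h.aemeasurable.ennreal_ofReal.restrict
          (by simp),
        ← integral_withDensity_eq_integral_toReal_smul₀ h.aemeasurable.ennreal_ofReal.restrict
          (by simp), hac]
  refine .of_integral (fun x => ?_) fun a b => ?_
  · refine ⟨Ioc (x - 1) (x + 1), Ioc_mem_nhds (by linarith) (by linarith), (key (by linarith)).1⟩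
  · rcases le_total a b with hab | hab
    · rw [intervalIntegral.integral_of_le hab, (key hab).2]
    · rw [intervalIntegral.integral_of_ge hab, (key hab).2]; ring

/-- The image of the measure `(f ∘ y) ρ dξ` is `f dx`. -/
theorem map_withDensity (h : IsChange y ρ) {f : ℝ → ℝ≥0∞} (hf : Measurable f) :
    (volume.withDensity fun ξ => f (y ξ) * ENNReal.ofReal (ρ ξ)).map y = volume.withDensity f := by
  ext s hs
  rw [Measure.map_apply h.measurable hs, withDensity_apply _ (h.measurable hs),
    withDensity_apply _ hs]
  conv_rhs => rw [← h.map_density]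
  rw [setLIntegral_map hs hf h.measurable, density,
    setLIntegral_withDensity_eq_setLIntegral_mul_non_measurable₀ _
      h.aemeasurable.ennreal_ofReal.restrict _ (h.measurable hs) (by simp)]
  simp [mul_comm]

/-- The preimage of a null set can have positive measure, but then `ρ = 0` almost everywhere on it.
-/
theorem ae_comp (h : IsChange y ρ) {p : ℝ → Prop} (hp : ∀ᵐ x, p x) :
    ∀ᵐ ξ, ρ ξ ≠ 0 → p (y ξ) := by
  have h1 : ∀ᵐ ξ ∂(density ρ), p (y ξ) :=
    ae_of_ae_map h.measurable.aemeasurable (by rwa [h.map_density])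
  rw [density, ae_withDensity_iff' h.aemeasurable.ennreal_ofReal] at h1
  filter_upwards [h1, h.nonneg] with ξ h2 h3 h4
  apply h2
  rw [Ne, ENNReal.ofReal_eq_zero, not_le]
  exact lt_of_le_of_ne h3 (Ne.symm h4)

end IsChange

/-! ## Convolution with `e^{-|ξ|}` -/

theorem integral_exp_neg_abs_sub (ξ : ℝ) : Integrable (fun η : ℝ => Real.exp (-|ξ - η|)) ∧
    ∫ η, Real.exp (-|ξ - η|) = 2 := by
  have h1 : IntegrableOn (fun η : ℝ => Real.exp (-η)) (Ioi 0) := integrableOn_exp_neg_Ioi 0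
  have h2 : Integrable fun η : ℝ => Real.exp (-|η|) := by
    have h0 : IntegrableOn (fun η : ℝ => Real.exp (-|η|)) (Ioi 0) :=
      h1.congr_fun (fun η hη => by simp only [abs_of_pos (mem_Ioi.1 hη)]) measurableSet_Ioi
    have h0' : IntegrableOn (fun η : ℝ => Real.exp (-|η|)) (Iic 0) :=
      (integrableOn_exp_Iic 0).congr_fun
        (fun η hη => by simp only [abs_of_nonpos (mem_Iic.1 hη), neg_neg]) measurableSet_Iic
    rw [← integrableOn_univ, ← Iic_union_Ioi (a := (0 : ℝ))]
    exact h0'.union h0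
  have h3 : ∫ η : ℝ, Real.exp (-|η|) = 2 := by
    rw [integral_comp_abs (f := fun η => Real.exp (-η)), integral_exp_neg_Ioi_zero, mul_one]
  exact ⟨h2.comp_sub_left ξ, by rw [integral_sub_left_eq_self (fun η => Real.exp (-|η|)), h3]⟩

theorem continuous_exp_neg_abs_sub (ξ : ℝ) : Continuous fun η : ℝ => Real.exp (-|ξ - η|) := by
  fun_prop

theorem exp_neg_abs_sub_le (ξ η : ℝ) : Real.exp (-|ξ - η|) ≤ 1 :=
  Real.exp_le_one_iff.2 (neg_nonpos.2 (abs_nonneg _))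

theorem memLp_exp_neg_abs_sub (ξ : ℝ) : MemLp (fun η : ℝ => Real.exp (-|ξ - η|)) 2 := by
  have hm := (continuous_exp_neg_abs_sub ξ).aestronglyMeasurable (μ := volume)
  refine (memLp_two_iff_integrable_sq hm).2
    ((integral_exp_neg_abs_sub ξ).1.mono' (hm.pow 2) (Eventually.of_forall fun η => ?_))
  rw [Real.norm_eq_abs, abs_of_nonneg (sq_nonneg _), sq]
  exact mul_le_of_le_one_left (Real.exp_pos _).le (exp_neg_abs_sub_le ξ η)

/-- The convolution of `f` with `e^{-|ξ|}`. -/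
def expConv (f : ℝ → ℝ) (ξ : ℝ) : ℝ := ∫ η, Real.exp (-|ξ - η|) * f η

variable {f g : ℝ → ℝ}

theorem integrable_exp_mul (hf : MemLp f 2) (ξ : ℝ) :
    Integrable fun η => Real.exp (-|ξ - η|) * f η :=
  (memLp_exp_neg_abs_sub ξ).integrable_mul hf

theorem integrable_exp_mul_of_integrable (hf : Integrable f) (ξ : ℝ) :
    Integrable fun η => Real.exp (-|ξ - η|) * f η :=
  hf.bdd_mul (c := 1) (continuous_exp_neg_abs_sub ξ).aestronglyMeasurable
    (Eventually.of_forall fun η => by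
      rw [Real.norm_eq_abs, Real.abs_exp]; exact exp_neg_abs_sub_le ξ η)

theorem expConv_nonneg (hf : 0 ≤ᵐ[volume] f) (ξ : ℝ) : 0 ≤ expConv f ξ :=
  integral_nonneg_of_ae (hf.mono fun _ hη => mul_nonneg (Real.exp_pos _).le hη)

theorem expConv_mono (hf : MemLp f 2) (hg : MemLp g 2) (h : f ≤ᵐ[volume] g) (ξ : ℝ) :
    expConv f ξ ≤ expConv g ξ :=
  integral_mono_ae (integrable_exp_mul hf ξ) (integrable_exp_mul hg ξ)
    (h.mono fun _ hη => mul_le_mul_of_nonneg_left hη (Real.exp_pos _).le)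

theorem expConv_const_mul (c : ℝ) (f : ℝ → ℝ) (ξ : ℝ) :
    expConv (fun η => c * f η) ξ = c * expConv f ξ := by
  rw [expConv, expConv, ← integral_const_mul]
  congr 1; ext η; ring

theorem sq_expConv_le (hf : MemLp f 2) (ξ : ℝ) :
    expConv f ξ ^ 2 ≤ 2 * expConv (fun η => f η ^ 2) ξ := by
  -- The weight `e^{-|ξ-η|}` has mass `2`, so `c` is the weighted mean of `f`; nonnegativity of the
  -- variance is the Cauchy–Schwarz inequality.
  set c := expConv f ξ / 2 with hc
  have h0 : 0 ≤ ∫ η, Real.exp (-|ξ - η|) * (f η - c) ^ 2 :=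
    integral_nonneg fun η => mul_nonneg (Real.exp_pos _).le (sq_nonneg _)
  have h1 : (fun η => Real.exp (-|ξ - η|) * (f η - c) ^ 2) = fun η =>
      Real.exp (-|ξ - η|) * f η ^ 2 - 2 * c * (Real.exp (-|ξ - η|) * f η)
        + c ^ 2 * Real.exp (-|ξ - η|) := by
    ext η; ring
  have i1 := integrable_exp_mul_of_integrable hf.integrable_sq ξ
  have i2 := (integrable_exp_mul hf ξ).const_mul (2 * c)
  have i3 := (integral_exp_neg_abs_sub ξ).1.const_mul (c ^ 2)
  have i12 : Integrable fun η => Real.exp (-|ξ - η|) * f η ^ 2 -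
    2 * c * (Real.exp (-|ξ - η|) * f η) := i1.sub i2
  rw [h1, integral_add i12 i3, integral_sub i1 i2, integral_const_mul, integral_const_mul,
    (integral_exp_neg_abs_sub ξ).2] at h0
  change 0 ≤ expConv (fun η => f η ^ 2) ξ - 2 * c * expConv f ξ + c ^ 2 * 2 at h0
  rw [hc] at h0
  nlinarith

theorem abs_expConv_le (hf : MemLp f 2) (ξ : ℝ) :
    expConv f ξ ^ 2 ≤ 2 * ∫ η, f η ^ 2 := by
  refine (sq_expConv_le hf ξ).trans (mul_le_mul_of_nonneg_left ?_ two_pos.le)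
  refine integral_mono (integrable_exp_mul_of_integrable hf.integrable_sq ξ) hf.integrable_sq ?_
  intro η
  simpa using mul_le_mul_of_nonneg_right (exp_neg_abs_sub_le ξ η) (sq_nonneg (f η))

theorem integral_expConv (hf : Integrable f) :
    Integrable (expConv f) ∧ ∫ ξ, expConv f ξ = 2 * ∫ η, f η := by
  have h0 : Integrable fun η : ℝ => Real.exp (-|η|) := by
    simpa using (integral_exp_neg_abs_sub 0).1
  have h1 : ∫ η : ℝ, Real.exp (-|η|) = 2 := by
    simpa using (integral_exp_neg_abs_sub 0).2
  have he : expConv f = convolution f (fun η => Real.exp (-|η|)) (ContinuousLinearMap.mul ℝ ℝ)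
      volume := by
    ext ξ
    simp only [expConv, convolution, ContinuousLinearMap.mul_apply']
    congr 1; ext η; ring
  constructor
  · rw [he]; exact hf.integrable_convolution _ h0
  · rw [he, integral_convolution _ hf h0, h1]
    simp [mul_comm]

/-- Young's inequality. One factor `2` comes from the pointwise bound `sq_expConv_le`, the other
from integrating the convolution of `f²`. -/
theorem memLp_expConv (hf : MemLp f 2) : MemLp (expConv f) 2 ∧
    ∫ ξ, expConv f ξ ^ 2 ≤ 4 * ∫ η, f η ^ 2 := by
  have hm : AEStronglyMeasurable (expConv f) volume := by
    have : AEStronglyMeasurable (fun p : ℝ × ℝ => Real.exp (-|p.1 - p.2|) * f p.2)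
        (volume.prod volume) :=
      (by fun_prop : Continuous fun p : ℝ × ℝ => Real.exp (-|p.1 - p.2|)).aestronglyMeasurable.mul
        hf.1.comp_snd
    exact this.integral_prod_right'
  obtain ⟨i1, i2⟩ := integral_expConv hf.integrable_sq
  have i3 : Integrable fun ξ => expConv f ξ ^ 2 := by
    refine (i1.const_mul 2).mono' (hm.pow 2) (Eventually.of_forall fun ξ => ?_)
    rw [Real.norm_eq_abs, abs_of_nonneg (sq_nonneg _)]
    exact sq_expConv_le hf ξ
  refine ⟨(memLp_two_iff_integrable_sq hm).2 i3, ?_⟩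
  have := integral_mono i3 (i1.const_mul 2) (fun ξ => sq_expConv_le hf ξ)
  rw [integral_const_mul, i2] at this
  linarith

theorem tendsto_expConv_atTop (hf : MemLp f 2) : Tendsto (expConv f) atTop (𝓝 0) := by
  -- Dominated convergence applies to `f²`, which is integrable, whereas `f` need not be.
  have h1 : Tendsto (fun ξ => 2 * expConv (fun η => f η ^ 2) ξ) atTop (𝓝 0) := by
    have : Tendsto (fun ξ => expConv (fun η => f η ^ 2) ξ) atTop (𝓝 (∫ _ : ℝ, (0 : ℝ))) := by
      refine tendsto_integral_filter_of_dominated_convergence (fun η => f η ^ 2) ?_ ?_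
        hf.integrable_sq ?_
      · exact Eventually.of_forall fun ξ =>
          (integrable_exp_mul_of_integrable hf.integrable_sq ξ).aestronglyMeasurable
      · refine Eventually.of_forall fun ξ => Eventually.of_forall fun η => ?_
        rw [Real.norm_eq_abs, abs_mul, Real.abs_exp, abs_of_nonneg (sq_nonneg (f η))]
        simpa using mul_le_mul_of_nonneg_right (exp_neg_abs_sub_le ξ η) (sq_nonneg (f η))
      · refine Eventually.of_forall fun η => ?_
        have : Tendsto (fun ξ : ℝ => Real.exp (-|ξ - η|)) atTop (𝓝 0) :=
          Real.tendsto_exp_neg_atTop_nhds_zero.comp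
            (tendsto_abs_atTop_atTop.comp (tendsto_atTop_add_const_right _ (-η) tendsto_id))
        simpa using this.mul_const (f η ^ 2)
    simpa using this.const_mul 2
  have h2 := squeeze_zero (fun ξ => sq_nonneg (expConv f ξ)) (sq_expConv_le hf) h1
  have h3 := (Real.continuous_sqrt.tendsto 0).comp h2
  simp only [Function.comp_def, Real.sqrt_sq_eq_abs, Real.sqrt_zero] at h3
  exact (tendsto_zero_iff_abs_tendsto_zero _).2 h3

theorem L2.norm_sq_eq (f : L2) : ‖f‖ ^ 2 = ∫ ξ, f ξ ^ 2 := by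
  rw [← real_inner_self_eq_norm_sq, L2.inner_def]
  simp [sq]

theorem L2.memLp (f : L2) : MemLp (f : ℝ → ℝ) 2 := Lp.memLp f

/-- Convolution with `e^{-|ξ|}` in `L²(ℝ)`. -/
def L2.expConv (f : L2) : L2 := (memLp_expConv (Lp.memLp f)).1.toLp _

theorem L2.expConv_ae (f : L2) : (L2.expConv f : ℝ → ℝ) =ᵐ[volume] CamassaHolm.expConv f :=
  MemLp.coeFn_toLp _

theorem L2.norm_expConv_le (f : L2) : ‖L2.expConv f‖ ≤ 2 * ‖f‖ := by
  refine le_of_sq_le_sq ?_ (by positivity)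
  rw [mul_pow, L2.norm_sq_eq, L2.norm_sq_eq]
  have : ∫ ξ, (L2.expConv f : ℝ → ℝ) ξ ^ 2 = ∫ ξ, CamassaHolm.expConv f ξ ^ 2 :=
    integral_congr_ae ((L2.expConv_ae f).mono fun ξ h => by simp only [h])
  rw [this]
  have := (memLp_expConv (L2.memLp f)).2
  linarith

theorem L2.abs_expConv_le (f : L2) (ξ : ℝ) : |CamassaHolm.expConv f ξ| ≤ 2 * ‖f‖ := by
  refine abs_le_of_sq_le_sq ?_ (by positivity)
  have := CamassaHolm.abs_expConv_le (L2.memLp f) ξ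
  rw [← L2.norm_sq_eq] at this
  nlinarith [sq_nonneg ‖f‖]

/-! ## The integral operators defining `P` and `Q` -/

/-- `¼ ∫ k(ξ, η) s(η) dη`. -/
def kerP (y s : ℝ → ℝ) (ξ : ℝ) : ℝ := 1 / 4 * ∫ η, kernel y ξ η * s η

/-- `-¼ ∫ sgn(ξ - η) k(ξ, η) s(η) dη`. -/
def kerQ (y s : ℝ → ℝ) (ξ : ℝ) : ℝ :=
  -(1 / 4) * ∫ η, Real.sign (ξ - η) * kernel y ξ η * s η

theorem isPrimitive_char (ζ : V) : IsPrimitive (char ζ) (charDer ζ) :=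
  isPrimitive_id.add ζ.isPrimitive

theorem measurable_sign_sub (ξ : ℝ) : Measurable fun η : ℝ => Real.sign (ξ - η) := by
  unfold Real.sign
  refine Measurable.ite ?_ measurable_const (Measurable.ite ?_ measurable_const measurable_const)
  · exact measurableSet_lt (by fun_prop) measurable_const
  · exact measurableSet_lt measurable_const (by fun_prop)

theorem abs_sign_le (x : ℝ) : |Real.sign x| ≤ 1 := by
  rcases lt_trichotomy x 0 with h | h | h
  · simp [Real.sign_of_neg h]
  · simp [h]
  · simp [Real.sign_of_pos h]

theorem measurable_kernel {y : ℝ → ℝ} (hy : Measurable y) (ξ : ℝ) :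
    Measurable fun η => kernel y ξ η :=
  Real.measurable_exp.comp
    ((measurable_sign_sub ξ).mul (measurable_const.sub hy)).neg

theorem sign_mul_self (x : ℝ) : Real.sign x * x = |x| := by
  rcases lt_trichotomy x 0 with h | h | h
  · simp [Real.sign_of_neg h, abs_of_neg h]
  · simp [h]
  · simp [Real.sign_of_pos h, abs_of_pos h]

/-- With `sgn (ξ - η)` in place of an absolute value, the exponent is affine in `ζ`. The kernel
estimates therefore need no monotonicity of `y`, which is known only along the solutions. -/
theorem kernel_exponent (ζ : V) (ξ η : ℝ) :
    Real.sign (ξ - η) * (char ζ ξ - char ζ η) =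
      |ξ - η| + Real.sign (ξ - η) * (V.val ζ ξ - V.val ζ η) := by
  rw [← sign_mul_self, char, char]; ring

theorem abs_kernel_exponent_sub_le (ζ ζ' : V) (ξ η : ℝ) :
    |Real.sign (ξ - η) * (char ζ ξ - char ζ η) - Real.sign (ξ - η) * (char ζ' ξ - char ζ' η)|
      ≤ 2 * ‖ζ - ζ'‖ := by
  have h1 := V.abs_val_le (ζ - ζ') ξ
  have h2 := V.abs_val_le (ζ - ζ') η
  rw [kernel_exponent, kernel_exponent, show ∀ a b c d e : ℝ, a + b * (c - d) - (a + b * e) =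
    b * (c - d - e) from fun a b c d e => by ring, abs_mul]
  refine (mul_le_of_le_one_left (abs_nonneg _) (abs_sign_le _)).trans ?_
  rw [show V.val ζ ξ - V.val ζ η - (V.val ζ' ξ - V.val ζ' η) =
    V.val (ζ - ζ') ξ - V.val (ζ - ζ') η by simp; ring]
  linarith [abs_sub (V.val (ζ - ζ') ξ) (V.val (ζ - ζ') η)]

theorem kernel_le (ζ : V) {M : ℝ} (hM : ‖ζ‖ ≤ M) (ξ η : ℝ) :
    kernel (char ζ) ξ η ≤ Real.exp (2 * M) * Real.exp (-|ξ - η|) := by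
  rw [kernel, ← Real.exp_add, Real.exp_le_exp, kernel_exponent]
  have h1 := abs_le.1 (V.abs_val_le ζ ξ)
  have h2 := abs_le.1 (V.abs_val_le ζ η)
  have h3 : |Real.sign (ξ - η) * (V.val ζ ξ - V.val ζ η)| ≤ 2 * M := by
    rw [abs_mul]
    refine (mul_le_of_le_one_left (abs_nonneg _) (abs_sign_le _)).trans (abs_le.2 ?_)
    constructor <;> linarith
  linarith [neg_le_of_abs_le h3]

theorem kernel_nonneg (y : ℝ → ℝ) (ξ η : ℝ) : 0 ≤ kernel y ξ η := (Real.exp_pos _).le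

theorem abs_exp_neg_sub_le {p q B : ℝ} (hp : Real.exp (-p) ≤ B) (hq : Real.exp (-q) ≤ B) :
    |Real.exp (-p) - Real.exp (-q)| ≤ |p - q| * B := by
  wlog h : p ≤ q generalizing p q
  · rw [abs_sub_comm, abs_sub_comm p]; exact this hq hp (not_le.1 h).le
  have h1 : Real.exp (-q) = Real.exp (-p) * Real.exp (p - q) := by
    rw [← Real.exp_add]; ring_nf
  have h2 := Real.add_one_le_exp (p - q)
  have h3 : Real.exp (-q) ≤ Real.exp (-p) := Real.exp_le_exp.2 (by linarith)
  rw [abs_of_nonneg (by linarith), abs_of_nonpos (by linarith)]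
  nlinarith [Real.exp_pos (-p)]

theorem abs_kernel_sub_le (ζ ζ' : V) {M : ℝ} (h : ‖ζ‖ ≤ M) (h' : ‖ζ'‖ ≤ M) (ξ η : ℝ) :
    |kernel (char ζ) ξ η - kernel (char ζ') ξ η| ≤
      2 * ‖ζ - ζ'‖ * (Real.exp (2 * M) * Real.exp (-|ξ - η|)) :=
  (abs_exp_neg_sub_le (kernel_le ζ h ξ η) (kernel_le ζ' h' ξ η)).trans
    (mul_le_mul_of_nonneg_right (abs_kernel_exponent_sub_le ζ ζ' ξ η) (by positivity))

section

variable {s s' : ℝ → ℝ} (ζ ζ' : V)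

theorem continuous_char : Continuous (char ζ) := (isPrimitive_char ζ).continuous

theorem integrable_kernel_mul (hs : MemLp s 2) (ξ : ℝ) :
    Integrable fun η => kernel (char ζ) ξ η * s η := by
  refine ((integrable_exp_mul hs.norm ξ).const_mul (Real.exp (2 * ‖ζ‖))).mono'
    ((measurable_kernel (continuous_char ζ).measurable ξ).aestronglyMeasurable.mul hs.1)
    (Eventually.of_forall fun η => ?_)
  rw [norm_mul, Real.norm_eq_abs, abs_of_nonneg (kernel_nonneg _ _ _), ← mul_assoc]
  exact mul_le_mul_of_nonneg_right (kernel_le ζ le_rfl ξ η) (norm_nonneg _)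

theorem integrable_sign_kernel_mul (hs : MemLp s 2) (ξ : ℝ) :
    Integrable fun η => Real.sign (ξ - η) * kernel (char ζ) ξ η * s η := by
  simp only [mul_assoc]
  exact (integrable_kernel_mul ζ hs ξ).bdd_mul (c := 1)
    (measurable_sign_sub ξ).aestronglyMeasurable
    (Eventually.of_forall fun η => abs_sign_le _)

/-- The weight `σ` lets one estimate serve for both `P` (`σ = 1`) and `Q` (`σ = sgn`). The second
term in the convolution accounts for the variation of the kernel. -/
theorem abs_integral_kernel_sub_le {σ : ℝ → ℝ} (hσ : Measurable σ) (hσ1 : ∀ η, |σ η| ≤ 1)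
    {M : ℝ} (h : ‖ζ‖ ≤ M) (h' : ‖ζ'‖ ≤ M) (hs : MemLp s 2) (hs' : MemLp s' 2) (ξ : ℝ) :
    |(∫ η, σ η * (kernel (char ζ) ξ η * s η)) - ∫ η, σ η * (kernel (char ζ') ξ η * s' η)| ≤
      2 * Real.exp (2 * M) * expConv (fun η => |s η - s' η| + ‖ζ - ζ'‖ * |s' η|) ξ := by
  have hσb : ∀ᵐ η, ‖σ η‖ ≤ 1 := Eventually.of_forall fun η => hσ1 η
  have i1 := (integrable_kernel_mul ζ hs ξ).bdd_mul (c := 1) hσ.aestronglyMeasurable hσb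
  have i2 := (integrable_kernel_mul ζ' hs' ξ).bdd_mul (c := 1) hσ.aestronglyMeasurable hσb
  have hT : MemLp (fun η => |s η - s' η| + ‖ζ - ζ'‖ * |s' η|) 2 :=
    (hs.sub hs').norm.add (hs'.norm.const_mul _)
  rw [← integral_sub i1 i2, expConv, ← integral_const_mul, ← Real.norm_eq_abs]
  refine norm_integral_le_of_norm_le ((integrable_exp_mul hT ξ).const_mul _)
    (Eventually.of_forall fun η => ?_)
  have e1 := kernel_le ζ h ξ η
  have e2 := abs_kernel_sub_le ζ ζ' h h' ξ η
  have e3 := kernel_nonneg (char ζ) ξ η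
  set k := kernel (char ζ) ξ η
  set k' := kernel (char ζ') ξ η
  set B := Real.exp (2 * M) * Real.exp (-|ξ - η|) with hB
  have hB0 : 0 ≤ B := by positivity
  rw [Real.norm_eq_abs, ← mul_sub, abs_mul, show k * s η - k' * s' η =
    k * (s η - s' η) + (k - k') * s' η by ring]
  refine (mul_le_of_le_one_left (abs_nonneg _) (hσ1 η)).trans ((abs_add_le _ _).trans ?_)
  rw [abs_mul, abs_mul, abs_of_nonneg e3]
  have e4 := mul_le_mul_of_nonneg_right e1 (abs_nonneg (s η - s' η))
  have e5 := mul_le_mul_of_nonneg_right e2 (abs_nonneg (s' η))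
  have e6 : 0 ≤ B * |s η - s' η| := by positivity
  calc _ ≤ B * |s η - s' η| + 2 * ‖ζ - ζ'‖ * B * |s' η| := add_le_add e4 e5
    _ ≤ 2 * (B * |s η - s' η|) + 2 * ‖ζ - ζ'‖ * B * |s' η| := by linarith
    _ = _ := by rw [hB]; ring

theorem abs_kerP_sub_le {M : ℝ} (h : ‖ζ‖ ≤ M) (h' : ‖ζ'‖ ≤ M) (hs : MemLp s 2)
    (hs' : MemLp s' 2) (ξ : ℝ) :
    |kerP (char ζ) s ξ - kerP (char ζ') s' ξ| ≤
      Real.exp (2 * M) * expConv (fun η => |s η - s' η| + ‖ζ - ζ'‖ * |s' η|) ξ := by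
  have := abs_integral_kernel_sub_le ζ ζ' (σ := fun _ => 1) measurable_const (by simp) h h' hs hs' ξ
  simp only [one_mul] at this
  rw [kerP, kerP, ← mul_sub, abs_mul, abs_of_pos (by norm_num : (0 : ℝ) < 1 / 4)]
  linarith [abs_nonneg ((∫ η, kernel (char ζ) ξ η * s η) - ∫ η, kernel (char ζ') ξ η * s' η)]

theorem abs_kerQ_sub_le {M : ℝ} (h : ‖ζ‖ ≤ M) (h' : ‖ζ'‖ ≤ M) (hs : MemLp s 2)
    (hs' : MemLp s' 2) (ξ : ℝ) :
    |kerQ (char ζ) s ξ - kerQ (char ζ') s' ξ| ≤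
      Real.exp (2 * M) * expConv (fun η => |s η - s' η| + ‖ζ - ζ'‖ * |s' η|) ξ := by
  have := abs_integral_kernel_sub_le ζ ζ' (measurable_sign_sub ξ) (fun η => abs_sign_le _)
    h h' hs hs' ξ
  simp only [kerQ, mul_assoc]
  rw [← mul_sub, abs_mul, abs_neg, abs_of_pos (by norm_num : (0 : ℝ) < 1 / 4)]
  linarith [abs_nonneg ((∫ η, Real.sign (ξ - η) * (kernel (char ζ) ξ η * s η)) -
    ∫ η, Real.sign (ξ - η) * (kernel (char ζ') ξ η * s' η))]

theorem abs_kerQ_le {M : ℝ} (h : ‖ζ‖ ≤ M) (hs : MemLp s 2) (ξ : ℝ) :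
    |kerQ (char ζ) s ξ| ≤ Real.exp (2 * M) * expConv (fun η => |s η|) ξ := by
  have := abs_kerQ_sub_le ζ ζ h h hs (MemLp.zero (ε := ℝ)) ξ
  simpa [kerQ] using this

theorem kerP_congr {y : ℝ → ℝ} (h : s =ᵐ[volume] s') : kerP y s = kerP y s' := by
  ext ξ
  exact congrArg _ (integral_congr_ae (h.mono fun η hη => by simp only [hη]))

theorem kerQ_congr {y : ℝ → ℝ} (h : s =ᵐ[volume] s') : kerQ y s = kerQ y s' := by
  ext ξ
  exact congrArg _ (integral_congr_ae (h.mono fun η hη => by simp only [hη]))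

theorem integrableOn_exp_char_mul (hs : MemLp s 2) (ξ : ℝ) :
    IntegrableOn (fun η => Real.exp (char ζ η) * s η) (Iic ξ) := by
  refine (((integrable_kernel_mul ζ hs ξ).const_mul (Real.exp (char ζ ξ))).integrableOn
    (s := Iic ξ)).congr ?_
  rw [← restrict_Iio_eq_restrict_Iic]
  filter_upwards [ae_restrict_mem measurableSet_Iio] with η hη
  rw [kernel, Real.sign_of_pos (sub_pos.2 hη), ← mul_assoc, ← Real.exp_add]
  ring_nf

theorem integrableOn_exp_neg_char_mul (hs : MemLp s 2) (ξ : ℝ) :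
    IntegrableOn (fun η => Real.exp (-char ζ η) * s η) (Ioi ξ) := by
  refine (((integrable_kernel_mul ζ hs ξ).const_mul (Real.exp (-char ζ ξ))).integrableOn
    (s := Ioi ξ)).congr ?_
  filter_upwards [ae_restrict_mem measurableSet_Ioi] with η hη
  rw [kernel, Real.sign_of_neg (sub_neg.2 hη), ← mul_assoc, ← Real.exp_add]
  ring_nf

/-- The kernel is a product of a function of `ξ` and a function of `η` on each side of `ξ`. The
weight `σ` is prescribed only for `η < ξ`, because `sgn` vanishes at the endpoint. -/
theorem integral_kernel_Iic (s : ℝ → ℝ) (ξ : ℝ) {σ : ℝ → ℝ} {c : ℝ} (hσ : ∀ η < ξ, σ η = c) :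
    ∫ η in Iic ξ, σ η * (kernel (char ζ) ξ η * s η) =
      c * (Real.exp (-char ζ ξ) * ∫ η in Iic ξ, Real.exp (char ζ η) * s η) := by
  rw [← integral_const_mul, ← integral_const_mul, ← restrict_Iio_eq_restrict_Iic]
  refine setIntegral_congr_fun measurableSet_Iio fun η hη => ?_
  rw [kernel, Real.sign_of_pos (sub_pos.2 hη), hσ η hη, ← mul_assoc (Real.exp _) _ (s η),
    ← Real.exp_add]
  ring_nf

theorem integral_kernel_Ioi (s : ℝ → ℝ) (ξ : ℝ) {σ : ℝ → ℝ} {c : ℝ} (hσ : ∀ η > ξ, σ η = c) :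
    ∫ η in Ioi ξ, σ η * (kernel (char ζ) ξ η * s η) =
      c * (Real.exp (char ζ ξ) * ∫ η in Ioi ξ, Real.exp (-char ζ η) * s η) := by
  rw [← integral_const_mul, ← integral_const_mul]
  refine setIntegral_congr_fun measurableSet_Ioi fun η hη => ?_
  rw [kernel, Real.sign_of_neg (sub_neg.2 hη), hσ η hη, ← mul_assoc (Real.exp _) _ (s η),
    ← Real.exp_add]
  ring_nf

theorem kerP_eq (hs : MemLp s 2) (ξ : ℝ) : kerP (char ζ) s ξ =
    1 / 4 * (Real.exp (-char ζ ξ) * ∫ η in Iic ξ, Real.exp (char ζ η) * s η) +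
    1 / 4 * (Real.exp (char ζ ξ) * ∫ η in Ioi ξ, Real.exp (-char ζ η) * s η) := by
  have hi := integrable_kernel_mul ζ hs ξ
  have h1 := integral_kernel_Iic ζ s ξ (σ := fun _ => 1) (fun _ _ => rfl)
  have h2 := integral_kernel_Ioi ζ s ξ (σ := fun _ => 1) (fun _ _ => rfl)
  simp only [one_mul] at h1 h2
  rw [kerP, ← intervalIntegral.integral_Iic_add_Ioi hi.integrableOn hi.integrableOn (b := ξ),
    h1, h2, mul_add]

theorem kerQ_eq (hs : MemLp s 2) (ξ : ℝ) : kerQ (char ζ) s ξ =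
    1 / 4 * (Real.exp (char ζ ξ) * ∫ η in Ioi ξ, Real.exp (-char ζ η) * s η) -
    1 / 4 * (Real.exp (-char ζ ξ) * ∫ η in Iic ξ, Real.exp (char ζ η) * s η) := by
  have hi := integrable_sign_kernel_mul ζ hs ξ
  have h1 := integral_kernel_Iic ζ s ξ (σ := fun η => Real.sign (ξ - η))
    (fun η hη => Real.sign_of_pos (sub_pos.2 hη))
  have h2 := integral_kernel_Ioi ζ s ξ (σ := fun η => Real.sign (ξ - η))
    (fun η hη => Real.sign_of_neg (sub_neg.2 hη))
  simp only [← mul_assoc (Real.sign _)] at h1 h2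
  rw [kerQ, ← intervalIntegral.integral_Iic_add_Ioi hi.integrableOn hi.integrableOn (b := ξ),
    h1, h2]
  ring

theorem isPrimitive_integral_Iic {f : ℝ → ℝ} (hf : LocallyIntegrable f)
    (h : ∀ ξ, IntegrableOn f (Iic ξ)) : IsPrimitive (fun ξ => ∫ η in Iic ξ, f η) f :=
  .of_integral hf fun a b => (intervalIntegral.integral_Iic_sub_Iic (h a) (h b)).symm

theorem isPrimitive_integral_Ioi {f : ℝ → ℝ} (hf : LocallyIntegrable f)
    (h : ∀ ξ, IntegrableOn f (Ioi ξ)) : IsPrimitive (fun ξ => ∫ η in Ioi ξ, f η) (fun ξ => -f ξ) :=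
  .of_integral hf.neg fun a b => by
    rw [intervalIntegral.integral_neg, ← intervalIntegral.integral_Ioi_sub_Ioi' (h a) (h b)]
    ring

theorem isPrimitive_exp {F f : ℝ → ℝ} (h : IsPrimitive F f) :
    IsPrimitive (fun ξ => Real.exp (F ξ)) (fun ξ => Real.exp (F ξ) * f ξ) := by
  simpa using h.comp Real.contDiff_exp

/-- Call the two functions `A` and `B`. The product rule gives `A_ξ = s - y_ξ A` and `B_ξ = y_ξ B -
s`. Since `4 P = A + B` and `4 Q = B - A`, this yields `P_ξ = Q y_ξ` and `Q_ξ = P y_ξ - s / 2`. -/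
theorem isPrimitive_exp_mul_integrals (hs : MemLp s 2) :
    IsPrimitive (fun ξ => Real.exp (-char ζ ξ) * ∫ η in Iic ξ, Real.exp (char ζ η) * s η)
      (fun ξ => s ξ - charDer ζ ξ *
        (Real.exp (-char ζ ξ) * ∫ η in Iic ξ, Real.exp (char ζ η) * s η)) ∧
    IsPrimitive (fun ξ => Real.exp (char ζ ξ) * ∫ η in Ioi ξ, Real.exp (-char ζ η) * s η)
      (fun ξ => charDer ζ ξ *
        (Real.exp (char ζ ξ) * ∫ η in Ioi ξ, Real.exp (-char ζ η) * s η) - s ξ) := by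
  have hl : LocallyIntegrable s := hs.locallyIntegrable one_le_two
  have hc := continuous_char ζ
  have hy := isPrimitive_char ζ
  have hy' : IsPrimitive (fun ξ => -char ζ ξ) (fun ξ => -charDer ζ ξ) := by
    simpa using hy.const_mul (-1)
  have hl1 : LocallyIntegrable fun η => Real.exp (char ζ η) * s η :=
    hl.continuous_mul (Real.continuous_exp.comp hc)
  have hl2 : LocallyIntegrable fun η => Real.exp (-char ζ η) * s η :=
    hl.continuous_mul (Real.continuous_exp.comp hc.neg)
  have e (x : ℝ) : Real.exp (-x) * Real.exp x = 1 := by rw [← Real.exp_add]; simp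
  constructor
  · refine ((isPrimitive_exp hy').mul
      (isPrimitive_integral_Iic hl1 (integrableOn_exp_char_mul ζ hs))).congr
      (Eventually.of_forall fun ξ => ?_)
    simp only
    linear_combination s ξ * e (char ζ ξ)
  · refine ((isPrimitive_exp hy).mul
      (isPrimitive_integral_Ioi hl2 (integrableOn_exp_neg_char_mul ζ hs))).congr
      (Eventually.of_forall fun ξ => ?_)
    simp only
    linear_combination -s ξ * e (char ζ ξ)

theorem isPrimitive_kerP (hs : MemLp s 2) :
    IsPrimitive (kerP (char ζ) s) (fun ξ => kerQ (char ζ) s ξ * charDer ζ ξ) := by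
  obtain ⟨h1, h2⟩ := isPrimitive_exp_mul_integrals ζ hs
  have h := (h1.const_mul (1 / 4)).add (h2.const_mul (1 / 4))
  rw [show kerP (char ζ) s = _ from funext (kerP_eq ζ hs)]
  refine h.congr (Eventually.of_forall fun ξ => ?_)
  simp only [kerQ_eq ζ hs]
  ring

theorem isPrimitive_kerQ (hs : MemLp s 2) :
    IsPrimitive (kerQ (char ζ) s) (fun ξ => kerP (char ζ) s ξ * charDer ζ ξ - 1 / 2 * s ξ) := by
  obtain ⟨h1, h2⟩ := isPrimitive_exp_mul_integrals ζ hs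
  have h := (h2.const_mul (1 / 4)).sub (h1.const_mul (1 / 4))
  rw [show kerQ (char ζ) s = _ from funext (kerQ_eq ζ hs)]
  refine h.congr (Eventually.of_forall fun ξ => ?_)
  simp only [kerP_eq ζ hs]
  ring

end

/-! ## The system for vanishing asymptotics, and uniqueness of its solutions -/

theorem MemLp.mul_of_bound {f g : ℝ → ℝ} (hf : MemLp f 2) (hg : AEStronglyMeasurable g volume)
    {C : ℝ} (hC : ∀ ξ, |g ξ| ≤ C) : MemLp (fun ξ => g ξ * f ξ) 2 :=
  (hf.const_mul C).mono (hg.mul hf.1) (Eventually.of_forall fun ξ => by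
    rw [norm_mul, norm_mul]
    exact mul_le_mul_of_nonneg_right ((hC ξ).trans (le_abs_self C)) (norm_nonneg _))

/-- The factor `3` is `1` plus the bound `2` for the norm of the convolution operator. -/
theorem L2.norm_le_of_ae {f : L2} {T : L2} {C : ℝ} (hC : 0 ≤ C)
    (h : ∀ᵐ ξ, |(f : ℝ → ℝ) ξ| ≤ C * ((T : ℝ → ℝ) ξ + CamassaHolm.expConv T ξ)) : ‖f‖ ≤ C * (3 * ‖T‖) := by
  have h1 : ‖f‖ ≤ ‖C • (T + L2.expConv T)‖ := by
    refine Lp.norm_le_norm_of_ae_le ?_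
    filter_upwards [h, Lp.coeFn_smul C (T + L2.expConv T), Lp.coeFn_add T (L2.expConv T),
      L2.expConv_ae T] with ξ e1 e2 e3 e4
    rw [e2, Pi.smul_apply, e3, Pi.add_apply, e4]
    exact e1.trans (le_abs_self _)
  rw [norm_smul, Real.norm_of_nonneg hC] at h1
  refine h1.trans (mul_le_mul_of_nonneg_left ?_ hC)
  linarith [norm_add_le T (L2.expConv T), L2.norm_expConv_le T]

/-- The state space `V × H¹(ℝ) × L²(ℝ)`, with elements `(ζ, U, h)`. -/
abbrev State : Type := V × H1 × L2

namespace State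

/-- The unknown `U`. -/
def U (X : State) : ℝ → ℝ := H1.val X.2.1

/-- The derivative `U_ξ`. -/
def UDer (X : State) : ℝ → ℝ := H1.der X.2.1

/-- The unknown `h`. -/
def h (X : State) : ℝ → ℝ := X.2.2

/-- The density `2 U² y_ξ + h`. -/
def source (X : State) (ξ : ℝ) : ℝ := 2 * U X ξ ^ 2 * charDer X.1 ξ + h X ξ

/-- The function `P`. -/
def P (X : State) : ℝ → ℝ := kerP (char X.1) (source X)

/-- The function `Q`. -/
def Q (X : State) : ℝ → ℝ := kerQ (char X.1) (source X)

/-- `X'` is the right-hand side of `y_t = U`, `U_t = -Q`, `h_t = 2 (U² - P) U_ξ` at `X`. -/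
structure IsRHS (X X' : State) : Prop where
  y : ∀ ξ, V.val X'.1 ξ = U X ξ
  U : ∀ ξ, U X' ξ = -Q X ξ
  h : h X' =ᵐ[volume] fun ξ => 2 * (State.U X ξ ^ 2 - P X ξ) * UDer X ξ

/-- `X ∈ C¹([0, ∞))` solves the system. -/
def IsSolution (X : ℝ → State) : Prop :=
  ∀ t : ℝ, 0 ≤ t → ∃ X', HasDerivWithinAt X X' (Ici 0) t ∧ IsRHS (X t) X'

theorem abs_U_le (X : State) (ξ : ℝ) : |U X ξ| ≤ ‖X‖ :=
  (H1.abs_val_le X.2.1 ξ).trans ((le_max_left _ _).trans (le_max_right ‖X.1‖ _))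

theorem continuous_U (X : State) : Continuous (U X) := X.2.1.isPrimitive.continuous

theorem memLp_sq_mul_charDer (X : State) : MemLp (fun ξ => U X ξ ^ 2 * charDer X.1 ξ) 2 := by
  have hm := X.continuous_U.aestronglyMeasurable (μ := volume)
  have h1 : MemLp (fun ξ => U X ξ * U X ξ) 2 :=
    MemLp.mul_of_bound X.2.1.memLp_val hm X.abs_U_le
  have h2 : MemLp (fun ξ => U X ξ * (U X ξ * V.der X.1 ξ)) 2 :=
    MemLp.mul_of_bound (MemLp.mul_of_bound X.1.memLp_der hm X.abs_U_le) hm X.abs_U_le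
  refine (h1.add h2).ae_eq (Eventually.of_forall fun ξ => ?_)
  simp only [Pi.add_apply, charDer]
  ring

theorem memLp_source (X : State) : MemLp (source X) 2 := by
  refine ((X.memLp_sq_mul_charDer.const_mul 2).add (L2.memLp X.2.2)).ae_eq
    (Eventually.of_forall fun ξ => ?_)
  simp only [Pi.add_apply, source, h]
  ring

theorem isPrimitive_P (X : State) : IsPrimitive (P X) (fun ξ => Q X ξ * charDer X.1 ξ) :=
  isPrimitive_kerP X.1 X.memLp_source

theorem isPrimitive_Q (X : State) :
    IsPrimitive (Q X) (fun ξ => P X ξ * charDer X.1 ξ - 1 / 2 * source X ξ) :=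
  isPrimitive_kerQ X.1 X.memLp_source

theorem IsRHS.der_y {X X' : State} (hX : IsRHS X X') : V.der X'.1 =ᵐ[volume] UDer X :=
  V.der_ae hX.y X.2.1.isPrimitive

/-- The equation `U_t = -Q` differentiated in `ξ`; it controls the derivative part of the `H¹` norm
and enters the conservation of `y_ξ h - U_ξ²`. -/
theorem IsRHS.der_U {X X' : State} (hX : IsRHS X X') :
    UDer X' =ᵐ[volume] fun ξ => 1 / 2 * source X ξ - P X ξ * charDer X.1 ξ := by
  refine H1.der_ae (F := fun ξ => -1 * Q X ξ) (fun ξ => ?_) ((X.isPrimitive_Q.const_mul (-1)).congr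
    (Eventually.of_forall fun ξ => by simp only; ring))
  rw [← neg_eq_neg_one_mul]; exact hX.U ξ

/-! ### Local Lipschitz estimate for the right-hand side -/

/-- The function `|U| + |ζ_ξ| + |U_ξ| + |h|`. -/
def total (X : State) : L2 := |X.2.1.1.2| + |X.1.1.2| + |X.2.1.1.1.1.2| + |X.2.2|

theorem total_ae (X : State) : ∀ᵐ ξ, (total X : ℝ → ℝ) ξ =
    |U X ξ| + |V.der X.1 ξ| + |UDer X ξ| + |h X ξ| := by
  have hU : (X.2.1.1.2 : ℝ → ℝ) =ᵐ[volume] U X := X.2.1.2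
  filter_upwards [Lp.coeFn_add (|X.2.1.1.2| + |X.1.1.2| + |X.2.1.1.1.1.2|) |X.2.2|,
    Lp.coeFn_add (|X.2.1.1.2| + |X.1.1.2|) |X.2.1.1.1.1.2|,
    Lp.coeFn_add |X.2.1.1.2| |X.1.1.2|, Lp.coeFn_abs X.2.1.1.2, Lp.coeFn_abs X.1.1.2,
    Lp.coeFn_abs X.2.1.1.1.1.2, Lp.coeFn_abs X.2.2, hU] with ξ h1 h2 h3 h4 h5 h6 h7 h8
  simp only [Pi.add_apply] at h1 h2 h3
  rw [total, h1, h2, h3, h4, h5, h6, h7, h8]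
  rfl

theorem norm_total_le (X : State) : ‖total X‖ ≤ 4 * ‖X‖ := by
  have h1 : ‖X.1.1.2‖ ≤ ‖X‖ := (le_max_right _ _).trans (le_max_left ‖X.1‖ _)
  have h2 : ‖X.2.1‖ ≤ ‖X‖ := (le_max_left _ _).trans (le_max_right ‖X.1‖ _)
  have h3 : ‖X.2.1.1.2‖ ≤ ‖X‖ := (le_max_right _ _).trans h2
  have h4 : ‖X.2.1.1.1.1.2‖ ≤ ‖X‖ := (le_max_right _ _).trans ((le_max_left _ _).trans h2)
  have h5 : ‖X.2.2‖ ≤ ‖X‖ := (le_max_right _ _).trans (le_max_right ‖X.1‖ _)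
  have := (norm_add_le (|X.2.1.1.2| + |X.1.1.2| + |X.2.1.1.1.1.2|) |X.2.2|)
  have := (norm_add_le (|X.2.1.1.2| + |X.1.1.2|) |X.2.1.1.1.1.2|)
  have := (norm_add_le |X.2.1.1.2| |X.1.1.2|)
  simp only [norm_abs_eq_norm] at *
  rw [total]
  linarith

/-- A function dominating the difference of the right-hand sides at `X` and `Y`. -/
def diff (X Y : State) : L2 := total (X - Y) + ‖X - Y‖ • (total X + total Y)

theorem diff_ae (X Y : State) : ∀ᵐ ξ, (diff X Y : ℝ → ℝ) ξ =
    (|U X ξ - U Y ξ| + |V.der X.1 ξ - V.der Y.1 ξ| + |UDer X ξ - UDer Y ξ| + |h X ξ - h Y ξ|) +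
    ‖X - Y‖ * ((|U X ξ| + |V.der X.1 ξ| + |UDer X ξ| + |h X ξ|) +
      (|U Y ξ| + |V.der Y.1 ξ| + |UDer Y ξ| + |h Y ξ|)) := by
  filter_upwards [total_ae X, total_ae Y, total_ae (X - Y), Lp.coeFn_sub X.2.2 Y.2.2,
    V.der_sub X.1 Y.1, V.der_sub X.2.1.1.1 Y.2.1.1.1,
    Lp.coeFn_add (total (X - Y)) (‖X - Y‖ • (total X + total Y)),
    Lp.coeFn_smul ‖X - Y‖ (total X + total Y), Lp.coeFn_add (total X) (total Y)]
    with ξ h1 h2 h3 h4 h5 h6 h7 h8 h9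
  have e1 : h (X - Y) ξ = h X ξ - h Y ξ := h4
  have e2 : V.der (X - Y).1 ξ = V.der X.1 ξ - V.der Y.1 ξ := h5
  have e3 : UDer (X - Y) ξ = UDer X ξ - UDer Y ξ := h6
  have e4 : U (X - Y) ξ = U X ξ - U Y ξ := rfl
  simp only [Pi.add_apply, Pi.smul_apply, smul_eq_mul] at h7 h8 h9
  rw [diff, h7, h8, h9, h3, h1, h2, e1, e2, e3, e4]

theorem norm_diff_le {X Y : State} {M : ℝ} (hX : ‖X‖ ≤ M) (hY : ‖Y‖ ≤ M) :
    ‖diff X Y‖ ≤ (4 + 8 * M) * ‖X - Y‖ := by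
  have h1 := norm_total_le X
  have h2 := norm_total_le Y
  have h3 := norm_total_le (X - Y)
  have h4 := norm_add_le (total (X - Y)) (‖X - Y‖ • (total X + total Y))
  have h5 := norm_add_le (total X) (total Y)
  rw [norm_smul, norm_norm] at h4
  have h6 : ‖X - Y‖ * ‖total X + total Y‖ ≤ ‖X - Y‖ * (8 * M) :=
    mul_le_mul_of_nonneg_left (by linarith) (norm_nonneg _)
  rw [diff]
  linarith

/-- The Lipschitz constant of the source on the ball of radius `M`. -/
def sourceConst (M : ℝ) : ℝ := 4 * M ^ 2 + 6 * M + 2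

/-- The left side is the function whose convolution bounds the differences of `P` and of `Q`. The
terms `‖X - Y‖ * |·|` in `diff` are there for products such as `(U_X - U_Y) ζ_ξ`, where the first
factor is small in sup norm and the second is only in `L²`. -/
theorem source_sub_ae {X Y : State} {M : ℝ} (hX : ‖X‖ ≤ M) (hY : ‖Y‖ ≤ M) :
    ∀ᵐ ξ, |source X ξ - source Y ξ| + ‖X - Y‖ * |source Y ξ| ≤
      sourceConst M * (diff X Y : ℝ → ℝ) ξ := by
  filter_upwards [diff_ae X Y] with ξ hξ
  have hM : 0 ≤ M := (norm_nonneg _).trans hX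
  have hδ := norm_nonneg (X - Y)
  have u1 := (abs_U_le X ξ).trans hX
  have u2 := (abs_U_le Y ξ).trans hY
  have u3 : |U X ξ - U Y ξ| ≤ ‖X - Y‖ := abs_U_le (X - Y) ξ
  rw [hξ]
  simp only [source, charDer]
  set δ := ‖X - Y‖
  set u := U X ξ
  set v := U Y ξ
  set a := V.der X.1 ξ
  set b := V.der Y.1 ξ
  set p := h X ξ
  set q := h Y ξ
  have e1 : |2 * u ^ 2 * (1 + a) + p - (2 * v ^ 2 * (1 + b) + q)| ≤
      4 * M * |u - v| + 4 * M * (δ * |a|) + 2 * M ^ 2 * |a - b| + |p - q| := by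
    have : 2 * u ^ 2 * (1 + a) + p - (2 * v ^ 2 * (1 + b) + q) =
      2 * (u + v) * (u - v) + 2 * (u + v) * ((u - v) * a) + 2 * v ^ 2 * (a - b) + (p - q) := by ring
    rw [this]
    have h1 : |2 * (u + v)| ≤ 4 * M := by
      rw [abs_mul, abs_two]; linarith [abs_add_le u v]
    have h2 : |2 * v ^ 2| ≤ 2 * M ^ 2 := by
      rw [abs_mul, abs_two, abs_pow]; gcongr
    refine (abs_add_le _ _).trans (add_le_add ((abs_add_le _ _).trans (add_le_add
      ((abs_add_le _ _).trans (add_le_add ?_ ?_)) ?_)) le_rfl)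
    · rw [abs_mul]; gcongr
    · rw [abs_mul, abs_mul (u - v)]; gcongr
    · rw [abs_mul]; gcongr
  have e2 : |2 * v ^ 2 * (1 + b) + q| ≤ 2 * M * |v| + 2 * M ^ 2 * |b| + |q| := by
    rw [show 2 * v ^ 2 * (1 + b) + q = 2 * v * v + 2 * v ^ 2 * b + q by ring]
    refine (abs_add_le _ _).trans (add_le_add ((abs_add_le _ _).trans (add_le_add ?_ ?_)) le_rfl)
    · rw [abs_mul, abs_mul, abs_two]; gcongr
    · rw [abs_mul, abs_mul, abs_two, abs_pow]; gcongr
  have e3 := mul_le_mul_of_nonneg_left e2 hδ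
  refine (add_le_add e1 e3).trans ?_
  rw [sourceConst, ← sub_nonneg]
  -- This is the right side minus the left side, with coefficients collected; `sourceConst` is large
  -- enough to keep each of them nonnegative.
  have : 0 ≤ (4 * M ^ 2 + 2 * M + 2) * |u - v| + (2 * M ^ 2 + 6 * M + 2) * |a - b|
    + (4 * M ^ 2 + 6 * M + 1) * |p - q|
    + δ * ((4 * M ^ 2 + 4 * M + 2) * |v| + (2 * M ^ 2 + 6 * M + 2) * |b|
      + (4 * M ^ 2 + 6 * M + 1) * |q| + (4 * M ^ 2 + 2 * M + 2) * |a|)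
    + (4 * M ^ 2 + 6 * M + 2) * (|UDer X ξ - UDer Y ξ| +
      δ * (|u| + |UDer X ξ| + |p| + |UDer Y ξ|)) := by positivity
  nlinarith [this]

theorem memLp_source_diff (X Y : State) :
    MemLp (fun η => |source X η - source Y η| + ‖X.1 - Y.1‖ * |source Y η|) 2 :=
  (X.memLp_source.sub Y.memLp_source).norm.add (Y.memLp_source.norm.const_mul _)

theorem norm_fst_le (X : State) : ‖X.1‖ ≤ ‖X‖ := le_max_left _ _

theorem expConv_source_diff_le {X Y : State} {M : ℝ} (hX : ‖X‖ ≤ M) (hY : ‖Y‖ ≤ M) (ξ : ℝ) :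
    expConv (fun η => |source X η - source Y η| + ‖X.1 - Y.1‖ * |source Y η|) ξ ≤
      sourceConst M * expConv (diff X Y) ξ := by
  rw [← expConv_const_mul]
  refine expConv_mono (memLp_source_diff X Y) ((L2.memLp _).const_mul _) ?_ ξ
  filter_upwards [source_sub_ae hX hY] with η hη
  refine le_trans ?_ hη
  gcongr
  exact norm_fst_le (X - Y)

/-- The Lipschitz constant of `P` and `Q` on the ball of radius `M`. -/
def kerConst (M : ℝ) : ℝ := Real.exp (2 * M) * sourceConst M

theorem abs_P_sub_le {X Y : State} {M : ℝ} (hX : ‖X‖ ≤ M) (hY : ‖Y‖ ≤ M) (ξ : ℝ) :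
    |P X ξ - P Y ξ| ≤ kerConst M * expConv (diff X Y) ξ := by
  refine (abs_kerP_sub_le X.1 Y.1 ((norm_fst_le X).trans hX) ((norm_fst_le Y).trans hY)
    X.memLp_source Y.memLp_source ξ).trans ?_
  rw [kerConst, mul_assoc]
  exact mul_le_mul_of_nonneg_left (expConv_source_diff_le hX hY ξ) (Real.exp_pos _).le

theorem abs_Q_sub_le {X Y : State} {M : ℝ} (hX : ‖X‖ ≤ M) (hY : ‖Y‖ ≤ M) (ξ : ℝ) :
    |Q X ξ - Q Y ξ| ≤ kerConst M * expConv (diff X Y) ξ := by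
  refine (abs_kerQ_sub_le X.1 Y.1 ((norm_fst_le X).trans hX) ((norm_fst_le Y).trans hY)
    X.memLp_source Y.memLp_source ξ).trans ?_
  rw [kerConst, mul_assoc]
  exact mul_le_mul_of_nonneg_left (expConv_source_diff_le hX hY ξ) (Real.exp_pos _).le

theorem kerConst_nonneg {M : ℝ} (hM : 0 ≤ M) : 0 ≤ kerConst M := by
  rw [kerConst, sourceConst]; positivity

theorem expConv_diff_le {X Y : State} {M : ℝ} (hX : ‖X‖ ≤ M) (hY : ‖Y‖ ≤ M) (ξ : ℝ) :
    expConv (diff X Y) ξ ≤ (8 + 16 * M) * ‖X - Y‖ := by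
  have h1 := (le_abs_self _).trans (L2.abs_expConv_le (diff X Y) ξ)
  have h2 := norm_diff_le hX hY
  linarith

theorem P_zero (ξ : ℝ) : P 0 ξ = 0 := by
  have h1 : source 0 =ᵐ[volume] fun _ => 0 := by
    filter_upwards [Lp.coeFn_zero ℝ 2 (volume : Measure ℝ)] with ξ hξ
    have e1 : U 0 ξ = 0 := rfl
    have e2 : h 0 ξ = 0 := hξ
    rw [source, e1, e2]; ring
  rw [P, kerP_congr h1]
  simp [kerP]

/-- A bound for `P` on the ball of radius `M`. -/
def PBound (M : ℝ) : ℝ := kerConst M * ((8 + 16 * M) * M)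

theorem abs_P_le {X : State} {M : ℝ} (hX : ‖X‖ ≤ M) (ξ : ℝ) : |P X ξ| ≤ PBound M := by
  have hM : 0 ≤ M := (norm_nonneg _).trans hX
  -- A bound for `P` is its Lipschitz estimate against the zero state, where `P` vanishes.
  have h1 := abs_P_sub_le hX (Y := 0) (by simpa using hM) ξ
  have h2 := expConv_diff_le hX (Y := 0) (by simpa using hM) ξ
  rw [P_zero, sub_zero] at h1
  rw [sub_zero] at h2
  refine h1.trans (mul_le_mul_of_nonneg_left (h2.trans ?_) (kerConst_nonneg hM))
  gcongr

/-- The right-hand side is Lipschitz on bounded sets. -/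
theorem exists_lipschitz (M : ℝ) : ∃ C : ℝ, ∀ X Y X' Y' : State, ‖X‖ ≤ M → ‖Y‖ ≤ M →
    IsRHS X X' → IsRHS Y Y' → ‖X' - Y'‖ ≤ C * ‖X - Y‖ := by
  rcases lt_or_ge M 0 with hM | hM
  · exact ⟨0, fun X _ _ _ hX => absurd ((norm_nonneg X).trans hX) (not_le.2 hM)⟩
  set A := kerConst M with hA
  have hA0 : 0 ≤ A := kerConst_nonneg hM
  set N := 8 + 16 * M with hN
  have hN0 : 0 ≤ N := by positivity
  have hB0 : 0 ≤ PBound M := by rw [PBound]; positivity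
  have hS0 : 0 ≤ sourceConst M := by rw [sourceConst]; positivity
  -- A sum of the constants needed by the several components, so that one `C` serves for all of
  -- them.
  set C := A + A * N + PBound M + sourceConst M + 2 * (M ^ 2 + PBound M) + 2 * (2 * M + A * N) + 1
    with hC
  have hC0 : 0 ≤ C := by positivity
  refine ⟨1 + A * N + C * (3 * (4 + 8 * M)), fun X Y X' Y' hX hY hX' hY' => ?_⟩
  set δ := ‖X - Y‖ with hδ
  have hδ0 : 0 ≤ δ := norm_nonneg _
  have hT : ∀ f : L2, (∀ᵐ ξ, |(f : ℝ → ℝ) ξ| ≤ C * ((diff X Y : ℝ → ℝ) ξ + expConv (diff X Y) ξ)) →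
      ‖f‖ ≤ (1 + A * N + C * (3 * (4 + 8 * M))) * δ := by
    intro f hf
    refine (L2.norm_le_of_ae hC0 hf).trans ?_
    have := norm_diff_le hX hY
    have h2 : C * (3 * ‖diff X Y‖) ≤ C * (3 * ((4 + 8 * M) * δ)) := by gcongr
    have h3 : 0 ≤ (1 + A * N) * δ := by positivity
    linarith
  have hdiff0 : ∀ᵐ ξ, 0 ≤ (diff X Y : ℝ → ℝ) ξ := by
    filter_upwards [diff_ae X Y] with ξ hξ
    rw [hξ]; positivity
  have hK0 := expConv_nonneg hdiff0
  have hKN := expConv_diff_le hX hY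
  have hP := abs_P_sub_le hX hY
  have hQ := abs_Q_sub_le hX hY
  have hPN (ξ : ℝ) : |P X ξ - P Y ξ| ≤ A * N * δ := by
    refine (hP ξ).trans ?_
    rw [mul_assoc]
    exact mul_le_mul_of_nonneg_left (hKN ξ) hA0
  have hQN (ξ : ℝ) : |Q X ξ - Q Y ξ| ≤ A * N * δ := by
    refine (hQ ξ).trans ?_
    rw [mul_assoc]
    exact mul_le_mul_of_nonneg_left (hKN ξ) hA0
  have hrest : 0 ≤ C * (3 * (4 + 8 * M)) * δ := by positivity
  have hAN : 0 ≤ A * N * δ := by positivity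
  -- The norm is a maximum over `ζ` in `V`, `U` in `V`, `U` in `L²` and `h` in `L²`. Sup norms use
  -- `hQN` or the norm of `U`; each `L²` norm goes through `hT`.
  refine max_le ?_ (max_le (max_le ?_ ?_) ?_)
  · refine (V.norm_le (C := (1 + A * N + C * (3 * (4 + 8 * M))) * δ) (fun ξ => ?_)
      (hT _ ?_)).trans (max_le le_rfl le_rfl)
    · have : |U X ξ - U Y ξ| ≤ δ := abs_U_le (X - Y) ξ
      rw [Prod.fst_sub, V.val_sub, hX'.y, hY'.y]
      linarith
    · filter_upwards [V.der_sub X'.1 Y'.1, hX'.der_y, hY'.der_y, diff_ae X Y, hdiff0]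
        with ξ e1 e2 e3 e4 e5
      change |V.der (X'.1 - Y'.1) ξ| ≤ _
      rw [e1, e2, e3]
      have h1 : |UDer X ξ - UDer Y ξ| ≤ (diff X Y : ℝ → ℝ) ξ := by
        rw [e4, ← sub_nonneg]
        have : 0 ≤ |U X ξ - U Y ξ| + |V.der X.1 ξ - V.der Y.1 ξ| + |h X ξ - h Y ξ| +
          δ * ((|U X ξ| + |V.der X.1 ξ| + |UDer X ξ| + |h X ξ|) +
          (|U Y ξ| + |V.der Y.1 ξ| + |UDer Y ξ| + |h Y ξ|)) := by positivity
        linarith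
      have h2 : (1 : ℝ) ≤ C := by rw [hC]; exact le_add_of_nonneg_left (by positivity)
      have h3 := hK0 ξ
      calc _ ≤ (diff X Y : ℝ → ℝ) ξ := h1
        _ ≤ 1 * ((diff X Y : ℝ → ℝ) ξ + expConv (diff X Y) ξ) := by linarith
        _ ≤ _ := by gcongr
  · refine (V.norm_le (C := (1 + A * N + C * (3 * (4 + 8 * M))) * δ) (fun ξ => ?_)
      (hT _ ?_)).trans (max_le le_rfl le_rfl)
    · change |U X' ξ - U Y' ξ| ≤ _
      rw [hX'.U, hY'.U, neg_sub_neg, abs_sub_comm]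
      linarith [hQN ξ]
    · filter_upwards [V.der_sub X'.2.1.1.1 Y'.2.1.1.1, hX'.der_U, hY'.der_U, diff_ae X Y, hdiff0,
        source_sub_ae hX hY] with ξ e1 e2 e3 e4 e5 e6
      change |V.der (X'.2.1.1.1 - Y'.2.1.1.1) ξ| ≤ _
      rw [e1]
      change |UDer X' ξ - UDer Y' ξ| ≤ _
      rw [e2, e3]
      have p1 := hP ξ
      have p2 := hPN ξ
      have p3 := abs_P_le hY ξ
      have p4 := hK0 ξ
      simp only [charDer]
      set T := (diff X Y : ℝ → ℝ) ξ
      set K := expConv (diff X Y) ξ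
      have d1 : |V.der X.1 ξ - V.der Y.1 ξ| + δ * |V.der X.1 ξ| ≤ T := by
        rw [e4, ← sub_nonneg]
        have : 0 ≤ |U X ξ - U Y ξ| + |UDer X ξ - UDer Y ξ| + |h X ξ - h Y ξ| +
          δ * ((|U X ξ| + |UDer X ξ| + |h X ξ|) +
          (|U Y ξ| + |V.der Y.1 ξ| + |UDer Y ξ| + |h Y ξ|)) := by positivity
        linarith
      have d2 : |source X ξ - source Y ξ| ≤ sourceConst M * T := by
        have : 0 ≤ δ * |source Y ξ| := by positivity
        linarith
      -- The factor `1` in `y_ξ = 1 + ζ_ξ` is not square integrable, so `P X - P Y` standing alone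
      -- is bounded by the convolution, which is in `L²`. Multiplied by `ζ_ξ` it is bounded in sup
      -- norm.
      rw [show 1 / 2 * source X ξ - P X ξ * (1 + V.der X.1 ξ) -
        (1 / 2 * source Y ξ - P Y ξ * (1 + V.der Y.1 ξ)) =
        1 / 2 * (source X ξ - source Y ξ) + -(P X ξ - P Y ξ) + -((P X ξ - P Y ξ) * V.der X.1 ξ)
          + -(P Y ξ * (V.der X.1 ξ - V.der Y.1 ξ)) by ring]
      refine (abs_add_le _ _).trans ((add_le_add ((abs_add_le _ _).trans (add_le_add
        (abs_add_le _ _) le_rfl)) le_rfl).trans ?_)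
      rw [abs_neg, abs_neg, abs_neg, abs_mul, abs_mul, abs_mul,
        abs_of_pos (by norm_num : (0 : ℝ) < 1 / 2)]
      have f1 : |P X ξ - P Y ξ| * |V.der X.1 ξ| ≤ A * N * T := by
        calc _ ≤ A * N * δ * |V.der X.1 ξ| := by gcongr
          _ = A * N * (δ * |V.der X.1 ξ|) := by ring
          _ ≤ _ := by
            gcongr
            linarith [abs_nonneg (V.der X.1 ξ - V.der Y.1 ξ)]
      have f2 : |P Y ξ| * |V.der X.1 ξ - V.der Y.1 ξ| ≤ PBound M * T := by
        have : 0 ≤ δ * |V.der X.1 ξ| := by positivity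
        gcongr
        linarith
      have f3 : 0 ≤ (1 / 2 * sourceConst M + A + 2 * (M ^ 2 + PBound M) +
        2 * (2 * M + A * N) + 1) * T + (C - A) * K := by
        have : 0 ≤ C - A := by
          rw [hC, ← sub_nonneg]
          have : 0 ≤ A * N + PBound M + sourceConst M + 2 * (M ^ 2 + PBound M) +
            2 * (2 * M + A * N) + 1 := by positivity
          linarith
        positivity
      have f4 : C * T = (A + A * N + PBound M + sourceConst M + 2 * (M ^ 2 + PBound M) +
        2 * (2 * M + A * N) + 1) * T := rfl
      have f5 : 0 ≤ sourceConst M * T := by positivity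
      linarith
  · refine hT _ ?_
    have hUL : (X'.2.1 - Y'.2.1).1.2 =ᵐ[volume] U (X' - Y') := (X'.2.1 - Y'.2.1).2
    filter_upwards [hUL, hdiff0] with ξ e1 e2
    change |((X'.2.1 - Y'.2.1).1.2 : ℝ → ℝ) ξ| ≤ _
    rw [e1]
    change |U X' ξ - U Y' ξ| ≤ _
    rw [hX'.U, hY'.U, neg_sub_neg, abs_sub_comm]
    refine (hQ ξ).trans ?_
    have h1 : A ≤ C := by
      rw [hC, ← sub_nonneg]
      have : 0 ≤ A * N + PBound M + sourceConst M + 2 * (M ^ 2 + PBound M) +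
        2 * (2 * M + A * N) + 1 := by positivity
      linarith
    have h3 := hK0 ξ
    calc A * expConv (diff X Y) ξ ≤ C * expConv (diff X Y) ξ := by gcongr
      _ ≤ _ := by gcongr; linarith
  · refine hT _ ?_
    filter_upwards [Lp.coeFn_sub X'.2.2 Y'.2.2, hX'.h, hY'.h, hdiff0, diff_ae X Y]
      with ξ e1 e2 e3 e4 e5
    change |((X'.2.2 - Y'.2.2 : L2) : ℝ → ℝ) ξ| ≤ _
    rw [e1]
    change |h X' ξ - h Y' ξ| ≤ _
    rw [e2, e3]
    have p2 := hPN ξ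
    have p3 := abs_P_le hX ξ
    have p4 := hK0 ξ
    have u1 := (abs_U_le X ξ).trans hX
    have u2 := (abs_U_le Y ξ).trans hY
    have u3 : |U X ξ - U Y ξ| ≤ δ := abs_U_le (X - Y) ξ
    set T := (diff X Y : ℝ → ℝ) ξ
    set K := expConv (diff X Y) ξ
    have d1 : |UDer X ξ - UDer Y ξ| + δ * |UDer Y ξ| ≤ T := by
      rw [e5, ← sub_nonneg]
      have : 0 ≤ |U X ξ - U Y ξ| + |V.der X.1 ξ - V.der Y.1 ξ| + |h X ξ - h Y ξ| +
        δ * ((|U X ξ| + |V.der X.1 ξ| + |UDer X ξ| + |h X ξ|) +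
        (|U Y ξ| + |V.der Y.1 ξ| + |h Y ξ|)) := by positivity
      linarith
    rw [show 2 * (U X ξ ^ 2 - P X ξ) * UDer X ξ - 2 * (U Y ξ ^ 2 - P Y ξ) * UDer Y ξ =
      2 * (U X ξ ^ 2 - P X ξ) * (UDer X ξ - UDer Y ξ) +
      2 * ((U X ξ + U Y ξ) * (U X ξ - U Y ξ) - (P X ξ - P Y ξ)) * UDer Y ξ by ring]
    refine (abs_add_le _ _).trans ?_
    have f1 : |2 * (U X ξ ^ 2 - P X ξ) * (UDer X ξ - UDer Y ξ)| ≤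
        2 * (M ^ 2 + PBound M) * T := by
      rw [abs_mul, abs_mul, abs_two]
      have h1 : |U X ξ ^ 2 - P X ξ| ≤ M ^ 2 + PBound M := by
        refine (abs_sub _ _).trans (add_le_add ?_ p3)
        rw [abs_pow]; gcongr
      have : 0 ≤ δ * |UDer Y ξ| := by positivity
      gcongr
      linarith
    have f2 : |2 * ((U X ξ + U Y ξ) * (U X ξ - U Y ξ) - (P X ξ - P Y ξ)) * UDer Y ξ| ≤
        2 * (2 * M + A * N) * T := by
      rw [abs_mul, abs_mul, abs_two]
      have h1 : |(U X ξ + U Y ξ) * (U X ξ - U Y ξ) - (P X ξ - P Y ξ)| ≤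
          (2 * M + A * N) * δ := by
        refine (abs_sub _ _).trans ?_
        rw [abs_mul, add_mul]
        refine add_le_add ?_ p2
        gcongr
        linarith [abs_add_le (U X ξ) (U Y ξ)]
      calc _ ≤ 2 * ((2 * M + A * N) * δ) * |UDer Y ξ| := by gcongr
        _ = 2 * (2 * M + A * N) * (δ * |UDer Y ξ|) := by ring
        _ ≤ _ := by
          gcongr
          linarith [abs_nonneg (UDer X ξ - UDer Y ξ)]
    have f3 : 0 ≤ (A + A * N + PBound M + sourceConst M + 1) * T + C * K := by positivity
    have f4 : C * T = (A + A * N + PBound M + sourceConst M + 2 * (M ^ 2 + PBound M) +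
        2 * (2 * M + A * N) + 1) * T := rfl
    linarith

/-! ### Uniqueness by Grönwall's inequality -/

theorem IsSolution.continuousOn {X : ℝ → State} (hX : IsSolution X) : ContinuousOn X (Ici 0) :=
  fun t ht => (hX t ht).choose_spec.1.continuousWithinAt

theorem IsSolution.exists_bound {X : ℝ → State} (hX : IsSolution X) (T : ℝ) :
    ∃ M, 0 ≤ M ∧ ∀ t ∈ Icc 0 T, ‖X t‖ ≤ M := by
  obtain ⟨M, hM⟩ := (isCompact_Icc (a := (0 : ℝ)) (b := T)).exists_bound_of_continuousOn
    (hX.continuousOn.mono fun t ht => ht.1)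
  exact ⟨max M 0, le_max_right _ _, fun t ht => (hM t ht).trans (le_max_left _ _)⟩

/-- Uniqueness for the system. -/
theorem IsSolution.unique {X Y : ℝ → State} (hX : IsSolution X) (hY : IsSolution Y)
    (h0 : X 0 = Y 0) : ∀ t, 0 ≤ t → X t = Y t := by
  intro T hT
  obtain ⟨M₁, hM₁, h₁⟩ := hX.exists_bound T
  obtain ⟨M₂, hM₂, h₂⟩ := hY.exists_bound T
  obtain ⟨C, hC⟩ := exists_lipschitz (max M₁ M₂)
  choose! X' hXd hXr using hX
  choose! Y' hYd hYr using hY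
  -- With zero initial error `δ` and zero forcing `ε` the Grönwall bound is `0`.
  have key := norm_le_gronwallBound_of_norm_deriv_right_le (f := fun t => X t - Y t)
    (f' := fun t => X' t - Y' t) (δ := 0) (K := C) (ε := 0) (a := 0) (b := T)
    (fun t ht => ((hXd t ht.1).sub (hYd t ht.1)).continuousWithinAt.mono Icc_subset_Ici_self)
    (fun t ht => ((hXd t ht.1).sub (hYd t ht.1)).mono (Ici_subset_Ici.2 ht.1))
    (by simp [h0])
    (fun t ht => by
      rw [add_zero]
      exact hC _ _ _ _ ((h₁ t ⟨ht.1, ht.2.le⟩).trans (le_max_left _ _))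
        ((h₂ t ⟨ht.1, ht.2.le⟩).trans (le_max_right _ _)) (hXr t ht.1) (hYr t ht.1))
    T ⟨hT, le_rfl⟩
  rw [gronwallBound_ε0, zero_mul] at key
  exact sub_eq_zero.1 (norm_le_zero_iff.1 key)

end State

/-! ## Bounded operators on the function spaces -/

/-- The derivative as a bounded operator. -/
def V.derL : V →L[ℝ] L2 :=
  (ContinuousLinearMap.snd ℝ (ℝ →ᵇ ℝ) L2).comp (Submodule.subtypeL VSub)

/-- The inclusion of `H¹` in `V`. -/
def H1.toV : H1 →L[ℝ] V :=
  (ContinuousLinearMap.fst ℝ V L2).comp (Submodule.subtypeL H1Sub)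

/-- The inclusion of `H¹` in `L²`. -/
def H1.toL2 : H1 →L[ℝ] L2 :=
  (ContinuousLinearMap.snd ℝ V L2).comp (Submodule.subtypeL H1Sub)

theorem H1.toL2_ae (f : H1) : (H1.toL2 f : ℝ → ℝ) =ᵐ[volume] H1.val f := f.2

theorem V.memLp_top_val (f : V) : MemLp (V.val f) ∞ :=
  memLp_top_of_bound f.isPrimitive.continuous.aestronglyMeasurable ‖f‖
    (Eventually.of_forall f.abs_val_le)

/-- The inclusion of `V` in `L^∞`. -/
def V.toLinf : V →L[ℝ] Lp ℝ ∞ (volume : Measure ℝ) :=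
  LinearMap.mkContinuous
    { toFun := fun f => f.memLp_top_val.toLp _
      map_add' := fun _ _ => rfl
      map_smul' := fun _ _ => rfl } 1 fun f => by
    rw [one_mul]
    change ‖f.memLp_top_val.toLp _‖ ≤ ‖f‖
    rw [Lp.norm_toLp]
    refine ENNReal.toReal_le_of_le_ofReal (norm_nonneg _) ?_
    refine (eLpNorm_le_of_ae_bound (Eventually.of_forall f.abs_val_le)).trans ?_
    simp

theorem V.toLinf_ae (f : V) : (V.toLinf f : ℝ → ℝ) =ᵐ[volume] V.val f :=
  f.memLp_top_val.coeFn_toLp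

/-- The multiplication `L^∞ × L² → L²`. -/
def mulL : Lp ℝ ∞ (volume : Measure ℝ) →L[ℝ] L2 →L[ℝ] L2 :=
  (ContinuousLinearMap.mul ℝ ℝ).holderL volume ∞ 2 2

theorem mulL_ae (f : Lp ℝ ∞ (volume : Measure ℝ)) (g : L2) :
    (mulL f g : ℝ → ℝ) =ᵐ[volume] fun ξ => f ξ * g ξ :=
  (ContinuousLinearMap.mul ℝ ℝ).coeFn_holder f g

/-- The indicator of `s` in `L^∞`. -/
def indicatorLinf {s : Set ℝ} (hs : MeasurableSet s) (hμ : volume s ≠ ∞) :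
    Lp ℝ ∞ (volume : Measure ℝ) := indicatorConstLp ∞ hs hμ 1

/-- Solutions are differentiable in time only as curves in `L²`, not at a fixed `ξ`. Writing `∫_s f
g` as a continuous bilinear form on `L²` makes it differentiable along them. -/
theorem inner_indicator_mul {s : Set ℝ} (hs : MeasurableSet s) (hμ : volume s ≠ ∞) (f g : L2) :
    inner ℝ (mulL (indicatorLinf hs hμ) f) g = ∫ ξ in s, f ξ * g ξ := by
  rw [L2.inner_def, ← integral_indicator hs]
  refine integral_congr_ae ?_
  have h1 : (indicatorLinf hs hμ : ℝ → ℝ) =ᵐ[volume] s.indicator fun _ => 1 :=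
    indicatorConstLp_coeFn
  filter_upwards [mulL_ae (indicatorLinf hs hμ) f, h1] with ξ h2 h3
  rw [h2, h3]
  by_cases h : ξ ∈ s <;> simp [h, mul_comm]

theorem inner_indicator_one {s : Set ℝ} (hs : MeasurableSet s) (hμ : volume s ≠ ∞) (g : L2) :
    inner ℝ (indicatorConstLp 2 hs hμ (1 : ℝ)) g = ∫ ξ in s, g ξ :=
  L2.inner_indicatorConstLp_one hs hμ g

namespace State

/-! ## The invariant `y_ξ h = U_ξ²`, and the signs of `y_ξ` and `h` -/

/-- The derivative `ζ_ξ` as an element of `L²`. -/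
def zetaL : State →L[ℝ] L2 := V.derL.comp (ContinuousLinearMap.fst ℝ V (H1 × L2))

/-- The derivative `U_ξ` as an element of `L²`. -/
def derL : State →L[ℝ] L2 :=
  V.derL.comp (H1.toV.comp ((ContinuousLinearMap.fst ℝ H1 L2).comp
    (ContinuousLinearMap.snd ℝ V (H1 × L2))))

/-- The unknown `h` as an element of `L²`. -/
def hL : State →L[ℝ] L2 :=
  (ContinuousLinearMap.snd ℝ H1 L2).comp (ContinuousLinearMap.snd ℝ V (H1 × L2))

theorem coe_zetaL (X : State) : (zetaL X : ℝ → ℝ) = V.der X.1 := rfl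
theorem coe_derL (X : State) : (derL X : ℝ → ℝ) = UDer X := rfl
theorem coe_hL (X : State) : (hL X : ℝ → ℝ) = h X := rfl

/-- `∫_s (y_ξ h - U_ξ²)`. -/
def defect {s : Set ℝ} (hs : MeasurableSet s) (hμ : volume s ≠ ∞) (X : State) : ℝ :=
  inner ℝ (indicatorConstLp 2 hs hμ (1 : ℝ)) (hL X) +
    inner ℝ (mulL (indicatorLinf hs hμ) (zetaL X)) (hL X) -
    inner ℝ (mulL (indicatorLinf hs hμ) (derL X)) (derL X)

theorem integrable_mul_L2 (f g : L2) : Integrable fun ξ => (f : ℝ → ℝ) ξ * (g : ℝ → ℝ) ξ :=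
  (L2.memLp f).integrable_mul (L2.memLp g)

theorem integrableOn_L2 (f : L2) {s : Set ℝ} (hμ : volume s ≠ ∞) :
    IntegrableOn (f : ℝ → ℝ) s := by
  have : IsFiniteMeasure (volume.restrict s) := ⟨by simpa using lt_top_iff_ne_top.2 hμ⟩
  exact ((L2.memLp f).restrict s).integrable one_le_two

theorem integrableOn_defect (X : State) {s : Set ℝ} (hμ : volume s ≠ ∞) :
    IntegrableOn (fun ξ => charDer X.1 ξ * h X ξ - UDer X ξ ^ 2) s := by
  have i1 := integrableOn_L2 (hL X) hμ
  have i2 := (integrable_mul_L2 (zetaL X) (hL X)).integrableOn (s := s)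
  have i3 := (integrable_mul_L2 (derL X) (derL X)).integrableOn (s := s)
  refine ((i1.add i2).sub i3).congr (Eventually.of_forall fun ξ => ?_)
  simp only [Pi.add_apply, Pi.sub_apply, coe_zetaL, coe_derL, coe_hL, charDer]
  ring

theorem defect_eq {s : Set ℝ} (hs : MeasurableSet s) (hμ : volume s ≠ ∞) (X : State) :
    defect hs hμ X = ∫ ξ in s, charDer X.1 ξ * h X ξ - UDer X ξ ^ 2 := by
  have i1 := integrableOn_L2 (hL X) hμ
  have i2 := (integrable_mul_L2 (zetaL X) (hL X)).integrableOn (s := s)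
  have i3 := (integrable_mul_L2 (derL X) (derL X)).integrableOn (s := s)
  have i12 : IntegrableOn (fun ξ => (hL X : ℝ → ℝ) ξ + (zetaL X : ℝ → ℝ) ξ * (hL X : ℝ → ℝ) ξ) s :=
    i1.add i2
  rw [defect, inner_indicator_one, inner_indicator_mul, inner_indicator_mul,
    ← integral_add i1 i2, ← integral_sub i12 i3]
  congr 1
  ext ξ
  simp only [coe_zetaL, coe_derL, coe_hL, charDer]
  ring

theorem IsRHS.hasDerivWithinAt_defect {X : ℝ → State} {X' : State} {t : ℝ}
    (hd : HasDerivWithinAt X X' (Ici 0) t) (hr : IsRHS (X t) X')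
    {s : Set ℝ} (hs : MeasurableSet s) (hμ : volume s ≠ ∞) :
    HasDerivWithinAt (fun t => defect hs hμ (X t)) 0 (Ici 0) t := by
  have d1 := (zetaL.hasFDerivAt (x := X t)).comp_hasDerivWithinAt t hd
  have d2 := (derL.hasFDerivAt (x := X t)).comp_hasDerivWithinAt t hd
  have d3 := (hL.hasFDerivAt (x := X t)).comp_hasDerivWithinAt t hd
  have m1 := ((mulL (indicatorLinf hs hμ)).hasFDerivAt
    (x := zetaL (X t))).comp_hasDerivWithinAt t d1
  have m2 := ((mulL (indicatorLinf hs hμ)).hasFDerivAt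
    (x := derL (X t))).comp_hasDerivWithinAt t d2
  have c1 : HasDerivWithinAt (fun _ : ℝ => (indicatorConstLp 2 hs hμ (1 : ℝ) : L2)) 0 (Ici 0) t :=
    hasDerivWithinAt_const _ _ _
  have key := ((c1.inner ℝ d3).add (m1.inner ℝ d3)).sub (m2.inner ℝ d2)
  refine key.congr_deriv ?_
  simp only [Function.comp_apply, inner_zero_left, add_zero]
  rw [inner_indicator_one, inner_indicator_mul, inner_indicator_mul, inner_indicator_mul,
    inner_indicator_mul]
  have j (f g : L2) := (integrable_mul_L2 f g).integrableOn (s := s)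
  have i1 := integrableOn_L2 (hL X') hμ
  have j' (f g f' g' : L2) : IntegrableOn (fun ξ => (f : ℝ → ℝ) ξ * (g : ℝ → ℝ) ξ +
    (f' : ℝ → ℝ) ξ * (g' : ℝ → ℝ) ξ) s := (j f g).add (j f' g')
  have j'' (f g f' g' : L2) : IntegrableOn (fun ξ => (hL X' : ℝ → ℝ) ξ + ((f : ℝ → ℝ) ξ *
    (g : ℝ → ℝ) ξ + (f' : ℝ → ℝ) ξ * (g' : ℝ → ℝ) ξ)) s := i1.add (j' f g f' g')
  rw [← integral_add (j _ _) (j _ _), ← integral_add i1 (j' _ _ _ _),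
    ← integral_add (j _ _) (j _ _), ← integral_sub (j'' _ _ _ _) (j' _ _ _ _)]
  rw [← integral_zero ℝ ℝ (μ := volume.restrict s)]
  refine integral_congr_ae (ae_restrict_of_ae ?_)
  -- Pointwise, `y_ξ h - U_ξ²` has formal time derivative `U_ξ h + 2 y_ξ (U² - P) U_ξ - 2 U_ξ (U²
  -- y_ξ + h / 2 - P y_ξ) = 0`.
  filter_upwards [hr.der_y, hr.der_U, hr.h] with ξ e1 e2 e3
  simp only [coe_zetaL, coe_derL, coe_hL, e1, e2, e3, charDer, source]
  ring

theorem defect_const {X : ℝ → State} (hX : IsSolution X) {s : Set ℝ} (hs : MeasurableSet s)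
    (hμ : volume s ≠ ∞) {T : ℝ} (hT : 0 ≤ T) : defect hs hμ (X T) = defect hs hμ (X 0) := by
  choose! X' hd hr using hX
  have hder (t : ℝ) (ht : 0 ≤ t) := IsRHS.hasDerivWithinAt_defect (hd t ht) (hr t ht) hs hμ
  exact constant_of_has_deriv_right_zero (f := fun t => defect hs hμ (X t)) (a := 0) (b := T)
    (fun t ht => ((hder t ht.1).continuousWithinAt).mono fun _ h => h.1)
    (fun t ht => (hder t ht.1).mono (Ici_subset_Ici.2 ht.1)) T ⟨hT, le_rfl⟩

/-- The identity `y_ξ h = U_ξ²` is preserved. -/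
theorem IsSolution.mul_eq {X : ℝ → State} (hX : IsSolution X)
    (h0 : ∀ᵐ ξ, charDer (X 0).1 ξ * h (X 0) ξ = UDer (X 0) ξ ^ 2) {t : ℝ} (ht : 0 ≤ t) :
    ∀ᵐ ξ, charDer (X t).1 ξ * h (X t) ξ = UDer (X t) ξ ^ 2 := by
  -- Conservation of the integrals over all sets of finite measure gives the identity almost
  -- everywhere.
  have key := ae_eq_zero_of_forall_setIntegral_eq_of_sigmaFinite
    (f := fun ξ => charDer (X t).1 ξ * h (X t) ξ - UDer (X t) ξ ^ 2) (μ := volume)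
    (fun s _ hμ => integrableOn_defect (X t) hμ.ne) fun s hs hμ => by
      rw [← defect_eq hs hμ.ne, defect_const hX hs hμ.ne ht, defect_eq]
      refine integral_eq_zero_of_ae (ae_restrict_of_ae ?_)
      filter_upwards [h0] with ξ hξ
      rw [hξ, sub_self]; rfl
  filter_upwards [key] with ξ hξ
  exact sub_eq_zero.1 hξ

/-! ### Preservation of the signs by an energy estimate -/

/-- The negative part of `1 + r`. -/
def negPart (r : ℝ) : ℝ := max (-(1 + r)) 0

theorem negPart_nonneg (r : ℝ) : 0 ≤ negPart r := le_max_right _ _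

theorem negPart_le (r : ℝ) : negPart r ≤ |r| :=
  max_le (by linarith [neg_abs_le r]) (abs_nonneg r)

theorem continuous_negPart : Continuous negPart := by unfold negPart; fun_prop

/-- The square of the negative part is `C¹` with Lipschitz derivative `-2 negPart`. The remainder is
quadratic, which makes `negEnergy` differentiable on `L²`. -/
theorem abs_negPart_sq_sub_le (r k : ℝ) :
    |negPart (r + k) ^ 2 - negPart r ^ 2 - -2 * (negPart r * k)| ≤ k ^ 2 := by
  unfold negPart
  rcases le_total (-(1 + r)) 0 with h1 | h1 <;>
    rcases le_total (-(1 + (r + k))) 0 with h2 | h2 <;>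
    simp only [max_eq_left, max_eq_right, h1, h2] <;> rw [abs_le] <;> constructor <;> nlinarith

theorem memLp_negPart (f : L2) : MemLp (fun ξ => negPart (f ξ)) 2 :=
  (L2.memLp f).mono (continuous_negPart.comp_aestronglyMeasurable (L2.memLp f).1)
    (Eventually.of_forall fun ξ => by
      rw [Real.norm_of_nonneg (negPart_nonneg _)]; exact negPart_le _)

/-- The integral of the square of the negative part of `1 + f`. -/
def negEnergy (f : L2) : ℝ := ∫ ξ, negPart (f ξ) ^ 2

theorem hasFDerivAt_negEnergy (f : L2) :
    HasFDerivAt negEnergy ((-2 : ℝ) • innerSL ℝ ((memLp_negPart f).toLp _)) f := by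
  rw [hasFDerivAt_iff_isLittleO_nhds_zero]
  have hb (k : L2) : ‖negEnergy (f + k) - negEnergy f -
      ((-2 : ℝ) • innerSL ℝ ((memLp_negPart f).toLp _)) k‖ ≤ ‖k‖ ^ 2 := by
    have e1 : ((-2 : ℝ) • innerSL ℝ ((memLp_negPart f).toLp _)) k =
        ∫ ξ, -2 * (negPart (f ξ) * k ξ) := by
      rw [smul_apply, innerSL_apply_apply, L2.inner_def, integral_const_mul,
        smul_eq_mul]
      congr 1
      refine integral_congr_ae ?_
      filter_upwards [(memLp_negPart f).coeFn_toLp] with ξ hξ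
      rw [hξ]; simp [mul_comm]
    have i1 := (memLp_negPart (f + k)).integrable_sq
    have i2 := (memLp_negPart f).integrable_sq
    have i3 : Integrable fun ξ => -2 * (negPart (f ξ) * k ξ) :=
      ((memLp_negPart f).integrable_mul (L2.memLp k)).const_mul (-2)
    have i12 : Integrable fun ξ => negPart ((f + k : L2) ξ) ^ 2 - negPart (f ξ) ^ 2 := i1.sub i2
    rw [e1, negEnergy, negEnergy, ← integral_sub i1 i2, ← integral_sub i12 i3, L2.norm_sq_eq]
    refine norm_integral_le_of_norm_le (L2.memLp k).integrable_sq ?_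
    filter_upwards [Lp.coeFn_add f k] with ξ hξ
    rw [hξ, Pi.add_apply]
    exact abs_negPart_sq_sub_le _ _
  refine Asymptotics.IsBigO.trans_isLittleO (g := fun k : L2 => ‖k‖ ^ 2) ?_ ?_
  · refine Asymptotics.IsBigO.of_bound 1 (Eventually.of_forall fun k => ?_)
    rw [one_mul, Real.norm_of_nonneg (sq_nonneg _)]
    exact hb k
  · exact Asymptotics.isLittleO_norm_pow_id one_lt_two

/-- The signs of `y_ξ` and `h` are preserved. -/
theorem IsSolution.nonneg {X : ℝ → State} (hX : IsSolution X)
    (h0 : ∀ᵐ ξ, charDer (X 0).1 ξ * h (X 0) ξ = UDer (X 0) ξ ^ 2)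
    (hs0 : ∀ᵐ ξ, 0 ≤ charDer (X 0).1 ξ + h (X 0) ξ) {t : ℝ} (ht : 0 ≤ t) :
    ∀ᵐ ξ, 0 ≤ charDer (X t).1 ξ ∧ 0 ≤ h (X t) ξ := by
  obtain ⟨M, hM0, hM⟩ := hX.exists_bound t
  have hmul (s : ℝ) (hs : 0 ≤ s) := hX.mul_eq h0 hs
  choose! X' hd hr using hX
  -- It suffices to control the sign of the sum `y_ξ + h = 1 + σ`, as the product `y_ξ h = U_ξ²` is
  -- nonnegative.
  set σ : State →L[ℝ] L2 := zetaL + hL with hσ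
  have hσae (Y : State) : ∀ᵐ ξ, 1 + (σ Y : ℝ → ℝ) ξ = charDer Y.1 ξ + h Y ξ := by
    filter_upwards [Lp.coeFn_add (zetaL Y) (hL Y)] with ξ hξ
    rw [hσ, add_apply, hξ, Pi.add_apply, coe_zetaL, coe_hL, charDer]
    ring
  have hder (s : ℝ) (hs : 0 ≤ s) : HasDerivWithinAt (fun s => negEnergy (σ (X s)))
      (((-2 : ℝ) • innerSL ℝ ((memLp_negPart (σ (X s))).toLp _)) (σ (X' s))) (Ici 0) s := by
    have d : HasDerivWithinAt (fun s => σ (X s)) (σ (X' s)) (Ici 0) s :=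
      (σ.hasFDerivAt (x := X s)).comp_hasDerivWithinAt s (hd s hs)
    exact (hasFDerivAt_negEnergy (σ (X s))).comp_hasDerivWithinAt s d
  set K : ℝ := 1 + 2 * (M ^ 2 + PBound M) with hK
  have hbound (s : ℝ) (hs : s ∈ Icc 0 t) :
      ‖((-2 : ℝ) • innerSL ℝ ((memLp_negPart (σ (X s))).toLp _)) (σ (X' s))‖ ≤
        K * ‖negEnergy (σ (X s))‖ := by
    have hN : ‖negEnergy (σ (X s))‖ = ∫ ξ, negPart ((σ (X s) : ℝ → ℝ) ξ) ^ 2 :=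
      Real.norm_of_nonneg (integral_nonneg fun ξ => sq_nonneg _)
    rw [smul_apply, innerSL_apply_apply, L2.inner_def, norm_smul, hN, ← integral_const_mul]
    have h1 : ‖∫ ξ, inner ℝ (((memLp_negPart (σ (X s))).toLp _ : L2) ξ) ((σ (X' s) : ℝ → ℝ) ξ)‖ ≤
        ∫ ξ, 1 / 2 * (K * negPart ((σ (X s) : ℝ → ℝ) ξ) ^ 2) := by
      refine norm_integral_le_of_norm_le
        (((memLp_negPart (σ (X s))).integrable_sq.const_mul K).const_mul (1 / 2)) ?_
      filter_upwards [(memLp_negPart (σ (X s))).coeFn_toLp, hσae (X s), hσae (X' s),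
        (hr s hs.1).der_y, (hr s hs.1).h, hmul s hs.1] with ξ e1 e2 e3 e4 e5 e6
      have e7 : (σ (X' s) : ℝ → ℝ) ξ =
          UDer (X s) ξ * (1 + 2 * (U (X s) ξ ^ 2 - P (X s) ξ)) := by
        rw [charDer, e4, e5] at e3; linarith
      rw [e1, e7]
      set r := (σ (X s) : ℝ → ℝ) ξ
      set b := UDer (X s) ξ
      set m := U (X s) ξ ^ 2 - P (X s) ξ with hm
      have hmK : |1 + 2 * m| ≤ K := by
        have p1 := abs_P_le (hM s hs) ξ
        have p2 : |U (X s) ξ ^ 2| ≤ M ^ 2 := by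
          rw [abs_pow]
          have := (abs_U_le (X s) ξ).trans (hM s hs)
          gcongr
        have p3 := abs_sub (U (X s) ξ ^ 2) (P (X s) ξ)
        have p4 := abs_add_le 1 (2 * m)
        rw [abs_mul, abs_two, abs_one] at p4
        rw [hK]; linarith
      -- The time derivative of `y_ξ + h` is a bounded multiple of `U_ξ`, and `U_ξ² = y_ξ h ≤ (y_ξ +
      -- h)² / 4`. Where the sum is negative, `|U_ξ|` is at most half its negative part, which
      -- closes the Grönwall estimate.
      have hn : negPart r * |b| ≤ 1 / 2 * negPart r ^ 2 := by
        rcases le_total (-(1 + r)) 0 with hneg | hneg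
        · have h2 : negPart r = 0 := max_eq_right hneg
          simp [h2]
        · have h2 : negPart r = -(1 + r) := max_eq_left hneg
          have h3 : |b| ≤ 1 / 2 * negPart r := by
            refine abs_le_of_sq_le_sq ?_ (by rw [h2]; linarith)
            rw [h2, ← e6, e2]
            nlinarith [sq_nonneg (charDer (X s).1 ξ - h (X s) ξ)]
          calc _ ≤ negPart r * (1 / 2 * negPart r) :=
                mul_le_mul_of_nonneg_left h3 (negPart_nonneg r)
            _ = _ := by ring
      have h4 : ‖inner ℝ (negPart r) (b * (1 + 2 * m))‖ = negPart r * |b| * |1 + 2 * m| := by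
        simp only [RCLike.inner_apply, conj_trivial, norm_mul, Real.norm_eq_abs,
          abs_of_nonneg (negPart_nonneg r)]
        ring
      rw [h4]
      calc _ ≤ (1 / 2 * negPart r ^ 2) * K :=
            mul_le_mul hn hmK (abs_nonneg _) (by positivity)
        _ = _ := by ring
    rw [integral_const_mul] at h1
    rw [norm_neg, Real.norm_of_nonneg two_pos.le]
    linarith
  have h00 : negEnergy (σ (X 0)) = 0 := by
    refine integral_eq_zero_of_ae ?_
    filter_upwards [hσae (X 0), hs0] with ξ e1 e2
    have : negPart ((σ (X 0) : ℝ → ℝ) ξ) = 0 := max_eq_right (by linarith)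
    rw [this]; simp
  have key := eq_zero_of_abs_deriv_le_mul_abs_self_of_eq_zero_right
    (f := fun s => negEnergy (σ (X s))) (a := 0) (b := t) (K := K)
    (fun s hs => (hder s hs.1).continuousWithinAt.mono fun _ h => h.1)
    (fun s hs => (hder s hs.1).mono (Ici_subset_Ici.2 hs.1)) h00
    (fun s hs => hbound s ⟨hs.1, hs.2.le⟩) t ⟨ht, le_rfl⟩
  have key2 := (integral_eq_zero_iff_of_nonneg (fun ξ => sq_nonneg _)
    (memLp_negPart (σ (X t))).integrable_sq).1 key
  filter_upwards [key2, hσae (X t), hmul t ht] with ξ e1 e2 e3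
  have e4 : negPart ((σ (X t) : ℝ → ℝ) ξ) = 0 := by simpa using e1
  have e5 : 0 ≤ charDer (X t).1 ξ + h (X t) ξ := by
    have := le_max_left (-(1 + (σ (X t) : ℝ → ℝ) ξ)) 0
    rw [negPart] at e4
    rw [e4] at this
    linarith
  have e6 : 0 ≤ charDer (X t).1 ξ * h (X t) ξ := e3 ▸ sq_nonneg _
  constructor <;> nlinarith

end State

/-! ## The limit at `+∞` vanishes identically if it does so initially -/

namespace IsPartitionFunction

variable {χ : ℝ → ℝ}

theorem monotone (hχ : IsPartitionFunction χ) : Monotone χ :=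
  monotone_of_deriv_nonneg (hχ.smooth.differentiable (by simp)) hχ.deriv_nonneg

theorem nonneg (hχ : IsPartitionFunction χ) (x : ℝ) : 0 ≤ χ x :=
  (hχ.eq_zero _ (min_le_right x 0)).symm.le.trans (hχ.monotone (min_le_left x 0))

theorem le_one (hχ : IsPartitionFunction χ) (x : ℝ) : χ x ≤ 1 :=
  (hχ.monotone (le_max_left x 1)).trans (hχ.eq_one _ (le_max_right x 1)).le

theorem deriv_eq_zero (hχ : IsPartitionFunction χ) {x : ℝ} (hx : 1 < x) : deriv χ x = 0 := by
  have : χ =ᶠ[𝓝 x] fun _ => 1 := by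
    filter_upwards [lt_mem_nhds hx] with z hz using hχ.eq_one z hz.le
  rw [this.deriv_eq, deriv_const]

theorem deriv_deriv_eq_zero (hχ : IsPartitionFunction χ) {x : ℝ} (hx : 1 < x) :
    deriv (deriv χ) x = 0 := by
  have : deriv χ =ᶠ[𝓝 x] fun _ => 0 := by
    filter_upwards [lt_mem_nhds hx] with z hz using hχ.deriv_eq_zero hz
  rw [this.deriv_eq, deriv_const]

/-- To the right of `1` the derivatives of `χ` vanish, so `|x - z| = x - z` wherever the integrand
is nonzero and `x` factors out. Hence `g' → 0` at `+∞`. -/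
theorem gFun_eq (hχ : IsPartitionFunction χ) {x : ℝ} (hx : 1 < x) :
    gFun χ x = 1 + 1 / 2 * (∫ z, Real.exp z * (2 * deriv χ z ^ 2 + 2 * χ z * deriv (deriv χ) z)) *
      Real.exp (-x) := by
  rw [gFun, hχ.eq_one x hx.le, mul_assoc (1 / 2), mul_comm _ (Real.exp (-x)),
    ← integral_const_mul (Real.exp (-x)), one_pow]
  refine congrArg (fun I : ℝ => 1 + 1 / 2 * I) ?_
  refine integral_congr_ae (Eventually.of_forall fun z => ?_)
  simp only
  rcases le_or_gt z 1 with hz | hz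
  · rw [abs_of_nonneg (by linarith), ← mul_assoc, ← Real.exp_add]
    ring_nf
  · rw [hχ.deriv_eq_zero hz, hχ.deriv_deriv_eq_zero hz]; ring

theorem tendsto_deriv_gFun (hχ : IsPartitionFunction χ) :
    Tendsto (deriv (gFun χ)) atTop (𝓝 0) := by
  set C := 1 / 2 * (∫ z, Real.exp z * (2 * deriv χ z ^ 2 + 2 * χ z * deriv (deriv χ) z)) with hC
  have h1 : (fun x => -C * Real.exp (-x)) =ᶠ[atTop] deriv (gFun χ) := by
    filter_upwards [eventually_gt_atTop 1] with x hx
    have h2 : gFun χ =ᶠ[𝓝 x] fun x => 1 + C * Real.exp (-x) := by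
      filter_upwards [lt_mem_nhds hx] with z hz using hχ.gFun_eq hz
    have h3 : HasDerivAt (fun x => 1 + C * Real.exp (-x)) (C * (Real.exp (-x) * -1)) x :=
      (((hasDerivAt_neg x).exp).const_mul C).const_add 1
    rw [h2.deriv_eq, h3.deriv]; ring
  refine Tendsto.congr' h1 ?_
  simpa using Real.tendsto_exp_neg_atTop_nhds_zero.const_mul (-C)

theorem continuous (hχ : IsPartitionFunction χ) : Continuous χ := hχ.smooth.continuous

/-- Since `|y - id| ≤ ‖ζ‖`, both terms are `0`, or both are `1`, outside a bounded interval. This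
puts `Ū = w + c (χ - χ ∘ y)` in `L²`. -/
theorem memLp_sub_comp_char (hχ : IsPartitionFunction χ) (ζ : V) :
    MemLp (fun ξ => χ ξ - χ (char ζ ξ)) 2 := by
  have h1 : MemLp ((Icc (-‖ζ‖) (1 + ‖ζ‖)).indicator fun _ => (1 : ℝ)) 2 :=
    memLp_indicator_const 2 measurableSet_Icc 1 (Or.inr measure_Icc_lt_top.ne)
  refine h1.mono (hχ.continuous.sub
    (hχ.continuous.comp (continuous_char ζ))).aestronglyMeasurable
    (Eventually.of_forall fun ξ => ?_)
  have hb := abs_le.1 (V.abs_val_le ζ ξ)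
  have hζ := norm_nonneg ζ
  have e : char ζ ξ = ξ + V.val ζ ξ := rfl
  by_cases h : ξ ∈ Icc (-‖ζ‖) (1 + ‖ζ‖)
  · rw [indicator_of_mem h, norm_one, Real.norm_eq_abs, abs_le]
    have a1 := hχ.nonneg ξ
    have a2 := hχ.le_one ξ
    have a3 := hχ.nonneg (char ζ ξ)
    have a4 := hχ.le_one (char ζ ξ)
    constructor <;> linarith
  · rw [indicator_of_notMem h, norm_zero]
    rw [mem_Icc, not_and_or, not_le, not_le] at h
    rcases h with h | h
    · rw [hχ.eq_zero ξ (by linarith), hχ.eq_zero (char ζ ξ) (by rw [e]; linarith)]; simp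
    · rw [hχ.eq_one ξ (by linarith), hχ.eq_one (char ζ ξ) (by rw [e]; linarith)]; simp

theorem tendsto_atTop (hχ : IsPartitionFunction χ) : Tendsto χ atTop (𝓝 1) :=
  tendsto_const_nhds.congr' (by
    filter_upwards [eventually_ge_atTop 1] with x hx using (hχ.eq_one x hx).symm)

end IsPartitionFunction

theorem tendsto_char_atTop (ζ : V) : Tendsto (char ζ) atTop atTop :=
  tendsto_atTop_mono (fun ξ => by
    have := abs_le.1 (V.abs_val_le ζ ξ)
    show ξ + -‖ζ‖ ≤ ξ + V.val ζ ξ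
    linarith) (tendsto_atTop_add_const_right _ (-‖ζ‖) tendsto_id)

theorem tendsto_char_atBot (ζ : V) : Tendsto (char ζ) atBot atBot :=
  tendsto_atBot_mono (fun ξ => by
    have := abs_le.1 (V.abs_val_le ζ ξ)
    show ξ + V.val ζ ξ ≤ ξ + ‖ζ‖
    linarith) (tendsto_atBot_add_const_right _ ‖ζ‖ tendsto_id)

theorem tendsto_H0inf_val {χ : ℝ → ℝ} (hχ : IsPartitionFunction χ) (u : H0inf) :
    Tendsto (H0inf.val χ u) atTop (𝓝 u.2) := by
  have h := (H1.tendsto_val_atTop u.1).add (hχ.tendsto_atTop.const_mul u.2)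
  rw [zero_add, mul_one] at h
  exact h

theorem H0inf.isPrimitive {χ : ℝ → ℝ} (hχ : IsPartitionFunction χ) (u : H0inf) :
    IsPrimitive (H0inf.val χ u) (H0inf.der χ u) :=
  u.1.isPrimitive.add ((IsPrimitive.of_contDiff (hχ.smooth.of_le (by simp))).const_mul u.2)

namespace E

variable {χ : ℝ → ℝ}

/-- The density is `(2 Ū + 4 c χ ∘ y) Ū (1 + ζ_ξ) + h`, with a bounded first factor and `Ū` both
bounded and in `L²`. -/
theorem memLp_source (hχ : IsPartitionFunction χ) (X : E) : MemLp (source χ X) 2 := by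
  have hχy : Continuous fun ξ => χ (y X ξ) := hχ.continuous.comp (continuous_char X.1)
  have hU : Continuous (U χ X) := (H0inf.isPrimitive hχ X.2.1).continuous
  have hUbar : Continuous (Ubar χ X) := hU.sub (hχy.const_smul (c X))
  have hχ1 (x : ℝ) : |χ x| ≤ 1 := abs_le.2 ⟨by linarith [hχ.nonneg x], hχ.le_one x⟩
  have h1 : MemLp (Ubar χ X) 2 := by
    refine (X.2.1.1.memLp_val.add ((hχ.memLp_sub_comp_char X.1).const_mul (c X))).ae_eq
      (Eventually.of_forall fun ξ => ?_)
    simp only [Pi.add_apply, Ubar, U, H0inf.val, c, y]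
    ring
  have hb1 (ξ : ℝ) : |Ubar χ X ξ| ≤ ‖X.2.1.1‖ + 2 * |c X| := by
    have e : Ubar χ X ξ = H1.val X.2.1.1 ξ + (c X * χ ξ - c X * χ (y X ξ)) := by
      simp only [Ubar, U, H0inf.val, c]; ring
    have a1 : |c X * χ ξ| ≤ |c X| := by
      rw [abs_mul]; exact mul_le_of_le_one_right (abs_nonneg _) (hχ1 _)
    have a2 : |c X * χ (y X ξ)| ≤ |c X| := by
      rw [abs_mul]; exact mul_le_of_le_one_right (abs_nonneg _) (hχ1 _)
    rw [e]
    refine (abs_add_le _ _).trans (add_le_add (H1.abs_val_le _ _) ((abs_sub _ _).trans ?_))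
    linarith
  set C := ‖X.2.1.1‖ + 2 * |c X|
  have hb2 (ξ : ℝ) : |2 * Ubar χ X ξ + 4 * c X * χ (y X ξ)| ≤ 2 * C + 4 * |c X| := by
    refine (abs_add_le _ _).trans (add_le_add ?_ ?_)
    · rw [abs_mul, abs_two]; linarith [hb1 ξ]
    · rw [abs_mul, abs_mul, abs_of_pos (by norm_num : (0 : ℝ) < 4)]
      exact mul_le_of_le_one_right (by positivity) (hχ1 _)
  have hB : Continuous fun ξ => 2 * Ubar χ X ξ + 4 * c X * χ (y X ξ) :=
    (continuous_const.mul hUbar).add (continuous_const.mul hχy)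
  have h2 := MemLp.mul_of_bound h1 hB.aestronglyMeasurable hb2
  have h3 := MemLp.mul_of_bound (MemLp.mul_of_bound X.1.memLp_der hUbar.aestronglyMeasurable hb1)
    hB.aestronglyMeasurable hb2
  refine ((h2.add h3).add (L2.memLp X.2.2)).ae_eq (Eventually.of_forall fun ξ => ?_)
  simp only [Pi.add_apply, source, yDer, charDer, h]
  ring

theorem tendsto_Q (hχ : IsPartitionFunction χ) (X : E) : Tendsto (Q χ X) atTop (𝓝 0) := by
  have h1 : Tendsto (kerQ (char X.1) (source χ X)) atTop (𝓝 0) := by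
    refine squeeze_zero_norm (abs_kerQ_le X.1 le_rfl (memLp_source hχ X)) ?_
    simpa using (tendsto_expConv_atTop (memLp_source hχ X).norm).const_mul (Real.exp (2 * ‖X.1‖))
  have h2 : Tendsto (fun ξ => c X ^ 2 * deriv (gFun χ) (y X ξ)) atTop (𝓝 0) := by
    have h := (hχ.tendsto_deriv_gFun.comp (tendsto_char_atTop X.1)).const_mul (c X ^ 2)
    rwa [mul_zero] at h
  have h := h1.add h2
  rwa [add_zero] at h

/-- The state `(ζ, U, h)`, when `U` vanishes at `+∞`. -/
def toState (X : E) : State := (X.1, X.2.1.1, X.2.2)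

theorem U_eq {X : E} (hc : c X = 0) : U χ X = State.U (toState X) := by
  ext ξ
  rw [c] at hc
  simp [U, H0inf.val, hc, State.U, toState]

theorem UDer_eq {X : E} (hc : c X = 0) : UDer χ X = State.UDer (toState X) := by
  ext ξ
  rw [c] at hc
  simp [UDer, H0inf.der, hc, State.UDer, toState]

theorem source_eq {X : E} (hc : c X = 0) : source χ X = State.source (toState X) := by
  ext ξ
  simp only [source, Ubar, hc, U_eq hc, State.source]
  simp [yDer, h, State.h, toState]

theorem P_eq {X : E} (hc : c X = 0) : P χ X = State.P (toState X) := by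
  ext ξ
  simp only [P, hc, source_eq hc]
  simp [State.P, kerP, y, toState]

theorem Q_eq {X : E} (hc : c X = 0) : Q χ X = State.Q (toState X) := by
  ext ξ
  simp only [Q, hc, source_eq hc]
  simp [State.Q, kerQ, y, toState]

/-- `toState` as a bounded operator. -/
def toStateL : E →L[ℝ] State :=
  (ContinuousLinearMap.fst ℝ V (H0inf × L2)).prod
    (((ContinuousLinearMap.fst ℝ H1 ℝ).comp ((ContinuousLinearMap.fst ℝ H0inf L2).comp
      (ContinuousLinearMap.snd ℝ V (H0inf × L2)))).prod
    ((ContinuousLinearMap.snd ℝ H0inf L2).comp (ContinuousLinearMap.snd ℝ V (H0inf × L2))))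

/-- The limit at `+∞` as a bounded operator. -/
def cL : E →L[ℝ] ℝ :=
  (ContinuousLinearMap.snd ℝ H1 ℝ).comp ((ContinuousLinearMap.fst ℝ H0inf L2).comp
      (ContinuousLinearMap.snd ℝ V (H0inf × L2)))

end E

/-- The limit at `+∞` is a continuous linear functional of the state. Applied to `U_t = -Q` it gives
`0`, because `Q → 0`; hence `c` is constant. -/
theorem IsLagrangianSolution.c_eq_zero {χ : ℝ → ℝ} (hχ : IsPartitionFunction χ) {X : ℝ → E}
    (hX : IsLagrangianSolution χ X) (h0 : E.c (X 0) = 0) {t : ℝ} (ht : 0 ≤ t) :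
    E.c (X t) = 0 := by
  obtain ⟨X', -, hX'⟩ := hX
  have hc' (s : ℝ) (hs : 0 ≤ s) : E.c (X' s) = 0 := by
    have h1 : Tendsto (E.U χ (X' s)) atTop (𝓝 (E.c (X' s))) := tendsto_H0inf_val hχ _
    have h2 := (E.tendsto_Q hχ (X s)).neg
    rw [neg_zero] at h2
    exact tendsto_nhds_unique h1 (h2.congr fun ξ => ((hX' s hs).2.2.1 ξ).symm)
  have hder (s : ℝ) (hs : 0 ≤ s) : HasDerivWithinAt (fun s => E.c (X s)) 0 (Ici 0) s := by
    refine HasDerivWithinAt.congr_deriv ?_ (hc' s hs)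
    exact (E.cL.hasFDerivAt (x := X s)).comp_hasDerivWithinAt s (hX' s hs).1
  rw [← h0]
  exact constant_of_has_deriv_right_zero (f := fun s => E.c (X s)) (a := 0) (b := t)
    (fun s hs => (hder s hs.1).continuousWithinAt.mono fun _ h => h.1)
    (fun s hs => (hder s hs.1).mono (Ici_subset_Ici.2 hs.1)) t ⟨ht, le_rfl⟩

theorem IsLagrangianSolution.isSolution {χ : ℝ → ℝ} (hχ : IsPartitionFunction χ) {X : ℝ → E}
    (hX : IsLagrangianSolution χ X) (h0 : E.c (X 0) = 0) :
    State.IsSolution fun t => E.toState (X t) := by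
  intro t ht
  have hc := hX.c_eq_zero hχ h0 ht
  obtain ⟨X', -, hX'⟩ := hX
  obtain ⟨hd, h1, h2, h3⟩ := hX' t ht
  -- The time derivative must also have zero limit, so that its `U`-component is its `H¹` part.
  have hc' : E.c (X' t) = 0 := by
    have h1 : Tendsto (E.U χ (X' t)) atTop (𝓝 (E.c (X' t))) := tendsto_H0inf_val hχ _
    have h4 := (E.tendsto_Q hχ (X t)).neg
    rw [neg_zero] at h4
    exact tendsto_nhds_unique h1 (h4.congr fun ξ => (h2 ξ).symm)
  refine ⟨E.toState (X' t), (E.toStateL.hasFDerivAt (x := X t)).comp_hasDerivWithinAt t hd,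
    ⟨fun ξ => ?_, fun ξ => ?_, ?_⟩⟩
  · rw [← E.U_eq (χ := χ) hc]; exact h1 ξ
  · rw [← E.U_eq (χ := χ) hc', ← E.Q_eq (χ := χ) hc]; exact h2 ξ
  · rw [← E.U_eq (χ := χ) hc, ← E.P_eq (χ := χ) hc, ← E.UDer_eq (χ := χ) hc]; exact h3

/-! ## Relabeling -/

/-- `id + e` is a relabeling whose derivative takes its values in `[1, 1 + B]`. -/
structure IsRelabeling (e : V) (B : ℝ) : Prop where
  nonneg : 0 ≤ᵐ[volume] V.der e
  le : ∀ᵐ ξ, V.der e ξ ≤ B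

namespace IsRelabeling

variable {e : V} {B : ℝ}

theorem isChange (he : IsRelabeling e B) : IsChange (char e) (charDer e) where
  prim := isPrimitive_char e
  nonneg := he.nonneg.mono fun _ h => add_nonneg zero_le_one h
  atBot := tendsto_char_atBot e
  atTop := tendsto_char_atTop e

theorem strictMono (he : IsRelabeling e B) : StrictMono (char e) := by
  intro a b hab
  have := e.isPrimitive.monotone he.nonneg hab.le
  exact add_lt_add_of_lt_of_le hab this

theorem bound_nonneg (he : IsRelabeling e B) : 0 ≤ B := by
  obtain ⟨ξ, h1, h2⟩ := (he.nonneg.and he.le).exists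
  exact le_trans h1 h2

/-- The slope of a relabeling is at least `1`, so the order of labels is kept, and with it the sign
in the kernel. -/
theorem sign_eq (he : IsRelabeling e B) (ξ η : ℝ) :
    Real.sign (char e ξ - char e η) = Real.sign (ξ - η) := by
  rcases lt_trichotomy ξ η with h | h | h
  · rw [Real.sign_of_neg (sub_neg.2 h), Real.sign_of_neg (sub_neg.2 (he.strictMono h))]
  · simp [h]
  · rw [Real.sign_of_pos (sub_pos.2 h), Real.sign_of_pos (sub_pos.2 (he.strictMono h))]

theorem integral_comp_sq (he : IsRelabeling e B) {f : ℝ → ℝ} (hf : MemLp f 2) :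
    Integrable (fun ξ => f (char e ξ) ^ 2 * charDer e ξ) ∧
      ∫ ξ, f (char e ξ) ^ 2 * charDer e ξ = ∫ x, f x ^ 2 := by
  have h1 := he.isChange.integrableOn_comp (f := fun x => f x ^ 2) MeasurableSet.univ
    (hf.1.pow 2)
  have h2 := he.isChange.integral_comp (f := fun x => f x ^ 2) (hf.1.pow 2) MeasurableSet.univ
  simp only [preimage_univ, integrableOn_univ, setIntegral_univ] at h1 h2
  exact ⟨h1.2 hf.integrable_sq, h2⟩

/-- Of the two factors `charDer e` in the square, one is the Jacobian and the other is at most `1 +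
B`. -/
theorem memLp_der_comp (he : IsRelabeling e B) (f : V) :
    MemLp (fun ξ => V.der f (char e ξ) * charDer e ξ) 2 ∧
      ∫ ξ, (V.der f (char e ξ) * charDer e ξ) ^ 2 ≤ (1 + B) * ∫ x, V.der f x ^ 2 := by
  obtain ⟨i, h⟩ := he.integral_comp_sq f.memLp_der
  have hm := (he.isChange.isPrimitive_comp f.isPrimitive).aestronglyMeasurable
  have hb : ∀ᵐ ξ, (V.der f (char e ξ) * charDer e ξ) ^ 2 ≤
      (1 + B) * (V.der f (char e ξ) ^ 2 * charDer e ξ) := by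
    filter_upwards [he.nonneg, he.le] with ξ h1 h2
    have h3 : 0 ≤ charDer e ξ := add_nonneg zero_le_one h1
    have h4 : charDer e ξ ≤ 1 + B := by rw [charDer]; linarith
    calc (V.der f (char e ξ) * charDer e ξ) ^ 2
        = charDer e ξ * (V.der f (char e ξ) ^ 2 * charDer e ξ) := by ring
      _ ≤ _ := by gcongr
  have i2 : Integrable fun ξ => (V.der f (char e ξ) * charDer e ξ) ^ 2 := by
    refine (i.const_mul (1 + B)).mono' (hm.pow 2) ?_
    filter_upwards [hb] with ξ hξ
    rwa [Real.norm_of_nonneg (sq_nonneg _)]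
  refine ⟨(memLp_two_iff_integrable_sq hm).2 i2, ?_⟩
  rw [← h, ← integral_const_mul]
  exact integral_mono_ae i2 (i.const_mul _) hb

theorem memLp_val_comp (he : IsRelabeling e B) (f : H1) :
    MemLp (fun ξ => H1.val f (char e ξ)) 2 ∧
      ∫ ξ, H1.val f (char e ξ) ^ 2 ≤ ∫ x, H1.val f x ^ 2 := by
  obtain ⟨i, h⟩ := he.integral_comp_sq f.memLp_val
  have hm : AEStronglyMeasurable (fun ξ => H1.val f (char e ξ)) volume :=
    (f.isPrimitive.continuous.comp (continuous_char e)).aestronglyMeasurable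
  have hb : ∀ᵐ ξ, H1.val f (char e ξ) ^ 2 ≤ H1.val f (char e ξ) ^ 2 * charDer e ξ := by
    filter_upwards [he.nonneg] with ξ h1
    exact le_mul_of_one_le_right (sq_nonneg _) (le_add_of_nonneg_right h1)
  have i2 : Integrable fun ξ => H1.val f (char e ξ) ^ 2 := by
    refine i.mono' (hm.pow 2) ?_
    filter_upwards [hb] with ξ hξ
    rwa [Real.norm_of_nonneg (sq_nonneg _)]
  refine ⟨(memLp_two_iff_integrable_sq hm).2 i2, ?_⟩
  rw [← h]
  exact integral_mono_ae i2 i hb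

/-- Composition with a relabeling in `V`. -/
def compV (he : IsRelabeling e B) : V →L[ℝ] V :=
  LinearMap.mkContinuous
    { toFun := fun f => V.mk (fun ξ => V.val f (char e ξ))
        (fun ξ => V.der f (char e ξ) * charDer e ξ) ⟨‖f‖, fun ξ => f.abs_val_le _⟩
        (he.isChange.isPrimitive_comp f.isPrimitive) (he.memLp_der_comp f).1
      map_add' := fun _ _ => V.ext_val fun _ => rfl
      map_smul' := fun _ _ => V.ext_val fun _ => rfl } (1 + B) fun f => by
    have hB := he.bound_nonneg
    have h0 : ‖f‖ ≤ (1 + B) * ‖f‖ := le_mul_of_one_le_left (norm_nonneg _) (by linarith)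
    refine (V.norm_le (f := V.mk (fun ξ => V.val f (char e ξ)) _ ⟨‖f‖, fun ξ => f.abs_val_le _⟩
      (he.isChange.isPrimitive_comp f.isPrimitive) (he.memLp_der_comp f).1)
      (C := (1 + B) * ‖f‖) (D := (1 + B) * ‖f‖) (fun ξ => (f.abs_val_le _).trans h0) ?_).trans (max_le le_rfl le_rfl)
    change ‖(he.memLp_der_comp f).1.toLp _‖ ≤ _
    refine le_of_sq_le_sq ?_ (by positivity)
    rw [L2.norm_sq_eq, integral_congr_ae (g := fun ξ => (V.der f (char e ξ) * charDer e ξ) ^ 2)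
      ((he.memLp_der_comp f).1.coeFn_toLp.mono fun ξ hξ => by simp only [hξ])]
    refine (he.memLp_der_comp f).2.trans ?_
    have h1 : ∫ x, V.der f x ^ 2 = ‖f.1.2‖ ^ 2 := (L2.norm_sq_eq f.1.2).symm
    have h2 : ‖f.1.2‖ ≤ ‖f‖ := le_max_right _ _
    rw [h1, mul_pow]
    gcongr
    nlinarith

theorem val_compV (he : IsRelabeling e B) (f : V) (ξ : ℝ) :
    V.val (he.compV f) ξ = V.val f (char e ξ) := rfl

theorem der_compV (he : IsRelabeling e B) (f : V) :
    V.der (he.compV f) =ᵐ[volume] fun ξ => V.der f (char e ξ) * charDer e ξ :=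
  (he.memLp_der_comp f).1.coeFn_toLp

/-- Composition with a relabeling in `H¹`. -/
def compH1 (he : IsRelabeling e B) : H1 →L[ℝ] H1 :=
  LinearMap.mkContinuous
    { toFun := fun f => H1.mk (he.compV f.1.1) (he.memLp_val_comp f).1
      map_add' := fun _ _ => H1.ext_val fun _ => rfl
      map_smul' := fun _ _ => H1.ext_val fun _ => rfl } (‖he.compV‖ + 1) fun f => by
    have h1 : ‖f.1.1‖ ≤ ‖f‖ := le_max_left _ _
    have h2 : ‖f.1.2‖ ≤ ‖f‖ := le_max_right _ _
    have h0 := norm_nonneg he.compV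
    refine max_le ?_ ?_
    · refine (he.compV.le_opNorm f.1.1).trans ?_
      gcongr
      linarith
    · have h3 : ‖(he.memLp_val_comp f).1.toLp _‖ ≤ ‖f.1.2‖ := by
        refine le_of_sq_le_sq ?_ (norm_nonneg _)
        rw [L2.norm_sq_eq, L2.norm_sq_eq,
          integral_congr_ae (g := fun ξ => H1.val f (char e ξ) ^ 2)
            ((he.memLp_val_comp f).1.coeFn_toLp.mono fun ξ hξ => by simp only [hξ]),
          integral_congr_ae (f := fun ξ => (f.1.2 : ℝ → ℝ) ξ ^ 2) (g := fun ξ => H1.val f ξ ^ 2)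
            ((H1.toL2_ae f).mono fun ξ hξ => by
              change (H1.toL2 f : ℝ → ℝ) ξ ^ 2 = _
              rw [hξ])]
        exact (he.memLp_val_comp f).2
      exact (h3.trans h2).trans (le_mul_of_one_le_left (norm_nonneg _) (by linarith))

theorem kernel_comp (he : IsRelabeling e B) (y : ℝ → ℝ) (ξ η : ℝ) :
    kernel (fun ξ => y (char e ξ)) ξ η = kernel y (char e ξ) (char e η) := by
  rw [kernel, kernel, he.sign_eq]

/-- Equivariance: the source transforms as a density, while `P` transforms as a function. -/
theorem kerP_comp (he : IsRelabeling e B) {y s : ℝ → ℝ} (hy : Measurable y)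
    (hs : AEStronglyMeasurable s volume) (ξ : ℝ) :
    kerP (fun ξ => y (char e ξ)) (fun η => s (char e η) * charDer e η) ξ =
      kerP y s (char e ξ) := by
  have h := he.isChange.integral_comp (f := fun η => kernel y (char e ξ) η * s η)
    ((measurable_kernel hy _).aestronglyMeasurable.mul hs) MeasurableSet.univ
  simp only [preimage_univ, setIntegral_univ] at h
  rw [kerP, kerP, ← h]
  simp only [he.kernel_comp, mul_assoc]

theorem kerQ_comp (he : IsRelabeling e B) {y s : ℝ → ℝ} (hy : Measurable y)
    (hs : AEStronglyMeasurable s volume) (ξ : ℝ) :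
    kerQ (fun ξ => y (char e ξ)) (fun η => s (char e η) * charDer e η) ξ =
      kerQ y s (char e ξ) := by
  have h := he.isChange.integral_comp
    (f := fun η => Real.sign (char e ξ - η) * kernel y (char e ξ) η * s η)
    (((measurable_sign_sub _).mul (measurable_kernel hy _)).aestronglyMeasurable.mul hs)
    MeasurableSet.univ
  simp only [preimage_univ, setIntegral_univ] at h
  rw [kerQ, kerQ, ← h]
  simp only [he.kernel_comp, he.sign_eq, mul_assoc]

/-! ### From Holden–Raynaud states to the common system -/

/-- The state `(ζ, U, H_ξ - U² y_ξ)` obtained by relabeling from a state `(ζ, U, H)` of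
Holden and Raynaud. -/
def toState (he : IsRelabeling e B) (X : HR.E) : State :=
  (e + he.compV X.1, he.compH1 X.2.1,
    V.derL (he.compV X.2.2) -
      (mulL (V.toLinf (H1.toV (he.compH1 X.2.1))) (H1.toL2 (he.compH1 X.2.1)) +
        mulL (V.toLinf (H1.toV (he.compH1 X.2.1)))
          (mulL (V.toLinf (H1.toV (he.compH1 X.2.1))) (V.derL (e + he.compV X.1)))))

variable (he : IsRelabeling e B) (X : HR.E)

theorem char_toState (ξ : ℝ) : char (he.toState X).1 ξ = HR.E.y X (char e ξ) := by
  simp only [toState, HR.E.y, char, V.val_add, val_compV, add_assoc]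

theorem U_toState (ξ : ℝ) : State.U (he.toState X) ξ = HR.E.U X (char e ξ) := rfl

theorem charDer_toState :
    charDer (he.toState X).1 =ᵐ[volume] fun ξ => HR.E.yDer X (char e ξ) * charDer e ξ := by
  have h1 : V.der (he.toState X).1 =ᵐ[volume] fun ξ => V.der e ξ + V.der (he.compV X.1) ξ :=
    Lp.coeFn_add e.1.2 (he.compV X.1).1.2
  filter_upwards [h1, he.der_compV X.1] with ξ h2 h3
  rw [charDer, h2, h3, HR.E.yDer, charDer, charDer]
  ring

theorem h_toState : State.h (he.toState X) =ᵐ[volume] fun ξ =>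
    V.der (he.compV X.2.2) ξ - State.U (he.toState X) ξ ^ 2 * charDer (he.toState X).1 ξ := by
  have h1 : State.h (he.toState X) =ᵐ[volume] fun ξ => V.der (he.compV X.2.2) ξ -
      (mulL (V.toLinf (H1.toV (he.compH1 X.2.1))) (H1.toL2 (he.compH1 X.2.1)) +
        mulL (V.toLinf (H1.toV (he.compH1 X.2.1)))
          (mulL (V.toLinf (H1.toV (he.compH1 X.2.1))) (V.derL (e + he.compV X.1))) : L2) ξ :=
    Lp.coeFn_sub _ _
  filter_upwards [h1, Lp.coeFn_add
    (mulL (V.toLinf (H1.toV (he.compH1 X.2.1))) (H1.toL2 (he.compH1 X.2.1)))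
    (mulL (V.toLinf (H1.toV (he.compH1 X.2.1)))
      (mulL (V.toLinf (H1.toV (he.compH1 X.2.1))) (V.derL (e + he.compV X.1)))),
    mulL_ae (V.toLinf (H1.toV (he.compH1 X.2.1))) (H1.toL2 (he.compH1 X.2.1)),
    mulL_ae (V.toLinf (H1.toV (he.compH1 X.2.1)))
      (mulL (V.toLinf (H1.toV (he.compH1 X.2.1))) (V.derL (e + he.compV X.1))),
    mulL_ae (V.toLinf (H1.toV (he.compH1 X.2.1))) (V.derL (e + he.compV X.1)),
    V.toLinf_ae (H1.toV (he.compH1 X.2.1)), H1.toL2_ae (he.compH1 X.2.1)]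
    with ξ e1 e2 e3 e4 e5 e6 e7
  have e8 : State.U (he.toState X) ξ = H1.val (he.compH1 X.2.1) ξ := rfl
  have e9 : V.val (H1.toV (he.compH1 X.2.1)) ξ = H1.val (he.compH1 X.2.1) ξ := rfl
  have e10 : charDer (he.toState X).1 ξ = 1 + (V.derL (e + he.compV X.1) : ℝ → ℝ) ξ := rfl
  rw [e1, e2, Pi.add_apply, e3, e4, e5, e6, e7, e8, e9, e10]
  ring

theorem aestronglyMeasurable_source : AEStronglyMeasurable (HR.E.source X) volume :=
  ((X.2.1.isPrimitive.continuous.pow 2).aestronglyMeasurable.mul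
    (isPrimitive_char X.1).aestronglyMeasurable).add X.2.2.isPrimitive.aestronglyMeasurable

/-- With `h = H_ξ - U² y_ξ` one has `2 U² y_ξ + h = U² y_ξ + H_ξ`: the point where the two nonlocal
terms become equal. -/
theorem source_toState : State.source (he.toState X) =ᵐ[volume]
    fun ξ => HR.E.source X (char e ξ) * charDer e ξ := by
  filter_upwards [he.h_toState X, he.charDer_toState X, he.der_compV X.2.2] with ξ e1 e2 e3
  rw [State.source, e1, e2, e3, U_toState, HR.E.source, HR.E.HDer]
  ring

theorem P_toState (ξ : ℝ) : State.P (he.toState X) ξ = HR.E.P X (char e ξ) := by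
  rw [State.P, kerP_congr (he.source_toState X),
    show char (he.toState X).1 = _ from funext (he.char_toState X)]
  exact he.kerP_comp (continuous_char X.1).measurable (aestronglyMeasurable_source X) ξ

theorem Q_toState (ξ : ℝ) : State.Q (he.toState X) ξ = HR.E.Q X (char e ξ) := by
  rw [State.Q, kerQ_congr (he.source_toState X),
    show char (he.toState X).1 = _ from funext (he.char_toState X)]
  exact he.kerQ_comp (continuous_char X.1).measurable (aestronglyMeasurable_source X) ξ

/-- The relabeled Holden-Raynaud solutions solve the system for `(ζ, U, h)`. -/
theorem isSolution {X : ℝ → HR.E} (hX : HR.IsLagrangianSolution X) :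
    State.IsSolution fun t => he.toState (X t) := by
  intro t ht
  obtain ⟨X', -, hX'⟩ := hX
  obtain ⟨hd, h1, h2, h3⟩ := hX' t ht
  generalize X' t = Y at hd h1 h2 h3
  have dζ : HasDerivWithinAt (fun t => e + he.compV (X t).1) (he.compV Y.1) (Ici 0) t :=
    ((he.compV.comp (ContinuousLinearMap.fst ℝ V (H1 × V))).hasFDerivAt
      (x := X t) |>.comp_hasDerivWithinAt t hd).const_add e
  have dU : HasDerivWithinAt (fun t => he.compH1 (X t).2.1) (he.compH1 Y.2.1) (Ici 0) t :=
    (he.compH1.comp ((ContinuousLinearMap.fst ℝ H1 V).comp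
      (ContinuousLinearMap.snd ℝ V (H1 × V)))).hasFDerivAt (x := X t) |>.comp_hasDerivWithinAt t hd
  have dH : HasDerivWithinAt (fun t => V.derL (he.compV (X t).2.2)) (V.derL (he.compV Y.2.2))
      (Ici 0) t :=
    (V.derL.comp (he.compV.comp ((ContinuousLinearMap.snd ℝ H1 V).comp
      (ContinuousLinearMap.snd ℝ V (H1 × V))))).hasFDerivAt (x := X t)
      |>.comp_hasDerivWithinAt t hd
  have dζL : HasDerivWithinAt (fun t => V.derL (e + he.compV (X t).1)) (V.derL (he.compV Y.1))
      (Ici 0) t := V.derL.hasFDerivAt.comp_hasDerivWithinAt t dζ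
  have dUL : HasDerivWithinAt (fun t => H1.toL2 (he.compH1 (X t).2.1))
      (H1.toL2 (he.compH1 Y.2.1)) (Ici 0) t := H1.toL2.hasFDerivAt.comp_hasDerivWithinAt t dU
  have dm : HasDerivWithinAt (fun t => mulL (V.toLinf (H1.toV (he.compH1 (X t).2.1))))
      (mulL (V.toLinf (H1.toV (he.compH1 Y.2.1)))) (Ici 0) t :=
    (mulL.comp (V.toLinf.comp H1.toV)).hasFDerivAt.comp_hasDerivWithinAt t dU
  have dh := dH.sub ((dm.clm_apply dUL).add (dm.clm_apply (dm.clm_apply dζL)))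
  refine ⟨_, dζ.prodMk (dU.prodMk dh), ⟨fun ξ => h1 _, fun ξ => ?_, ?_⟩⟩
  · rw [Q_toState]; exact h2 _
  set Z := he.toState (X t) with hZ
  set u := H1.toV (he.compH1 (X t).2.1) with hu
  set u' := H1.toV (he.compH1 Y.2.1) with hu'
  set w := H1.toL2 (he.compH1 (X t).2.1) with hw
  set w' := H1.toL2 (he.compH1 Y.2.1) with hw'
  set z := V.derL (e + he.compV (X t).1) with hz
  set z' := V.derL (he.compV Y.1) with hz'
  have a1 : (z' : ℝ → ℝ) =ᵐ[volume] State.UDer Z :=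
    V.der_ae (f := he.compV Y.1) (fun ξ => h1 _) Z.2.1.isPrimitive
  have hUp : IsPrimitive (State.U Z) (State.UDer Z) := Z.2.1.isPrimitive
  -- The equation `H_t = U³ - 2 P U` differentiated in `ξ`, with `P_ξ = Q y_ξ`. The resulting `-2 U
  -- Q y_ξ` cancels the contribution of `U_t = -Q` to `-(U² y_ξ)_t`, leaving `2 (U² - P) U_ξ`.
  have a2 : (V.derL (he.compV Y.2.2) : ℝ → ℝ) =ᵐ[volume] _ :=
    V.der_ae (f := he.compV Y.2.2)
      (F := fun ξ => State.U Z ξ * State.U Z ξ * State.U Z ξ - 2 * (State.P Z ξ * State.U Z ξ))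
      (fun ξ => by
        refine (h3 (char e ξ)).trans ?_
        rw [hZ, P_toState, U_toState]; ring)
      (((hUp.mul hUp).mul hUp).sub ((Z.isPrimitive_P.mul hUp).const_mul 2))
  have a3 (ξ : ℝ) : V.val u' ξ = -State.Q Z ξ := by
    rw [hZ, Q_toState]; exact h2 _
  have a4 (ξ : ℝ) : V.val u ξ = State.U Z ξ := rfl
  have a5 : (w : ℝ → ℝ) =ᵐ[volume] State.U Z := H1.toL2_ae _
  have a6 : (w' : ℝ → ℝ) =ᵐ[volume] V.val u' := H1.toL2_ae _
  have a7 (ξ : ℝ) : charDer Z.1 ξ = 1 + (z : ℝ → ℝ) ξ := rfl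
  have b0 := Lp.coeFn_sub (V.derL (he.compV Y.2.2))
    ((mulL (V.toLinf u') w + mulL (V.toLinf u) w') +
      (mulL (V.toLinf u') (mulL (V.toLinf u) z) +
        mulL (V.toLinf u) (mulL (V.toLinf u') z + mulL (V.toLinf u) z')))
  refine b0.trans ?_
  filter_upwards [a1, a2, a5, a6, V.toLinf_ae u, V.toLinf_ae u',
    Lp.coeFn_add (mulL (V.toLinf u') w + mulL (V.toLinf u) w')
      (mulL (V.toLinf u') (mulL (V.toLinf u) z) +
        mulL (V.toLinf u) (mulL (V.toLinf u') z + mulL (V.toLinf u) z')),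
    Lp.coeFn_add (mulL (V.toLinf u') w) (mulL (V.toLinf u) w'),
    Lp.coeFn_add (mulL (V.toLinf u') (mulL (V.toLinf u) z))
        (mulL (V.toLinf u) (mulL (V.toLinf u') z + mulL (V.toLinf u) z')),
    Lp.coeFn_add (mulL (V.toLinf u') z) (mulL (V.toLinf u) z'),
    mulL_ae (V.toLinf u') w, mulL_ae (V.toLinf u) w', mulL_ae (V.toLinf u) z,
    mulL_ae (V.toLinf u') (mulL (V.toLinf u) z), mulL_ae (V.toLinf u') z,
    mulL_ae (V.toLinf u) z',
    mulL_ae (V.toLinf u) (mulL (V.toLinf u') z + mulL (V.toLinf u) z')]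
    with ξ c1 c2 c3 c4 c5 c6 c7 c8 c9 c10 c11 c12 c13 c14 c15 c16 c17
  simp only [Pi.sub_apply, Pi.add_apply] at *
  rw [c7, c8, c9, c17, c10, c11, c12, c14, c13, c15, c16, c5, c6, c1, c2, c3, c4, a3, a4, a7]
  ring

end IsRelabeling

/-! ## The characteristic attached to a measure -/

section

variable (μ : Measure ℝ)

/-- The distribution function `μ((-∞, y)) + y`. -/
def distr (y : ℝ) : ℝ := μ.real (Iio y) + y

theorem le_distr (y : ℝ) : y ≤ distr μ y := le_add_of_nonneg_left measureReal_nonneg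

theorem charOfMeasure_set_bddAbove (ξ : ℝ) : BddAbove {y : ℝ | μ.real (Iio y) + y < ξ} :=
  ⟨ξ, fun y hy => (le_distr μ y).trans (le_of_lt hy)⟩

theorem le_distr_of_charOfMeasure_lt {ξ z : ℝ} (h : charOfMeasure μ ξ < z) : ξ ≤ distr μ z := by
  by_contra hlt
  exact absurd (le_csSup (charOfMeasure_set_bddAbove μ ξ) (not_le.1 hlt)) (not_le.2 h)

variable [IsFiniteMeasure μ]

theorem distr_strictMono : StrictMono (distr μ) := fun _ _ h =>
  add_lt_add_of_le_of_lt (measureReal_mono (Iio_subset_Iio h.le)) h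

theorem distr_sub_le {a b : ℝ} (h : a ≤ b) : b - a ≤ distr μ b - distr μ a := by
  have := measureReal_mono (μ := μ) (Iio_subset_Iio h)
  rw [distr, distr]; linarith

theorem distr_tendsto_left {u : ℕ → ℝ} {y : ℝ} (hu : Monotone u) (hlt : ∀ n, u n < y)
    (ht : Tendsto u atTop (𝓝 y)) : Tendsto (fun n => distr μ (u n)) atTop (𝓝 (distr μ y)) := by
  have h1 : ⋃ n, Iio (u n) = Iio y := by
    ext x
    simp only [mem_iUnion, mem_Iio]
    exact ⟨fun ⟨n, hn⟩ => hn.trans (hlt n), fun hx => (ht.eventually (lt_mem_nhds hx)).exists⟩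
  have h2 := tendsto_measure_iUnion_atTop (μ := μ) (s := fun n => Iio (u n))
    (fun _ _ h => Iio_subset_Iio (hu h))
  rw [h1] at h2
  exact ((ENNReal.tendsto_toReal (measure_ne_top μ _)).comp h2).add ht

theorem distr_tendsto_right {u : ℕ → ℝ} {y : ℝ} (hu : Antitone u) (hlt : ∀ n, y < u n)
    (ht : Tendsto u atTop (𝓝 y)) :
    Tendsto (fun n => distr μ (u n)) atTop (𝓝 (μ.real (Iic y) + y)) := by
  have h1 : ⋂ n, Iio (u n) = Iic y := by
    ext x
    simp only [mem_iInter, mem_Iio, mem_Iic]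
    exact ⟨fun hx => ge_of_tendsto' ht fun n => (hx n).le, fun hx n => hx.trans_lt (hlt n)⟩
  have h2 := tendsto_measure_iInter_atTop (μ := μ) (s := fun n => Iio (u n))
    (fun _ => measurableSet_Iio.nullMeasurableSet) (fun _ _ h => Iio_subset_Iio (hu h))
    ⟨0, measure_ne_top μ _⟩
  rw [h1] at h2
  exact ((ENNReal.tendsto_toReal (measure_ne_top μ _)).comp h2).add ht

theorem charOfMeasure_set_nonempty (ξ : ℝ) : {y : ℝ | μ.real (Iio y) + y < ξ}.Nonempty := by
  refine ⟨ξ - μ.real univ - 1, ?_⟩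
  have := measureReal_mono (μ := μ) (subset_univ (Iio (ξ - μ.real univ - 1)))
  rw [mem_ofPred_eq]
  linarith

theorem distr_charOfMeasure_le (ξ : ℝ) : distr μ (charOfMeasure μ ξ) ≤ ξ := by
  obtain ⟨u, hu, hlt, ht⟩ := exists_seq_strictMono_tendsto (charOfMeasure μ ξ)
  refine le_of_tendsto' (distr_tendsto_left μ hu.monotone hlt ht) fun n => ?_
  obtain ⟨y, hy, hlt'⟩ := exists_lt_of_lt_csSup (charOfMeasure_set_nonempty μ ξ) (hlt n)
  exact ((distr_strictMono μ hlt').trans hy).le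

/-- Together with `distr_charOfMeasure_le`, this brackets `ξ` between the left and right limits of
the distribution function at `y(ξ)`. They coincide where there is no atom. -/
theorem le_measureReal_Iic_add (ξ : ℝ) :
    ξ ≤ μ.real (Iic (charOfMeasure μ ξ)) + charOfMeasure μ ξ := by
  obtain ⟨u, hu, hlt, ht⟩ := exists_seq_strictAnti_tendsto (charOfMeasure μ ξ)
  exact ge_of_tendsto' (distr_tendsto_right μ hu.antitone hlt ht) fun n =>
    le_distr_of_charOfMeasure_lt μ (hlt n)

theorem eq_charOfMeasure {ξ y : ℝ} (h1 : distr μ y ≤ ξ) (h2 : ∀ z, y < z → ξ ≤ distr μ z) :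
    charOfMeasure μ ξ = y := by
  refine le_antisymm ?_ ?_
  · by_contra hlt
    obtain ⟨z, hz1, hz2⟩ := exists_between (not_le.1 hlt)
    exact absurd ((h2 z hz1).trans_lt (distr_strictMono μ hz2))
      (not_lt.2 (distr_charOfMeasure_le μ ξ))
  · by_contra hlt
    obtain ⟨z, hz1, hz2⟩ := exists_between (not_le.1 hlt)
    exact absurd ((le_distr_of_charOfMeasure_lt μ hz1).trans_lt (distr_strictMono μ hz2))
      (not_lt.2 h1)

theorem charOfMeasure_mono : Monotone (charOfMeasure μ) := fun ξ _ h =>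
  csSup_le_csSup (charOfMeasure_set_bddAbove μ _) (charOfMeasure_set_nonempty μ ξ)
    fun _ hy => lt_of_lt_of_le hy h

/-- The distribution function has slope at least `1`, so its generalized inverse is `1`-Lipschitz.
-/
theorem sub_charOfMeasure_mono : Monotone fun ξ => ξ - charOfMeasure μ ξ := by
  intro ξ ξ' h
  by_contra hlt
  rw [not_le] at hlt
  simp only at hlt
  obtain ⟨z, hz1, hz2⟩ := exists_between (show charOfMeasure μ ξ <
    charOfMeasure μ ξ' - (ξ' - ξ) by linarith)
  have h1 := le_distr_of_charOfMeasure_lt μ hz1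
  have h2 := distr_charOfMeasure_le μ ξ'
  have h3 := distr_sub_le μ (show z ≤ charOfMeasure μ ξ' by linarith)
  linarith

/-- The image of the Lebesgue measure by the characteristic is `μ + dx`. -/
theorem map_charOfMeasure : (volume : Measure ℝ).map (charOfMeasure μ) = μ + volume := by
  symm
  have hm := (charOfMeasure_mono μ).measurable
  refine Measure.ext_of_Ico' _ _ (fun a b _ => ?_) fun a b hab => ?_
  · rw [Measure.add_apply]
    exact ENNReal.add_ne_top.2 ⟨measure_ne_top μ _, measure_Ico_lt_top.ne⟩
  -- The equivalence can fail only at the single label `ξ = distr μ c`, which is negligible.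
  have hiff (c ξ : ℝ) (hξ : ξ ≠ distr μ c) : c ≤ charOfMeasure μ ξ ↔ distr μ c ≤ ξ := by
    constructor
    · intro h
      exact ((distr_strictMono μ).monotone h).trans (distr_charOfMeasure_le μ ξ)
    · intro h
      by_contra hlt
      exact hξ (le_antisymm (le_distr_of_charOfMeasure_lt μ (not_le.1 hlt)) h)
  have hae : charOfMeasure μ ⁻¹' Ico a b =ᵐ[volume] Ico (distr μ a) (distr μ b) := by
    have h0 (c : ℝ) : ∀ᵐ ξ : ℝ, ξ ≠ c := by simp [ae_iff]
    filter_upwards [h0 (distr μ a), h0 (distr μ b)] with ξ ha hb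
    apply propext
    change a ≤ _ ∧ _ < b ↔ _ ≤ ξ ∧ ξ < _
    rw [hiff a ξ ha, ← not_le, hiff b ξ hb, not_le]
  rw [Measure.map_apply hm measurableSet_Ico, measure_congr hae, Real.volume_Ico,
    Measure.add_apply, Real.volume_Ico, ← ofReal_measureReal,
    ← ENNReal.ofReal_add measureReal_nonneg (by linarith),
    show Ico a b = Iio b \ Iio a by ext z; simp,
    measureReal_sdiff (Iio_subset_Iio hab.le) measurableSet_Iio, distr, distr]
  congr 1; ring

end

/-- The identity `y_ξ (1 - y_ξ) = U_ξ²` for the characteristic attached to a measure with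
absolutely continuous part `u_x² dx`. -/
theorem charOfMeasure_identity (μ : Measure ℝ) [IsFiniteMeasure μ] {y ρ w : ℝ → ℝ}
    (hy : IsChange y ρ) (hyμ : ∀ ξ, y ξ = charOfMeasure μ ξ) (hρ : Measurable ρ)
    (hw : Measurable w) (hμ : acPart μ = volume.withDensity fun x => ENNReal.ofReal (w x ^ 2)) :
    ∀ᵐ ξ, ρ ξ * (1 - ρ ξ) = (w (y ξ) * ρ ξ) ^ 2 := by
  -- The singular part of `μ` does not charge `s`, and the complement of `s` is Lebesgue null.
  obtain ⟨s, hs, hs1, hs2⟩ := μ.mutuallySingular_singularPart volume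
  have hdec : μ = μ.singularPart volume + volume.withDensity fun x => ENNReal.ofReal (w x ^ 2) := by
    rw [← hμ, acPart]; exact μ.haveLebesgueDecomposition_add volume
  have hwm : Measurable fun x => ENNReal.ofReal (w x ^ 2) := (hw.pow_const 2).ennreal_ofReal
  have hatom (x : ℝ) (hx : x ∈ s) : μ.real {x} = 0 := by
    have h1 : μ {x} = 0 := by
      rw [hdec, Measure.add_apply, withDensity_apply _ (measurableSet_singleton x),
        measure_mono_null (singleton_subset_iff.2 hx) hs1]
      simp
    rw [measureReal_def, h1, ENNReal.toReal_zero]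
  have hinv (ξ : ℝ) (hξ : y ξ ∈ s) : distr μ (y ξ) = ξ := by
    refine le_antisymm (hyμ ξ ▸ distr_charOfMeasure_le μ ξ) ?_
    have h1 := le_measureReal_Iic_add μ ξ
    rw [← hyμ ξ, ← Iio_union_right, measureReal_union (by simp) (measurableSet_singleton _),
      hatom _ hξ, add_zero] at h1
    exact h1
  have hmap : (volume : Measure ℝ).map y = μ + volume := by
    rw [show y = _ from funext hyμ, map_charOfMeasure]
  have hF : Measurable (distr μ) := (distr_strictMono μ).monotone.measurable
  -- On `y ⁻¹' s` the map `distr μ` inverts `y`, so every measurable subset is a preimage `y ⁻¹' B`.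
  -- Computing its length through `y_# dξ = μ + dx` gives `1 = (w² ∘ y + 1) ρ` there.
  have key : (fun _ => 1) =ᵐ[volume.restrict (y ⁻¹' s)]
      fun ξ => ENNReal.ofReal (w (y ξ) ^ 2) * ENNReal.ofReal (ρ ξ) + ENNReal.ofReal (ρ ξ) := by
    refine ae_eq_of_forall_setLIntegral_eq_of_sigmaFinite measurable_const
      (((hwm.comp hy.measurable).mul hρ.ennreal_ofReal).add hρ.ennreal_ofReal) fun A hA _ => ?_
    set B := s ∩ distr μ ⁻¹' A with hB
    have hBm : MeasurableSet B := hs.inter (hF hA)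
    have hpre : A ∩ y ⁻¹' s = y ⁻¹' B := by
      ext ξ
      simp only [hB, mem_inter_iff, mem_preimage]
      constructor
      · rintro ⟨h1, h2⟩; exact ⟨h2, by rwa [hinv ξ h2]⟩
      · rintro ⟨h1, h2⟩; exact ⟨by rwa [hinv ξ h1] at h2, h1⟩
    have e1 : volume (y ⁻¹' B) = (∫⁻ x in B, ENNReal.ofReal (w x ^ 2)) + volume B := by
      rw [← Measure.map_apply hy.measurable hBm, hmap, Measure.add_apply]
      conv_lhs => rw [hdec]
      rw [Measure.add_apply, measure_mono_null inter_subset_left hs1, zero_add,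
        withDensity_apply _ hBm]
    have e2 : ∫⁻ ξ in y ⁻¹' B, ENNReal.ofReal (w (y ξ) ^ 2) * ENNReal.ofReal (ρ ξ) =
        ∫⁻ x in B, ENNReal.ofReal (w x ^ 2) := by
      rw [← withDensity_apply _ (hy.measurable hBm), ← Measure.map_apply hy.measurable hBm,
        hy.map_withDensity hwm, withDensity_apply _ hBm]
    have e3 : ∫⁻ ξ in y ⁻¹' B, ENNReal.ofReal (ρ ξ) = volume B := by
      rw [← withDensity_apply _ (hy.measurable hBm)]
      exact hy.density_preimage hBm
    rw [Measure.restrict_restrict hA, hpre, lintegral_add_right _ hρ.ennreal_ofReal, e2, e3,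
      setLIntegral_const, one_mul, e1]
  rw [Filter.EventuallyEq, ae_restrict_iff' (hy.measurable hs)] at key
  have hs2' : ∀ᵐ x, x ∈ s := by rw [ae_iff]; exact hs2
  filter_upwards [key, hy.ae_comp hs2', hy.nonneg] with ξ h1 h2 h3
  -- Outside `y ⁻¹' s` the derivative `ρ` vanishes almost everywhere, and the identity is trivial.
  by_cases h : ρ ξ = 0
  · simp [h]
  · have h4 := h1 (h2 h)
    have h5 : w (y ξ) ^ 2 * ρ ξ + ρ ξ = 1 := by
      have h3' : 0 ≤ ρ ξ := h3
      rw [← ENNReal.ofReal_mul (sq_nonneg _), ← ENNReal.ofReal_add (by positivity) h3] at h4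
      exact (ENNReal.ofReal_eq_one.1 h4.symm)
    have h6 : 1 - ρ ξ = w (y ξ) ^ 2 * ρ ξ := by linarith
    rw [h6]; ring

/-! ## The relabeling that relates the two constructions -/

/-- The relabeling `ξ ↦ ξ + ∫_{-∞}^{y(ξ)} w²`. -/
theorem exists_relabeling (w : H1) {ζ : V} (hy : IsChange (char ζ) (charDer ζ))
    (hle : ∀ᵐ ξ, charDer ζ ξ ≤ 1) : ∃ (e : V) (B : ℝ), IsRelabeling e B ∧
      (∀ ξ, V.val e ξ = ∫ z in Iio (char ζ ξ), H1.val w z ^ 2) ∧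
      V.der e =ᵐ[volume] fun ξ => H1.val w (char ζ ξ) ^ 2 * charDer ζ ξ := by
  have hi := w.memLp_val.integrable_sq
  have hR : IsPrimitive (fun x => ∫ z in Iio x, H1.val w z ^ 2) (fun x => H1.val w x ^ 2) := by
    simp only [← integral_Iic_eq_integral_Iio]
    exact isPrimitive_integral_Iic hi.locallyIntegrable fun _ => hi.integrableOn
  have hp := hy.isPrimitive_comp hR
  -- The bound `y_ξ ≤ 1` makes the relabeling Lipschitz, with `B = ‖w‖²`.
  have hb : ∀ᵐ ξ, 0 ≤ H1.val w (char ζ ξ) ^ 2 * charDer ζ ξ ∧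
      H1.val w (char ζ ξ) ^ 2 * charDer ζ ξ ≤ ‖w‖ ^ 2 := by
    filter_upwards [hy.nonneg, hle] with ξ h1 h2
    have h1' : 0 ≤ charDer ζ ξ := h1
    have h3 : H1.val w (char ζ ξ) ^ 2 ≤ ‖w‖ ^ 2 :=
      sq_le_sq' (abs_le.1 (w.abs_val_le _)).1 (abs_le.1 (w.abs_val_le _)).2
    refine ⟨by positivity, ?_⟩
    calc _ ≤ H1.val w (char ζ ξ) ^ 2 * 1 := by gcongr
      _ ≤ _ := by rwa [mul_one]
  have hint : Integrable fun ξ => H1.val w (char ζ ξ) ^ 2 * charDer ζ ξ := by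
    have := (hy.integrableOn_comp (f := fun x => H1.val w x ^ 2) MeasurableSet.univ
      (w.memLp_val.1.pow 2)).2 hi.integrableOn
    simpa using this
  have hmem : MemLp (fun ξ => H1.val w (char ζ ξ) ^ 2 * charDer ζ ξ) 2 := by
    refine (memLp_two_iff_integrable_sq hp.aestronglyMeasurable).2
      ((hint.const_mul (‖w‖ ^ 2)).mono' (hp.aestronglyMeasurable.pow 2) ?_)
    filter_upwards [hb] with ξ hξ
    rw [Real.norm_of_nonneg (sq_nonneg _), sq]
    exact mul_le_mul_of_nonneg_right hξ.2 hξ.1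
  have hbd : ∃ C, ∀ ξ, |∫ z in Iio (char ζ ξ), H1.val w z ^ 2| ≤ C := by
    refine ⟨∫ z, H1.val w z ^ 2, fun ξ => ?_⟩
    rw [abs_of_nonneg (integral_nonneg fun z => sq_nonneg _)]
    exact setIntegral_le_integral hi (Eventually.of_forall fun z => sq_nonneg _)
  have hder := V.der_mk _ _ hbd hp hmem
  refine ⟨V.mk _ _ hbd hp hmem, ‖w‖ ^ 2, ⟨?_, ?_⟩, fun ξ => rfl, hder⟩
  · filter_upwards [hder, hb] with ξ h1 h2
    rw [Pi.zero_apply, h1]; exact h2.1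
  · filter_upwards [hder, hb] with ξ h1 h2
    rw [h1]; exact h2.2

/-- The energy distributions of two initial data that correspond to each other. -/
theorem charOfMeasure_comp (μ ν : Measure ℝ) [IsFiniteMeasure μ] [IsFiniteMeasure ν]
    {f : ℝ → ℝ} (hf : Integrable fun z => f z ^ 2)
    (h : ∀ x, ν.real (Iio x) - μ.real (Iio x) = ∫ z in Iio x, f z ^ 2) (ξ : ℝ) :
    charOfMeasure ν (ξ + ∫ z in Iio (charOfMeasure μ ξ), f z ^ 2) = charOfMeasure μ ξ := by
  have hν (x : ℝ) : distr ν x = distr μ x + ∫ z in Iio x, f z ^ 2 := by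
    rw [← h, distr, distr]; ring
  -- Adding the nondecreasing function `∫_{-∞}^x f²` to the distribution function, and its value at
  -- `y(ξ)` to the label, preserves both bracketing inequalities.
  refine eq_charOfMeasure ν ?_ fun z hz => ?_
  · rw [hν]; linarith [distr_charOfMeasure_le μ ξ]
  · rw [hν]
    have := setIntegral_mono_set hf.integrableOn (Eventually.of_forall fun z => sq_nonneg (f z))
      (Iio_subset_Iio hz.le).eventuallyLE
    linarith [le_distr_of_charOfMeasure_lt μ hz]

/-! ### Comparison of the initial data -/

section

variable {χ u₀ v₀ : ℝ → ℝ} {μ₀ ν₀ : Measure ℝ} {X : E}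

theorem IsLagrangianOf.c_eq_zero (hχ : IsPartitionFunction χ) (hX : IsLagrangianOf χ u₀ μ₀ X)
    (w : H1) (hw : ∀ x, u₀ x = H1.val w x) : E.c X = 0 := by
  have h1 : Tendsto (E.U χ X) atTop (𝓝 (E.c X)) := tendsto_H0inf_val hχ _
  have h2 := w.tendsto_val_atTop.comp (tendsto_char_atTop X.1)
  refine tendsto_nhds_unique h1 (h2.congr fun ξ => ?_)
  rw [hX.2.1, hw]; rfl

/-- At the initial time, `y_ξ + h ≥ 0`. -/
theorem IsLagrangianOf.add_nonneg (hX : IsLagrangianOf χ u₀ μ₀ X) :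
    ∀ᵐ ξ, 0 ≤ charDer (E.toState X).1 ξ + State.h (E.toState X) ξ := by
  filter_upwards [hX.2.2] with ξ e
  have e4 : State.h (E.toState X) ξ = 1 - charDer X.1 ξ := e
  rw [e4]
  change 0 ≤ charDer X.1 ξ + (1 - charDer X.1 ξ)
  linarith

variable [IsFiniteMeasure μ₀]

theorem IsLagrangianOf.monotone (hX : IsLagrangianOf χ u₀ μ₀ X) : Monotone (char X.1) := by
  rw [show char X.1 = _ from funext hX.1]
  exact charOfMeasure_mono μ₀

theorem IsLagrangianOf.isChange (hX : IsLagrangianOf χ u₀ μ₀ X) :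
    IsChange (char X.1) (charDer X.1) where
  prim := isPrimitive_char X.1
  nonneg := (isPrimitive_char X.1).nonneg_of_monotone hX.monotone
  atBot := tendsto_char_atBot X.1
  atTop := tendsto_char_atTop X.1

theorem IsLagrangianOf.charDer_le (hX : IsLagrangianOf χ u₀ μ₀ X) :
    ∀ᵐ ξ, charDer X.1 ξ ≤ 1 := by
  have h1 : Monotone fun ξ => ξ - char X.1 ξ := by
    rw [show char X.1 = _ from funext hX.1]
    exact sub_charOfMeasure_mono μ₀
  filter_upwards [(isPrimitive_id.sub (isPrimitive_char X.1)).nonneg_of_monotone h1] with ξ h2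
  exact sub_nonneg.1 h2

/-- At the initial time, `y_ξ h = U_ξ²`. -/
theorem IsLagrangianOf.mul_eq (hχ : IsPartitionFunction χ) (h₀ : IsEulerian χ u₀ μ₀)
    (hX : IsLagrangianOf χ u₀ μ₀ X) (hc : E.c X = 0) :
    ∀ᵐ ξ, charDer (E.toState X).1 ξ * State.h (E.toState X) ξ =
      State.UDer (E.toState X) ξ ^ 2 := by
  obtain ⟨-, v, hv, hac⟩ := h₀
  have hm1 : Measurable (charDer X.1) :=
    measurable_const.add (Lp.stronglyMeasurable X.1.1.2).measurable
  have hm2 : Measurable (H0inf.der χ v) :=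
    (Lp.stronglyMeasurable v.1.1.1.1.2).measurable.add ((measurable_deriv χ).const_mul _)
  have h1 := charOfMeasure_identity μ₀ hX.isChange hX.1 hm1 hm2 hac
  have h2 : State.UDer (E.toState X) =ᵐ[volume]
      fun ξ => H0inf.der χ v (char X.1 ξ) * charDer X.1 ξ := by
    refine H1.der_ae (F := fun ξ => H0inf.val χ v (char X.1 ξ)) (fun ξ => ?_)
      (hX.isChange.isPrimitive_comp (H0inf.isPrimitive hχ v))
    rw [← hv]
    exact (congrFun (E.U_eq (χ := χ) hc) ξ).symm.trans (hX.2.1 ξ)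
  filter_upwards [h1, h2, hX.2.2] with ξ e1 e2 e3
  have e4 : State.h (E.toState X) ξ = 1 - charDer X.1 ξ := e3
  rw [e4, e2, ← e1]
  rfl

/-- The initial data of the two constructions agree up to a relabeling. -/
theorem exists_toState_eq (hχ : IsPartitionFunction χ) (hX : IsLagrangianOf χ u₀ μ₀ X)
    (h₀' : HR.IsEulerian v₀ ν₀) (huv : ∀ x, u₀ x = v₀ x)
    (hμν : ∀ x, ν₀.real (Iio x) - μ₀.real (Iio x) = ∫ z in Iio x, u₀ z ^ 2)
    {Y : HR.E} (hY : HR.IsLagrangianOf v₀ ν₀ Y) :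
    E.c X = 0 ∧ ∃ (e : V) (B : ℝ) (he : IsRelabeling e B), he.toState Y = E.toState X := by
  obtain ⟨hν, w, hw, -⟩ := h₀'
  have huw (x : ℝ) : u₀ x = H1.val w x := (huv x).trans (hw x)
  have hc := hX.c_eq_zero hχ w huw
  obtain ⟨e, B, he, hval, hder⟩ := exists_relabeling w hX.isChange hX.charDer_le
  have hy (ξ : ℝ) : HR.E.y Y (char e ξ) = char X.1 ξ := by
    have hint : Integrable fun z => u₀ z ^ 2 := by
      simpa only [huw] using w.memLp_val.integrable_sq
    have h1 := charOfMeasure_comp μ₀ ν₀ hint hμν ξ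
    have h2 : char X.1 ξ = charOfMeasure μ₀ ξ := hX.1 ξ
    rw [hY.1, char, hval]
    simp only [huw] at h1
    rw [h2]
    exact h1
  have hU (ξ : ℝ) : State.U (he.toState Y) ξ = H1.val w (char X.1 ξ) := by
    rw [he.U_toState, hY.2.1, hy, hw]
  have h1 : (he.toState Y).1 = X.1 := V.ext_val fun ξ => by
    have := (he.char_toState Y ξ).trans (hy ξ)
    simpa only [char, add_right_inj] using this
  refine ⟨hc, e, B, he, Prod.ext h1 (Prod.ext (H1.ext_val fun ξ => ?_) (Lp.ext ?_))⟩
  · refine (hU ξ).trans ?_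
    rw [← huw]
    exact (hX.2.1 ξ).symm.trans (congrFun (E.U_eq (χ := χ) hc) ξ)
  · have h2 : V.der (he.compV Y.2.2) =ᵐ[volume] fun ξ => charDer e ξ - charDer X.1 ξ := by
      refine V.der_ae (F := fun ξ => char e ξ - char X.1 ξ) (fun ξ => ?_)
        ((isPrimitive_char e).sub (isPrimitive_char X.1))
      rw [he.val_compV, ← hy]
      exact hY.2.2 _
    have h3 := he.h_toState Y
    rw [h1] at h3
    refine h3.trans ?_
    -- As `H = id - y`, the relabeled `H_ξ` is `1 + u₀² y_ξ - y_ξ`; subtracting `U² y_ξ` leaves `1 -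
    -- y_ξ`, the initial `h`.
    filter_upwards [h2, hder, hX.2.2] with ξ e2 e3 e4
    have e5 : ((E.toState X).2.2 : ℝ → ℝ) ξ = 1 - charDer X.1 ξ := e4
    rw [e5, e2, hU, charDer, e3]
    ring

end

/-! ## Return to Eulerian coordinates -/

/-- The map `char ζ` need not be injective. Being proper and onto, it is a closed quotient map, so
continuity descends through it. This supplies the measurability of `u(t)`. -/
theorem continuous_of_comp_char {f g : ℝ → ℝ} (ζ : V) (hg : Continuous g)
    (h : ∀ ξ, f (char ζ ξ) = g ξ) : Continuous f := by
  have hc := continuous_char ζ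
  have hproper : IsProperMap (char ζ) := by
    rw [isProperMap_iff_tendsto_cocompact]
    refine ⟨hc, ?_⟩
    rw [cocompact_eq_atBot_atTop]
    exact (tendsto_char_atBot ζ).sup_sup (tendsto_char_atTop ζ)
  have hq := hproper.isClosedMap.isQuotientMap hc
    (hc.surjective (tendsto_char_atTop ζ) (tendsto_char_atBot ζ))
  rw [hq.continuous_iff]
  exact hg.congr fun ξ => (h ξ).symm

/-- Eulerian measures do not see labels: the density picks up the Jacobian of the relabeling, which
the change of variables absorbs. -/
theorem IsRelabeling.pushDensity_eq {e : V} {B : ℝ} (he : IsRelabeling e B) (Y : HR.E) :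
    pushDensity (HR.E.y Y) (HR.E.HDer Y) =
      pushDensity (char (he.toState Y).1) (V.der (he.compV Y.2.2)) := by
  have hm : Measurable fun η => ENNReal.ofReal (HR.E.HDer Y η) :=
    (Lp.stronglyMeasurable Y.2.2.1.2).measurable.ennreal_ofReal
  rw [pushDensity, pushDensity, ← he.isChange.map_withDensity hm,
    Measure.map_map (show Measurable (HR.E.y Y) from (continuous_char Y.1).measurable)
       (continuous_char e).measurable,
    show char (he.toState Y).1 = HR.E.y Y ∘ char e from funext (he.char_toState Y)]
  congr 1
  refine withDensity_congr_ae ?_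
  filter_upwards [he.der_compV Y.2.2, he.nonneg] with ξ h1 h2
  have h3 : 0 ≤ charDer e ξ := add_nonneg zero_le_one h2
  rw [h1, ENNReal.ofReal_mul' h3]
  rfl

/-- The comparison of the two energy measures at a given time. -/
theorem pushDensity_compare {Z : State} {H : V} {f : ℝ → ℝ}
    (hnn : ∀ᵐ ξ, 0 ≤ charDer Z.1 ξ ∧ 0 ≤ State.h Z ξ)
    (hH : State.h Z =ᵐ[volume] fun ξ => V.der H ξ - State.U Z ξ ^ 2 * charDer Z.1 ξ)
    (hf : ∀ ξ, f (char Z.1 ξ) = State.U Z ξ) :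
    IsFiniteMeasure (pushDensity (char Z.1) (State.h Z)) ∧
    IsFiniteMeasure (pushDensity (char Z.1) (V.der H)) ∧
    Integrable (fun z => f z ^ 2) ∧
    ∀ x, (pushDensity (char Z.1) (V.der H)).real (Iio x) -
      (pushDensity (char Z.1) (State.h Z)).real (Iio x) = ∫ z in Iio x, f z ^ 2 := by
  have hy : IsChange (char Z.1) (charDer Z.1) :=
    ⟨isPrimitive_char Z.1, hnn.mono fun _ h => h.1, tendsto_char_atBot _, tendsto_char_atTop _⟩
  have hfc : Continuous f := continuous_of_comp_char Z.1 Z.continuous_U hf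
  have hHnn : 0 ≤ᵐ[volume] V.der H := by
    filter_upwards [hnn, hH] with ξ h1 h2
    have h3 : 0 ≤ State.U Z ξ ^ 2 * charDer Z.1 ξ := mul_nonneg (sq_nonneg _) h1.1
    rw [Pi.zero_apply]; linarith [h1.2]
  have hHi : Integrable (V.der H) := by
    -- A bounded function with nonnegative derivative has total variation at most `2 ‖H‖`, hence an
    -- integrable derivative.
    refine integrable_of_intervalIntegral_norm_bounded (2 * ‖H‖) (a := fun n : ℕ => -(n : ℝ))
      (b := fun n : ℕ => (n : ℝ)) (l := atTop) (fun n => ?_)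
      (tendsto_neg_atTop_atBot.comp tendsto_natCast_atTop_atTop) tendsto_natCast_atTop_atTop
      (Eventually.of_forall fun n => ?_)
    · exact (intervalIntegrable_iff_integrableOn_Ioc_of_le
        (by linarith [Nat.cast_nonneg (α := ℝ) n])).1 (H.isPrimitive.intervalIntegrable _ _)
    · rw [intervalIntegral.integral_congr_ae (g := V.der H)
        (hHnn.mono fun ξ hξ _ => Real.norm_of_nonneg hξ), H.isPrimitive.integral_eq]
      have h1 := abs_le.1 (H.abs_val_le n)
      have h2 := abs_le.1 (H.abs_val_le (-n))
      linarith
  have hUm : AEStronglyMeasurable (fun ξ => State.U Z ξ ^ 2 * charDer Z.1 ξ) volume :=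
    Z.memLp_sq_mul_charDer.1
  have hUi : Integrable fun ξ => State.U Z ξ ^ 2 * charDer Z.1 ξ := by
    refine hHi.mono' hUm ?_
    filter_upwards [hnn, hH] with ξ h1 h2
    rw [Real.norm_of_nonneg (mul_nonneg (sq_nonneg _) h1.1)]
    linarith [h1.2]
  have hhi : Integrable (State.h Z) := (hHi.sub hUi).congr hH.symm
  have hfi : Integrable fun z => f z ^ 2 := by
    have h1 := (hy.integrableOn_comp (f := fun z => f z ^ 2) MeasurableSet.univ
      (hfc.pow 2).aestronglyMeasurable).1
    simp only [preimage_univ, integrableOn_univ, hf] at h1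
    exact h1 hUi
  -- The splitting `H_ξ = h + U² y_ξ` passes through `ENNReal.ofReal` because both terms are
  -- nonnegative; the second is carried by `y` to `f² dx`.
  have hmeas : pushDensity (char Z.1) (V.der H) = pushDensity (char Z.1) (State.h Z) +
      volume.withDensity fun z => ENNReal.ofReal (f z ^ 2) := by
    have hf2 : Measurable fun z => ENNReal.ofReal (f z ^ 2) :=
      (hfc.pow 2).measurable.ennreal_ofReal
    have hhm : Measurable fun ξ => ENNReal.ofReal (State.h Z ξ) :=
      (Lp.stronglyMeasurable Z.2.2).measurable.ennreal_ofReal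
    rw [← hy.map_withDensity hf2, pushDensity, pushDensity, ← Measure.map_add _ _ hy.measurable,
      ← withDensity_add_left hhm]
    congr 1
    refine withDensity_congr_ae ?_
    filter_upwards [hnn, hH] with ξ h1 h2
    rw [Pi.add_apply, hf, ← ENNReal.ofReal_mul (sq_nonneg _),
      ← ENNReal.ofReal_add h1.2 (mul_nonneg (sq_nonneg _) h1.1), h2]
    congr 1; ring
  have fin (g : ℝ → ℝ) (hg : Integrable g) : IsFiniteMeasure (pushDensity (char Z.1) g) := by
    have := isFiniteMeasure_withDensity_ofReal hg.2
    exact Measure.isFiniteMeasure_map _ _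
  have i1 := fin _ hhi
  have i2 := isFiniteMeasure_withDensity_ofReal hfi.2
  refine ⟨i1, fin _ hHi, hfi, fun x => ?_⟩
  rw [hmeas, measureReal_add_apply, add_sub_cancel_left, measureReal_def,
    withDensity_apply _ measurableSet_Iio, integral_eq_lintegral_of_nonneg_ae
      (Eventually.of_forall fun z => sq_nonneg _) (hfc.pow 2).aestronglyMeasurable]

end CamassaHolm

end

theorem mainTheorem5 (χ : ℝ → ℝ) (hχ : CamassaHolm.IsPartitionFunction χ)
    (u₀ v₀ : ℝ → ℝ) (μ₀ ν₀ : Measure ℝ)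
    (h₀ : CamassaHolm.IsEulerian χ u₀ μ₀) (h₀' : CamassaHolm.HR.IsEulerian v₀ ν₀)
    (huv : ∀ x, u₀ x = v₀ x)
    (hμν : ∀ x, ν₀.real (Iio x) - μ₀.real (Iio x) = ∫ z in Iio x, u₀ z ^ 2)
    (u v : ℝ → ℝ → ℝ) (μ ν : ℝ → Measure ℝ)
    (hu : CamassaHolm.IsConservativeSolution χ u₀ μ₀ u μ)
    (hv : CamassaHolm.HR.IsConservativeSolution v₀ ν₀ v ν) :
    ∀ t : ℝ, 0 ≤ t →
      (∀ x, u t x = v t x) ∧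
      IsFiniteMeasure (μ t) ∧ IsFiniteMeasure (ν t) ∧ Integrable (fun z => u t z ^ 2) ∧
      ∀ x, (ν t).real (Iio x) - (μ t).real (Iio x) = ∫ z in Iio x, u t z ^ 2 := by
  open CamassaHolm in
  intro t ht
  obtain ⟨X, hXs, hX0, hXe⟩ := hu
  obtain ⟨Y, hYs, hY0, hYe⟩ := hv
  have := h₀.1
  have := h₀'.1
  obtain ⟨hc, e, B, he, heq⟩ := exists_toState_eq hχ hX0 h₀' huv hμν hY0
  have hsol := hXs.isSolution hχ hc
  -- The relabeling chosen at time `0` serves for all times: both curves solve the same system with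
  -- the same initial state.
  have hZ : he.toState (Y t) = E.toState (X t) := (he.isSolution hYs).unique hsol heq t ht
  have hct := hXs.c_eq_zero hχ hc ht
  have hnn := hsol.nonneg (hX0.mul_eq hχ h₀ hc) hX0.add_nonneg ht
  have hut (ξ : ℝ) : u t (char (E.toState (X t)).1 ξ) = State.U (E.toState (X t)) ξ :=
    ((hXe t ht).1 _ ξ rfl).trans (congrFun (E.U_eq hct) ξ)
  have hvt (ξ : ℝ) : v t (char (E.toState (X t)).1 ξ) = State.U (E.toState (X t)) ξ := by
    rw [← hZ, he.char_toState, (hYe t ht).1 _ _ rfl, he.U_toState]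
  refine ⟨fun x => ?_, ?_⟩
  · obtain ⟨ξ, rfl⟩ := (continuous_char (E.toState (X t)).1).surjective
      (tendsto_char_atTop _) (tendsto_char_atBot _) x
    rw [hut, hvt]
  · have hH := he.h_toState (Y t)
    rw [hZ] at hH
    have key := pushDensity_compare hnn hH hut
    have hμt : μ t = pushDensity (char (E.toState (X t)).1) (State.h (E.toState (X t))) :=
      (hXe t ht).2
    have hνt : ν t = pushDensity (char (E.toState (X t)).1) (V.der (he.compV (Y t).2.2)) := by
      rw [(hYe t ht).2, he.pushDensity_eq, hZ]
    rw [hμt, hνt]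
    exact key
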